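/- **Conventions.** All graded vector spaces are $\mathbb Z$-graded real vector spaces; $|a|$ is the degree of a homogeneous $a$ and $\deg(a)=|a|-1$ its degree in the shifted space $V[1]$. A *Gerstenhaber algebra* $G$ is a graded vector space with an associative graded commutative product of degree $0$ (no unit required) and a bracket of degree $-1$ such that $(G[1],[\,,])$ is a graded Lie algebra and $[a,bc]=[a,b]c+(-1)^{|b|\deg(a)}b[a,c]$. A *$G$-module* $M$ is a graded vector space with an associative product $G\times M\to M$ of degree $0$, $(a,u)\mapsto au$ (and $ua:=(-1)^{|a||u|}au$), and an action $(a,u)\mapsto a\bullet u$ of the graded Lie algebra $G[1]$ on $M[1]$ (so $|a\bullet u|=|a|+|u|-1$), such that $$[a,b]u=a\bullet(bu)-(-1)^{|b|\deg(a)}b(a\bullet u),\qquad (ab)\bullet u=a(b\bullet u)+(-1)^{|a||b|}b(a\bullet u).$$ The semidirect product $G\ltimes M=G\oplus M$ is the Gerstenhaber algebra with $(a+u)(b+v)=ab+av+ub$ and $[a+u,b+v]=[a,b]+a\bullet v-(-1)^{\deg(b)\deg(u)}b\bullet u$. For a Gerstenhaber algebra $B$ let $\mathrm{Bat}(p,q)$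 be the set of permutations of $\{1,\dots,p+q\}$ that are increasing on $\{1,\dots,p\}$ and on $\{p+1,\dots,p+q\}$, and let $\varepsilon$ denote Koszul signs. Let $\mathcal H=\bigoplus_{n\ge1}\underline{\otimes}^nB[1]$, where $\underline\otimes^nB[1]$ is the quotient of $\otimes^nB[1]$ by all shuffle products $$\sum_{\sigma\in \mathrm{Bat}(p,n-p)}\varepsilon_{\deg(a)}(\sigma^{-1})\,a_{\sigma^{-1}(1)}\otimes\cdots\otimes a_{\sigma^{-1}(n)},\qquad 0<p<n.$$ For the class $X$ of $a_1\otimes\cdots\otimes a_p$, its degree in $\mathcal H[1]$ is $\deg(X)=\sum_k\deg(a_k)-1$. Put $$m(X)=\sum_{j=1}^{p-1}(-1)^{\sum_{i\le j}\deg(a_i)}\,\underline{a_1\otimes\cdots\otimes a_ja_{j+1}\otimes\cdots\otimes a_p},$$ and, if $b_1,\dots,b_{p+q}$ are the letters of $X$ followed by the letters of a word $Y$ of length $q$, $$\ell(X,Y)=(-1)^{\deg(X)}\sum_{\sigma\in\mathrm{Bat}(p,q)}\ \sum_{k:\ \sigma^{-1}(k)\le p<\sigma^{-1}(k+1)}\varepsilon_{\deg(b)}(\sigma^{-1})\,\underline{b_{\sigma^{-1}(1)}\otimes\cdots\otimes[b_{\sigma^{-1}(k)},b_{\sigma^{-1}(k+1)}]\otimes\cdots\otimes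 b_{\sigma^{-1}(p+q)}}.$$ Let $G_\infty(B)=\bigoplus_{n\ge1}S^n(\mathcal H[1])$ (graded symmetric powers, inside the graded symmetric algebra with product $\cdot$), and let $C_N(B)\subset G_\infty(B)$ be the span of the products $X_1\cdots X_r$ ($r\ge1$) of classes of nonempty words with $N$ letters in total. **Proposition (expression of the Chevalley–Harrison boundary).** Let $G$ be a Gerstenhaber algebra and $M$ a $G$-module, and take $B=G\ltimes M$. (a) There are unique linear maps $m$, $\ell$ on $S(\mathcal H[1])$ (extended by $0$ to $S^0$) such that, for all words, $$m(X_1\cdots X_n)=\sum_{j}(-1)^{\sum_{k<j}\deg(X_k)}X_1\cdots m(X_j)\cdots X_n,$$ $$\ell(X_1\cdots X_n)=\sum_{i<j}\varepsilon_{\deg(X)}\!\left(\begin{smallmatrix}1\ \dots\ n\\ i,j,1,\dots\hat\imath\dots\hat\jmath\dots,n\end{smallmatrix}\right)\ell(X_i,X_j)\cdot X_1\cdots\hat\imath\cdots\hat\jmath\cdots X_n .$$ The map $m+\ell$ preserves $G_\infty(G\ltimes M)$, $(m+\ell)^2=0$, and $m+\ell$ maps $C_{N+1}(G\ltimes M)$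 into $C_N(G\ltimes M)$ for all $N\ge 0$ (with $C_0(G\ltimes M)=0$). (b) For $N\ge0$ let $C_N(G,M)$ be the span of the products $X_1\cdots X_r\cdot Y$ with $r\ge0$, where the $X_i$ are classes of nonempty words in $G$, $Y=\underline{a_1\otimes\cdots\otimes a_k\otimes v\otimes a_{k+1}\otimes\cdots\otimes a_p}$ with $a_1,\dots,a_p\in G$, $v\in M$, and the total number of letters from $G$ is $N$. Then $C_N(G,M)\subset C_{N+1}(G\ltimes M)$, and these subspaces form a subcomplex of $(G_\infty(G\ltimes M),m+\ell)$: $m+\ell$ maps $C_{N+1}(G,M)$ into $C_N(G,M)$ and vanishes on $C_0(G,M)$. (c) The boundary $\partial=m+\ell$ of this subcomplex is given, for $X_1\cdots X_r\cdot Y$ as in (b), by $$\begin{aligned}\partial(X_1\cdots X_r\cdot Y)={}&(\ell+m)(X_1\cdots X_r)\cdot Y+(-1)^{\sum_i\deg(X_i)}X_1\cdots X_r\cdot m(Y)\\&+\sum_i(-1)^{\sum_{j\ne i}\deg(X_j)}\,\varepsilon_{\deg(X)}\!\left(\begin{smallmatrix}1,\dots,r\\ 1,\dots\hat\imath\dots,r,i\end{smallmatrix}\right)X_1\cdots\hat\imath\cdots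 X_r\cdot\ell(X_i,Y).\end{aligned}$$ -/

import Mathlib

noncomputable section

set_option linter.unusedSimpArgs false

/-! Graded real vector spaces are given by a family of submodules `𝒱 i`, `i : ℤ`, of a real vector
space with `DirectSum.IsInternal 𝒱`.  For `a ∈ 𝒱 i` we write `|a| = i` and `deg a = i - 1`
(the degree of `a` in `V[1]`). -/

section Graded

variable {V W N : Type*} [AddCommGroup V] [Module ℝ V] [AddCommGroup W] [Module ℝ W]
  [AddCommGroup N] [Module ℝ N]

/-- The linear map on an internally graded space with prescribed restrictions to the pieces. -/
def gradedLift {𝒱 : ℤ → Submodule ℝ V} (h : DirectSum.IsInternal 𝒱) (φ : ∀ i, 𝒱 i →ₗ[ℝ] N) :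
    V →ₗ[ℝ] N :=
  (DirectSum.toModule ℝ ℤ N φ).comp
    (LinearEquiv.ofBijective (DirectSum.coeLinearMap 𝒱) h).symm.toLinearMap

theorem gradedLift_of_mem {𝒱 : ℤ → Submodule ℝ V} (h : DirectSum.IsInternal 𝒱)
    (φ : ∀ i, 𝒱 i →ₗ[ℝ] N) {i : ℤ} {a : V} (ha : a ∈ 𝒱 i) : gradedLift h φ a = φ i ⟨a, ha⟩ := by
  have key : (LinearEquiv.ofBijective (DirectSum.coeLinearMap 𝒱) h).symm a
      = DirectSum.lof ℝ ℤ (fun i => 𝒱 i) i ⟨a, ha⟩ := by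
    rw [LinearEquiv.symm_apply_eq]
    exact (DirectSum.coeLinearMap_lof 𝒱 i ⟨a, ha⟩).symm
  simp [gradedLift, key]

/-- The flip `b, a ↦ (-1)^((|a| - s) * (|b| - s)) f a b` of a bilinear map, following the sign rule
for degrees shifted by `s`. -/
def gradedFlip {𝒱 : ℤ → Submodule ℝ V} (hV : DirectSum.IsInternal 𝒱)
    {𝒲 : ℤ → Submodule ℝ W} (hW : DirectSum.IsInternal 𝒲) (s : ℤ) (f : V →ₗ[ℝ] W →ₗ[ℝ] N) :
    W →ₗ[ℝ] V →ₗ[ℝ] N :=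
  gradedLift hW fun j => LinearMap.flip
    (gradedLift hV fun i =>
      ((-1 : ℝ) ^ ((i - s) * (j - s))) • ((f.domRestrict (𝒱 i)).compl₂ (𝒲 j).subtype))

theorem gradedFlip_of_mem {𝒱 : ℤ → Submodule ℝ V} (hV : DirectSum.IsInternal 𝒱)
    {𝒲 : ℤ → Submodule ℝ W} (hW : DirectSum.IsInternal 𝒲) (s : ℤ) (f : V →ₗ[ℝ] W →ₗ[ℝ] N)
    {i j : ℤ} {a : V} {b : W} (ha : a ∈ 𝒱 i) (hb : b ∈ 𝒲 j) :
    gradedFlip hV hW s f b a = ((-1 : ℝ) ^ ((i - s) * (j - s))) • f a b := by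
  rw [gradedFlip, gradedLift_of_mem hW _ hb, LinearMap.flip_apply, gradedLift_of_mem hV _ ha]
  simp

theorem isInternal_prod {𝒱 : ℤ → Submodule ℝ V} (hV : DirectSum.IsInternal 𝒱)
    {𝒲 : ℤ → Submodule ℝ W} (hW : DirectSum.IsInternal 𝒲) :
    DirectSum.IsInternal fun i => (𝒱 i).prod (𝒲 i) := by
  rw [DirectSum.isInternal_submodule_iff_iSupIndep_and_iSup_eq_top] at *
  constructor
  · intro i
    have hle : (⨆ j, ⨆ (_ : j ≠ i), (𝒱 j).prod (𝒲 j)) ≤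
        (⨆ j, ⨆ (_ : j ≠ i), 𝒱 j).prod (⨆ j, ⨆ (_ : j ≠ i), 𝒲 j) :=
      iSup₂_le fun j hj => Submodule.prod_mono (le_iSup₂_of_le j hj le_rfl)
        (le_iSup₂_of_le j hj le_rfl)
    refine Disjoint.mono_right hle ?_
    rw [Submodule.disjoint_def]
    rintro ⟨a, b⟩ ⟨h1, h2⟩ ⟨h3, h4⟩
    exact Prod.ext (Submodule.disjoint_def.1 (hV.1 i) a h1 h3)
      (Submodule.disjoint_def.1 (hW.1 i) b h2 h4)
  · rw [eq_top_iff]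
    rintro ⟨a, b⟩ -
    have h1 : Submodule.map (LinearMap.inl ℝ V W) (⨆ i, 𝒱 i) ≤ ⨆ i, (𝒱 i).prod (𝒲 i) := by
      rw [Submodule.map_iSup]
      refine iSup_mono fun i => ?_
      rintro _ ⟨x, hx, rfl⟩
      exact ⟨hx, Submodule.zero_mem _⟩
    have h2 : Submodule.map (LinearMap.inr ℝ V W) (⨆ i, 𝒲 i) ≤ ⨆ i, (𝒱 i).prod (𝒲 i) := by
      rw [Submodule.map_iSup]
      refine iSup_mono fun i => ?_
      rintro _ ⟨x, hx, rfl⟩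
      exact ⟨Submodule.zero_mem _, hx⟩
    have e : ((a, b) : V × W) = LinearMap.inl ℝ V W a + LinearMap.inr ℝ V W b := by simp
    rw [e]
    exact Submodule.add_mem _ (h1 ⟨a, by simp [hV.2], rfl⟩) (h2 ⟨b, by simp [hW.2], rfl⟩)

end Graded

/-- A Gerstenhaber algebra: an associative graded commutative product of degree `0` (no unit is
required) and a bracket of degree `-1` which is a graded Lie bracket on `G[1]` and satisfies the
graded Leibniz rule. -/
structure GerstenhaberAlgebra (G : Type*) [AddCommGroup G] [Module ℝ G] where
  grade : ℤ → Submodule ℝ G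
  isInternal : DirectSum.IsInternal grade
  mul : G →ₗ[ℝ] G →ₗ[ℝ] G
  bracket : G →ₗ[ℝ] G →ₗ[ℝ] G
  mul_mem : ∀ {i j : ℤ} {a b : G}, a ∈ grade i → b ∈ grade j → mul a b ∈ grade (i + j)
  bracket_mem : ∀ {i j : ℤ} {a b : G}, a ∈ grade i → b ∈ grade j →
    bracket a b ∈ grade (i + j - 1)
  mul_comm : ∀ {i j : ℤ} {a b : G}, a ∈ grade i → b ∈ grade j →
    mul a b = ((-1 : ℝ) ^ (i * j)) • mul b a
  mul_assoc : ∀ {i j k : ℤ} {a b c : G}, a ∈ grade i → b ∈ grade j → c ∈ grade k →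
    mul (mul a b) c = mul a (mul b c)
  antisymm : ∀ {i j : ℤ} {a b : G}, a ∈ grade i → b ∈ grade j →
    bracket a b = -(((-1 : ℝ) ^ ((i - 1) * (j - 1))) • bracket b a)
  jacobi : ∀ {i j k : ℤ} {a b c : G}, a ∈ grade i → b ∈ grade j → c ∈ grade k →
    ((-1 : ℝ) ^ ((i - 1) * (k - 1))) • bracket (bracket a b) c
      + ((-1 : ℝ) ^ ((j - 1) * (i - 1))) • bracket (bracket b c) a
      + ((-1 : ℝ) ^ ((k - 1) * (j - 1))) • bracket (bracket c a) b = 0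
  leibniz : ∀ {i j k : ℤ} {a b c : G}, a ∈ grade i → b ∈ grade j → c ∈ grade k →
    bracket a (mul b c) = mul (bracket a b) c + ((-1 : ℝ) ^ (j * (i - 1))) • mul b (bracket a c)

/-- A module over a Gerstenhaber algebra: a graded vector space with a product `smul a u = a u`
(the right product being `u a = (-1)^(|a||u|) a u`), making it a symmetric bimodule over the
commutative algebra `G`, and an action `act a u` of the graded Lie algebra `G[1]` on `M[1]`,
with the two Leibniz compatibilities. -/
structure GerstenhaberModule {G : Type*} [AddCommGroup G] [Module ℝ G]
    (A : GerstenhaberAlgebra G) (M : Type*) [AddCommGroup M] [Module ℝ M] where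
  grade : ℤ → Submodule ℝ M
  isInternal : DirectSum.IsInternal grade
  smul : G →ₗ[ℝ] M →ₗ[ℝ] M
  act : G →ₗ[ℝ] M →ₗ[ℝ] M
  smul_mem : ∀ {i j : ℤ} {a : G} {u : M}, a ∈ A.grade i → u ∈ grade j → smul a u ∈ grade (i + j)
  act_mem : ∀ {i j : ℤ} {a : G} {u : M}, a ∈ A.grade i → u ∈ grade j →
    act a u ∈ grade (i + j - 1)
  mul_smul : ∀ {i j k : ℤ} {a b : G} {u : M}, a ∈ A.grade i → b ∈ A.grade j → u ∈ grade k →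
    smul (A.mul a b) u = smul a (smul b u)
  bracket_act : ∀ {i j k : ℤ} {a b : G} {u : M}, a ∈ A.grade i → b ∈ A.grade j → u ∈ grade k →
    act (A.bracket a b) u = act a (act b u) - ((-1 : ℝ) ^ ((i - 1) * (j - 1))) • act b (act a u)
  bracket_smul : ∀ {i j k : ℤ} {a b : G} {u : M}, a ∈ A.grade i → b ∈ A.grade j → u ∈ grade k →
    smul (A.bracket a b) u = act a (smul b u) - ((-1 : ℝ) ^ (j * (i - 1))) • smul b (act a u)
  mul_act : ∀ {i j k : ℤ} {a b : G} {u : M}, a ∈ A.grade i → b ∈ A.grade j → u ∈ grade k →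
    act (A.mul a b) u = smul a (act b u) + ((-1 : ℝ) ^ (i * j)) • smul b (act a u)

namespace GerstenhaberModule

variable {G M : Type*} [AddCommGroup G] [Module ℝ G] [AddCommGroup M] [Module ℝ M]
  {A : GerstenhaberAlgebra G} (P : GerstenhaberModule A M)

/-- `(a + u)(b + v) = ab + av + ub`, with `u b = (-1)^(|b||u|) b u`. -/
def sdMul : G × M →ₗ[ℝ] G × M →ₗ[ℝ] G × M :=
  LinearMap.mk₂ ℝ
    (fun x y => (A.mul x.1 y.1, P.smul x.1 y.2 + gradedFlip A.isInternal P.isInternal 0 P.smul x.2 y.1))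
    (by intros; ext <;> simp; abel) (by intros; ext <;> simp)
    (by intros; ext <;> simp; abel) (by intros; ext <;> simp)

/-- `[a + u, b + v] = [a, b] + a • v - (-1)^(deg b * deg u) b • u`. -/
def sdBracket : G × M →ₗ[ℝ] G × M →ₗ[ℝ] G × M :=
  LinearMap.mk₂ ℝ
    (fun x y => (A.bracket x.1 y.1, P.act x.1 y.2 - gradedFlip A.isInternal P.isInternal 1 P.act x.2 y.1))
    (by intros; ext <;> simp; abel) (by intros; ext <;> simp [smul_sub])
    (by intros; ext <;> simp; abel) (by intros; ext <;> simp [smul_sub])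

theorem sdMul_apply (x y : G × M) : P.sdMul x y = (A.mul x.1 y.1,
    P.smul x.1 y.2 + gradedFlip A.isInternal P.isInternal 0 P.smul x.2 y.1) := rfl

theorem sdBracket_apply (x y : G × M) : P.sdBracket x y = (A.bracket x.1 y.1,
    P.act x.1 y.2 - gradedFlip A.isInternal P.isInternal 1 P.act x.2 y.1) := rfl

theorem neg_one_zpow_eq (n : ℤ) : (-1 : ℝ) ^ n = if Even n then 1 else -1 := by
  split_ifs with h
  · exact h.neg_one_zpow
  · exact (Int.not_even_iff_odd.1 h).neg_one_zpow

/-- The semidirect product `G ⋉ M`, as a Gerstenhaber algebra. -/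
def semidirect : GerstenhaberAlgebra (G × M) where
  grade := fun i => (A.grade i).prod (P.grade i)
  isInternal := isInternal_prod A.isInternal P.isInternal
  mul := P.sdMul
  bracket := P.sdBracket
  mul_mem := by
    rintro i j ⟨a, u⟩ ⟨b, v⟩ ⟨ha, hu⟩ ⟨hb, hv⟩
    refine ⟨A.mul_mem ha hb, ?_⟩
    simp only [sdMul_apply, gradedFlip_of_mem A.isInternal P.isInternal _ _ hb hu]
    refine Submodule.add_mem _ (P.smul_mem ha hv) (Submodule.smul_mem _ _ ?_)
    rw [add_comm i j]
    exact P.smul_mem hb hu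
  bracket_mem := by
    rintro i j ⟨a, u⟩ ⟨b, v⟩ ⟨ha, hu⟩ ⟨hb, hv⟩
    refine ⟨A.bracket_mem ha hb, ?_⟩
    simp only [sdBracket_apply, gradedFlip_of_mem A.isInternal P.isInternal _ _ hb hu]
    refine Submodule.sub_mem _ (P.act_mem ha hv) (Submodule.smul_mem _ _ ?_)
    rw [add_comm i j]
    exact P.act_mem hb hu
  mul_comm := by
    rintro i j ⟨a, u⟩ ⟨b, v⟩ ⟨ha, hu⟩ ⟨hb, hv⟩
    simp only [sdMul_apply, gradedFlip_of_mem A.isInternal P.isInternal _ _ hb hu,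
      gradedFlip_of_mem A.isInternal P.isInternal _ _ ha hv]
    refine Prod.ext (A.mul_comm ha hb) ?_
    by_cases hi : Even i <;> by_cases hj : Even j <;>
      simp [neg_one_zpow_eq, Int.even_mul, hi, hj, add_comm]
  mul_assoc := by
    rintro i j k ⟨a, u⟩ ⟨b, v⟩ ⟨c, w⟩ ⟨ha, hu⟩ ⟨hb, hv⟩ ⟨hc, hw⟩
    have e1 := P.mul_smul ha hb hw
    have e2 : P.smul c (P.smul a v) = ((-1 : ℝ) ^ (k * i)) • P.smul a (P.smul c v) := by
      rw [← P.mul_smul hc ha hv, ← P.mul_smul ha hc hv, A.mul_comm hc ha, map_smul,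
        LinearMap.smul_apply]
    have e3 : P.smul (A.mul b c) u = ((-1 : ℝ) ^ (j * k)) • P.smul c (P.smul b u) := by
      rw [A.mul_comm hb hc, map_smul, LinearMap.smul_apply, P.mul_smul hc hb hu]
    refine Prod.ext (A.mul_assoc ha hb hc) ?_
    simp only [sdMul_apply, gradedFlip_of_mem A.isInternal P.isInternal _ _ hb hu,
      gradedFlip_of_mem A.isInternal P.isInternal _ _ hc hv, map_add, map_smul,
      LinearMap.add_apply, LinearMap.smul_apply,
      gradedFlip_of_mem A.isInternal P.isInternal _ _ hc (P.smul_mem ha hv),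
      gradedFlip_of_mem A.isInternal P.isInternal _ _ hc (P.smul_mem hb hu),
      gradedFlip_of_mem A.isInternal P.isInternal _ _ (A.mul_mem hb hc) hu, e1, e2, e3]
    by_cases hi : Even i <;> by_cases hj : Even j <;> by_cases hk : Even k <;>
      simp only [neg_one_zpow_eq, Int.even_mul, Int.even_sub, Int.even_add, Int.not_even_one,
        sub_zero, hi, hj, hk, iff_true, iff_false, not_true_eq_false, not_false_eq_true, or_true,
        or_false, true_or, or_self, if_true, if_false] <;> module
  antisymm := by
    rintro i j ⟨a, u⟩ ⟨b, v⟩ ⟨ha, hu⟩ ⟨hb, hv⟩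
    simp only [sdBracket_apply, gradedFlip_of_mem A.isInternal P.isInternal _ _ hb hu,
      gradedFlip_of_mem A.isInternal P.isInternal _ _ ha hv]
    refine Prod.ext (A.antisymm ha hb) ?_
    by_cases hi : Even i <;> by_cases hj : Even j <;>
      simp only [neg_one_zpow_eq, sub_zero, Int.even_mul, Int.even_sub, Int.not_even_one, hi, hj, iff_true,
        iff_false, not_true_eq_false, not_false_eq_true, or_true, or_false, true_or, or_self,
        if_true, if_false, Prod.snd_neg, Prod.smul_snd] <;> module
  jacobi := by
    rintro i j k ⟨a, u⟩ ⟨b, v⟩ ⟨c, w⟩ ⟨ha, hu⟩ ⟨hb, hv⟩ ⟨hc, hw⟩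
    have e1 := P.bracket_act ha hb hw
    have e2 := P.bracket_act hb hc hu
    have e3 := P.bracket_act hc ha hv
    refine Prod.ext (A.jacobi ha hb hc) ?_
    simp only [sdBracket_apply, gradedFlip_of_mem A.isInternal P.isInternal _ _ hb hu,
      gradedFlip_of_mem A.isInternal P.isInternal _ _ hc hv,
      gradedFlip_of_mem A.isInternal P.isInternal _ _ ha hw, map_sub, map_smul,
      LinearMap.sub_apply, LinearMap.smul_apply,
      gradedFlip_of_mem A.isInternal P.isInternal _ _ hc (P.act_mem ha hv),
      gradedFlip_of_mem A.isInternal P.isInternal _ _ hc (P.act_mem hb hu),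
      gradedFlip_of_mem A.isInternal P.isInternal _ _ ha (P.act_mem hb hw),
      gradedFlip_of_mem A.isInternal P.isInternal _ _ ha (P.act_mem hc hv),
      gradedFlip_of_mem A.isInternal P.isInternal _ _ hb (P.act_mem hc hu),
      gradedFlip_of_mem A.isInternal P.isInternal _ _ hb (P.act_mem ha hw), e1, e2, e3,
      Prod.snd_add, Prod.smul_snd, Prod.snd_zero]
    by_cases hi : Even i <;> by_cases hj : Even j <;> by_cases hk : Even k <;>
      simp only [neg_one_zpow_eq, Int.even_mul, Int.even_sub, Int.even_add, Int.not_even_one,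
        sub_zero, hi, hj, hk, iff_true, iff_false, not_true_eq_false, not_false_eq_true, or_true,
        or_false, true_or, or_self, if_true, if_false] <;> module
  leibniz := by
    rintro i j k ⟨a, u⟩ ⟨b, v⟩ ⟨c, w⟩ ⟨ha, hu⟩ ⟨hb, hv⟩ ⟨hc, hw⟩
    have e1 := P.bracket_smul ha hb hw
    have e2 := P.bracket_smul ha hc hv
    have e3 := P.mul_act hb hc hu
    refine Prod.ext (A.leibniz ha hb hc) ?_
    simp only [sdMul_apply, sdBracket_apply,
      gradedFlip_of_mem A.isInternal P.isInternal _ _ hb hu,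
      gradedFlip_of_mem A.isInternal P.isInternal _ _ hc hv,
      gradedFlip_of_mem A.isInternal P.isInternal _ _ hc hu, map_add, map_sub, map_smul,
      LinearMap.add_apply, LinearMap.sub_apply, LinearMap.smul_apply,
      gradedFlip_of_mem A.isInternal P.isInternal _ _ hc (P.act_mem ha hv),
      gradedFlip_of_mem A.isInternal P.isInternal _ _ hc (P.act_mem hb hu),
      gradedFlip_of_mem A.isInternal P.isInternal _ _ (A.bracket_mem ha hc) hv,
      gradedFlip_of_mem A.isInternal P.isInternal _ _ (A.mul_mem hb hc) hu, e1, e2, e3,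
      Prod.snd_add, Prod.smul_snd]
    by_cases hi : Even i <;> by_cases hj : Even j <;> by_cases hk : Even k <;>
      simp only [neg_one_zpow_eq, Int.even_mul, Int.even_sub, Int.even_add, Int.not_even_one,
        sub_zero, hi, hj, hk, iff_true, iff_false, not_true_eq_false, not_false_eq_true, or_true,
        or_false, true_or, or_self, if_true, if_false] <;> module

end GerstenhaberModule

section Words

variable {V : Type*} [AddCommGroup V] [Module ℝ V] (𝒱 : ℤ → Submodule ℝ V)

/-- A homogeneous element together with its degree. -/
abbrev Letter := Σ i : ℤ, 𝒱 i

variable {𝒱}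

/-- `deg a = |a| - 1`. -/
def letterDeg (a : Letter 𝒱) : ℤ := a.1 - 1

/-- The degree in `𝓗[1]` of the word `a₁ ⊗ ⋯ ⊗ a_p`, namely `deg a₁ + ⋯ + deg a_p - 1`. -/
def wordDeg (w : List (Letter 𝒱)) : ℤ := (w.map letterDeg).sum - 1

/-- The tensor `a₁ ⊗ ⋯ ⊗ a_p`. -/
def tens (w : List (Letter 𝒱)) : TensorAlgebra ℝ V :=
  (w.map fun a => TensorAlgebra.ι ℝ (a.2 : V)).prod

/-- The word `b_{σ⁻¹(1)}, …, b_{σ⁻¹(n)}`. -/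
def permuteWord (b : List (Letter 𝒱)) (σ : Equiv.Perm (Fin b.length)) : List (Letter 𝒱) :=
  List.ofFn fun k => b.get (σ⁻¹ k)

/-- The Koszul sign `ε_{deg b}(σ⁻¹)` of the passage from `b₁, …, b_n` to
`b_{σ⁻¹(1)}, …, b_{σ⁻¹(n)}`: a factor `(-1)^(deg b_i * deg b_j)` for each pair that gets
interchanged. -/
def koszulSign (b : List (Letter 𝒱)) (σ : Equiv.Perm (Fin b.length)) : ℝ :=
  ∏ i, ∏ j, if i < j ∧ σ j < σ i then
    (-1 : ℝ) ^ (letterDeg (b.get i) * letterDeg (b.get j)) else 1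

/-- `Bat(p, n - p)`: permutations increasing on the first `p` indices and on the other ones. -/
def shuffles (p n : ℕ) : Finset (Equiv.Perm (Fin n)) :=
  Finset.univ.filter fun σ => ∀ i j : Fin n, i < j → ((j : ℕ) < p ∨ p ≤ (i : ℕ)) → σ i < σ j

/-- The shuffle product `bat_{p,q}(x, y)` of two words, with respect to the degrees `deg`. -/
def shuffleProd (x y : List (Letter 𝒱)) : TensorAlgebra ℝ V :=
  ∑ σ ∈ shuffles x.length (x ++ y).length,
    koszulSign (x ++ y) σ • tens (permuteWord (x ++ y) σ)

variable (𝒱)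

/-- The subspace of the tensor algebra spanned by the scalars (so that only tensors of length
`≥ 1` remain in the quotient) and by the shuffle products of nonempty words. -/
def shuffleRel : Submodule ℝ (TensorAlgebra ℝ V) :=
  Submodule.span ℝ ({1} ∪ {t | ∃ x y : List (Letter 𝒱), x ≠ [] ∧ y ≠ [] ∧ t = shuffleProd x y})

/-- `𝓗 = ⨁_{n ≥ 1} ⊗ⁿ V[1] / (shuffles)`. -/
abbrev ShuffleQuot := TensorAlgebra ℝ V ⧸ shuffleRel 𝒱

/-- The relations `X · Y = (-1)^(deg X * deg Y) Y · X` of graded commutativity on `𝓗[1]`. -/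
def symRel (s t : TensorAlgebra ℝ (ShuffleQuot 𝒱)) : Prop :=
  ∃ x y : List (Letter 𝒱),
    s = TensorAlgebra.ι ℝ ((shuffleRel 𝒱).mkQ (tens x)) *
        TensorAlgebra.ι ℝ ((shuffleRel 𝒱).mkQ (tens y)) ∧
    t = ((-1 : ℝ) ^ (wordDeg x * wordDeg y)) •
        (TensorAlgebra.ι ℝ ((shuffleRel 𝒱).mkQ (tens y)) *
        TensorAlgebra.ι ℝ ((shuffleRel 𝒱).mkQ (tens x)))

/-- The graded symmetric algebra `S(𝓗[1]) = ⨁_{n ≥ 0} Sⁿ(𝓗[1])`. -/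
abbrev SymH := RingQuot (symRel 𝒱)

/-- The projection of a tensor to `𝓗[1] = S¹(𝓗[1])`. -/
def proj : TensorAlgebra ℝ V →ₗ[ℝ] SymH 𝒱 :=
  (RingQuot.mkAlgHom ℝ (symRel 𝒱)).toLinearMap ∘ₗ TensorAlgebra.ι ℝ ∘ₗ (shuffleRel 𝒱).mkQ

variable {𝒱}

/-- The product `X₁ · ⋯ · X_n` in `S(𝓗[1])` of the classes of the words `X₁, …, X_n`. -/
def symProd (X : List (List (Letter 𝒱))) : SymH 𝒱 := (X.map fun x => proj 𝒱 (tens x)).prod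

end Words

namespace GerstenhaberAlgebra

variable {G : Type*} [AddCommGroup G] [Module ℝ G] (A : GerstenhaberAlgebra G)

/-- `m(a₁ ⊗ ⋯ ⊗ a_n) = ∑_j (-1)^(∑_{i<j} deg a_i) a₁ ⊗ ⋯ ⊗ m(a_j ⊗ a_{j+1}) ⊗ ⋯ ⊗ a_n`,
where `m(a ⊗ b) = (-1)^(deg a) a b`; the two signs are combined. -/
def mulTens (w : List (Letter A.grade)) : TensorAlgebra ℝ G :=
  ∑ j : Fin w.length, ∑ j' : Fin w.length,
    if (j' : ℕ) = j + 1 then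
      ((-1 : ℝ) ^ ((w.take (j + 1)).map letterDeg).sum) •
        (tens (w.take j) * TensorAlgebra.ι ℝ (A.mul (w.get j).2 (w.get j').2) *
          tens (w.drop (j + 2)))
    else 0

/-- `[x ∧ y]`: with `b₁, …, b_{p+q}` the letters of `x` followed by those of `y`, the sum over
`σ ∈ Bat(p, q)` and over `k` with `σ⁻¹(k) ≤ p < σ⁻¹(k+1)` of
`ε(σ⁻¹) b_{σ⁻¹(1)} ⊗ ⋯ ⊗ [b_{σ⁻¹(k)}, b_{σ⁻¹(k+1)}] ⊗ ⋯ ⊗ b_{σ⁻¹(p+q)}`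
(the indices in the code start from `0`). -/
def bracketTens (x y : List (Letter A.grade)) : TensorAlgebra ℝ G :=
  ∑ σ ∈ shuffles x.length (x ++ y).length,
    ∑ k : Fin (x ++ y).length, ∑ k' : Fin (x ++ y).length,
      if (k' : ℕ) = k + 1 ∧ ((σ⁻¹ k : Fin _) : ℕ) < x.length ∧
          x.length ≤ ((σ⁻¹ k' : Fin _) : ℕ) then
        koszulSign (x ++ y) σ •
          (tens ((permuteWord (x ++ y) σ).take k) *
            TensorAlgebra.ι ℝ (A.bracket ((x ++ y).get (σ⁻¹ k)).2 ((x ++ y).get (σ⁻¹ k')).2) *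
            tens ((permuteWord (x ++ y) σ).drop (k + 2)))
      else 0

/-- The class in `𝓗[1]` of `m(X)`. -/
def mBlock (x : List (Letter A.grade)) : SymH A.grade := proj A.grade (A.mulTens x)

/-- `ℓ(X, Y) = (-1)^(deg X) [X ∧ Y]` in `𝓗[1]`. -/
def lBlock (x y : List (Letter A.grade)) : SymH A.grade :=
  ((-1 : ℝ) ^ wordDeg x) • proj A.grade (A.bracketTens x y)

/-- The positive part `⨁_{n ≥ 1} Sⁿ(𝓗[1])`, the underlying space of `G_∞(G)`. -/
def gInf : Submodule ℝ (SymH A.grade) :=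
  Submodule.span ℝ {z | ∃ X : List (List (Letter A.grade)), X ≠ [] ∧ z = symProd X}

/-- `C_N(G)`: the span of the products `X₁ · ⋯ · X_r`, `r ≥ 1`, of nonempty words with `N` letters
in total. -/
def chains (N : ℕ) : Submodule ℝ (SymH A.grade) :=
  Submodule.span ℝ {z | ∃ X : List (List (Letter A.grade)),
    X ≠ [] ∧ (∀ x ∈ X, x ≠ []) ∧ (X.map List.length).sum = N ∧ z = symProd X}

/-- `m` is the extension of the product to `S(𝓗[1])`:
`m(X₁ · ⋯ · X_n) = ∑_j (-1)^(∑_{k<j} deg X_k) X₁ · ⋯ · m(X_j) · ⋯ · X_n`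
(for `n = 0` this says `m(1) = 0`). -/
def IsProductExtension (m : SymH A.grade →ₗ[ℝ] SymH A.grade) : Prop :=
  ∀ X : List (List (Letter A.grade)),
    m (symProd X) = ∑ j : Fin X.length,
      ((-1 : ℝ) ^ ((X.take j).map wordDeg).sum) •
        (symProd (X.take j) * A.mBlock (X.get j) * symProd (X.drop (j + 1)))

/-- `ℓ` is the extension of the bracket to `S(𝓗[1])`:
`ℓ(X₁ · ⋯ · X_n) = ∑_{i<j} ε(1 ⋯ n; i, j, 1 ⋯ î ⋯ ĵ ⋯ n) ℓ(X_i, X_j) · X₁ ⋯ X̂_i ⋯ X̂_j ⋯ X_n`.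
The Koszul sign comes from moving `X_i` to the left of the `X_k` with `k < i`, then `X_j` to the
left of the `X_k` with `k < j`, `k ≠ i`. -/
def IsBracketExtension (l : SymH A.grade →ₗ[ℝ] SymH A.grade) : Prop :=
  ∀ X : List (List (Letter A.grade)),
    l (symProd X) = ∑ i : Fin X.length, ∑ j : Fin X.length,
      if i < j then
        ((-1 : ℝ) ^ (wordDeg (X.get i) * ((X.take i).map wordDeg).sum
            + wordDeg (X.get j) * (((X.take j).eraseIdx i).map wordDeg).sum)) •
          (A.lBlock (X.get i) (X.get j) * symProd ((X.eraseIdx j).eraseIdx i))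
      else 0

end GerstenhaberAlgebra

namespace GerstenhaberModule

variable {G M : Type*} [AddCommGroup G] [Module ℝ G] [AddCommGroup M] [Module ℝ M]
  {A : GerstenhaberAlgebra G} (P : GerstenhaberModule A M)

/-- A homogeneous element of `G`, seen in `G ⋉ M`. -/
def inG (a : Letter A.grade) : Letter P.semidirect.grade :=
  ⟨a.1, ⟨((a.2 : G), 0), ⟨a.2.2, Submodule.zero_mem _⟩⟩⟩

/-- A homogeneous element of `M`, seen in `G ⋉ M`. -/
def inM (v : Letter P.grade) : Letter P.semidirect.grade :=
  ⟨v.1, ⟨(0, (v.2 : M)), ⟨Submodule.zero_mem _, v.2.2⟩⟩⟩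

/-- A word in `G`, seen as a word in `G ⋉ M`. -/
def gWord (x : List (Letter A.grade)) : List (Letter P.semidirect.grade) := x.map P.inG

/-- The word `a₁ ⊗ ⋯ ⊗ a_k ⊗ v ⊗ a_{k+1} ⊗ ⋯ ⊗ a_p` in `G ⋉ M`. -/
def mWord (y : List (Letter A.grade)) (v : Letter P.grade) (y' : List (Letter A.grade)) :
    List (Letter P.semidirect.grade) := P.gWord y ++ P.inM v :: P.gWord y'

/-- `C_N(G, M)`: the span of the products `X₁ · ⋯ · X_r · Y`, `r ≥ 0`, where the `X_i` are nonempty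
words in `G`, `Y` is a word with one letter in `M` and the others in `G`, and the total number of
letters in `G` is `N`. -/
def moduleChains (N : ℕ) : Submodule ℝ (SymH P.semidirect.grade) :=
  Submodule.span ℝ {z | ∃ (X : List (List (Letter A.grade))) (y : List (Letter A.grade))
    (v : Letter P.grade) (y' : List (Letter A.grade)),
    (∀ x ∈ X, x ≠ []) ∧ (X.map List.length).sum + (y.length + y'.length) = N ∧
    z = symProd (X.map P.gWord) * symProd [P.mWord y v y']}

end GerstenhaberModule

end

/-! The sums over shuffles are hard to compute with directly, so the shuffle product, the bracket of
words and `m` are replaced by operators defined by recursion on the first letter: `shuffleMul`,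
`bracketMul`, `mulOp`. A shuffle of `a x` and `b y` begins with `a` or with `b`; once a contraction
is allowed, it may also begin with `[a, b]`. Sorting permutations by the index sent to the first
position proves the agreement with the closed sums (`shuffleProd_eq`, `mulTens_eq`,
`bracketTens_eq`).

The identities between words are then inductions on first letters. Associativity gives `m² = 0`
(`mulOp_mulOp`). Commutativity makes `m` a derivation of the shuffle product (`mulOp_shuffleMul`),
since products of letters from different words cancel in pairs. The Leibniz rule enters in making
`m` a derivation of the bracket (`mulOp_bracketMul`). Bracketing with a word is a derivation of the
shuffle product for formal reasons (`bracketMul_shuffleMul`), and this together with the Jacobi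
identity for letters gives Jacobi for words (`bracketMul_jacobi`). Derivations of the shuffle
product that take values in positive length preserve the span of shuffles, so `m` and the bracket
descend to the quotient. After the shift the bracket is a graded symmetric `ℓ` of degree one.

On the symmetric algebra the argument is the one for the Chevalley–Eilenberg complex. The map `m` is
extended as a derivation, and `ℓ(X s) = ad_X s ± X ℓ(s)`, where `ad_X` is the derivation extending
`ℓ(X, ·)`. The identities `mulCls_mulCls`, `mulCls_lieCls` and `lieCls_jacobi` yield `m² = 0`, `mℓ +
ℓm = 0` and `ℓ² = 0`.

All the stability statements are instances of one principle,
`GerstenhaberAlgebra.boundary_mem_homSym`: if multiplying or bracketing two letters changes an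
additive degree by `μ`, then so does the boundary. It is applied to a trivial degree, to the number
of letters, and to the pair formed by the number of letters and the number of letters in `M`. The
last case works because products and brackets of two elements of `M` vanish in `G ⋉ M`. The formula
for the boundary is the same recursion with `Y` isolated as the last factor. -/

noncomputable section

/-! ### Linear maps on a tensor algebra by recursion on the first letter -/

section TensorRec

variable {V N : Type*} [AddCommGroup V] [Module ℝ V] [AddCommGroup N] [Module ℝ N]

/-- One step of `tensorRec`: left multiplication by a vector, together with the recursion rule. -/
def tensorRecStep (β : V →ₗ[ℝ] TensorAlgebra ℝ V →ₗ[ℝ] N) (γ : V →ₗ[ℝ] N →ₗ[ℝ] N) :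
    V →ₗ[ℝ] Module.End ℝ (TensorAlgebra ℝ V × N) :=
  LinearMap.mk₂ ℝ (fun v p => (TensorAlgebra.ι ℝ v * p.1, β v p.1 + γ v p.2))
    (by intros; ext <;> simp [add_mul]; abel) (by intros; ext <;> simp)
    (by intros; ext <;> simp [mul_add]; abel) (by intros; ext <;> simp)

/-- The linear map `F` on the tensor algebra with `F 1 = n₀` and `F (v t) = β v t + γ v (F t)`. -/
def tensorRec (n₀ : N) (β : V →ₗ[ℝ] TensorAlgebra ℝ V →ₗ[ℝ] N) (γ : V →ₗ[ℝ] N →ₗ[ℝ] N) :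
    TensorAlgebra ℝ V →ₗ[ℝ] N :=
  LinearMap.snd ℝ _ _ ∘ₗ (LinearMap.applyₗ (R := ℝ) ((1, n₀) : TensorAlgebra ℝ V × N)) ∘ₗ
    (TensorAlgebra.lift ℝ (tensorRecStep β γ)).toLinearMap

variable (n₀ : N) (β : V →ₗ[ℝ] TensorAlgebra ℝ V →ₗ[ℝ] N) (γ : V →ₗ[ℝ] N →ₗ[ℝ] N)

theorem tensorRecStep_apply (v : V) (p : TensorAlgebra ℝ V × N) :
    tensorRecStep β γ v p = (TensorAlgebra.ι ℝ v * p.1, β v p.1 + γ v p.2) := rfl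

theorem tensorRec_one : tensorRec n₀ β γ 1 = n₀ := by
  simp [tensorRec]

/-- The first component only records the tensor built so far. Carrying it along lets `β` see the
tail itself and not merely the value already computed on the tail. -/
theorem fst_lift_tensorRecStep (t : TensorAlgebra ℝ V) (p : TensorAlgebra ℝ V × N) :
    (TensorAlgebra.lift ℝ (tensorRecStep β γ) t p).1 = t * p.1 := by
  induction t using TensorAlgebra.induction generalizing p with
  | algebraMap r => simp [Module.algebraMap_end_apply, Algebra.smul_def]
  | ι v => simp [tensorRecStep]
  | mul a b ha hb => simp [ha, hb, mul_assoc]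
  | add a b ha hb => simp [ha, hb, add_mul]

theorem tensorRec_ι_mul (v : V) (t : TensorAlgebra ℝ V) :
    tensorRec n₀ β γ (TensorAlgebra.ι ℝ v * t) = β v t + γ v (tensorRec n₀ β γ t) := by
  have h := fst_lift_tensorRecStep β γ t (1, n₀)
  simp only [mul_one] at h
  simp only [tensorRec, LinearMap.comp_apply, AlgHom.toLinearMap_apply, map_mul,
    TensorAlgebra.lift_ι_apply, LinearMap.applyₗ_apply_apply, Module.End.mul_apply]
  simp [tensorRecStep_apply, h]

end TensorRec

/-! ### Shuffle product, bracket and `m` as recursive operators on words -/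

section WordOperators

variable {V : Type*} [AddCommGroup V] [Module ℝ V] {𝒱 : ℤ → Submodule ℝ V}

/-- The sum of the degrees of the letters of a word. -/
def degSum (w : List (Letter 𝒱)) : ℤ := (w.map letterDeg).sum

@[simp] theorem degSum_nil : degSum ([] : List (Letter 𝒱)) = 0 := rfl
@[simp] theorem degSum_cons (a : Letter 𝒱) (w) : degSum (a :: w) = letterDeg a + degSum w := rfl

/-- A letter, as a tensor of length one. -/
def lt (a : Letter 𝒱) : TensorAlgebra ℝ V := TensorAlgebra.ι ℝ (a.2 : V)

@[simp] theorem tens_nil : tens ([] : List (Letter 𝒱)) = 1 := rfl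
@[simp] theorem tens_cons (a : Letter 𝒱) (w) : tens (a :: w) = lt a * tens w := by
  simp [tens, lt]

theorem span_tens (hV : DirectSum.IsInternal 𝒱) :
    Submodule.span ℝ (Set.range (tens (𝒱 := 𝒱))) = ⊤ := by
  have hι : ∀ v : V, ∀ t ∈ Submodule.span ℝ (Set.range (tens (𝒱 := 𝒱))),
      TensorAlgebra.ι ℝ v * t ∈ Submodule.span ℝ (Set.range (tens (𝒱 := 𝒱))) := by
    intro v t ht
    have hv : v ∈ ⨆ i, 𝒱 i := by
      rw [hV.submodule_iSup_eq_top]; trivial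
    induction hv using Submodule.iSup_induction' with
    | mem i a ha =>
      induction ht using Submodule.span_induction with
      | mem _ h =>
        obtain ⟨w, rfl⟩ := h
        exact Submodule.subset_span ⟨⟨i, a, ha⟩ :: w, by simp [lt]⟩
      | zero => simp
      | add _ _ _ _ h1 h2 => rw [mul_add]; exact add_mem h1 h2
      | smul c _ _ h => rw [mul_smul_comm]; exact Submodule.smul_mem _ _ h
    | zero => simp
    | add _ _ _ _ h1 h2 => rw [map_add, add_mul]; exact add_mem h1 h2
  have hmul : ∀ s t : TensorAlgebra ℝ V, t ∈ Submodule.span ℝ (Set.range (tens (𝒱 := 𝒱))) →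
      s * t ∈ Submodule.span ℝ (Set.range (tens (𝒱 := 𝒱))) := by
    intro s
    induction s using TensorAlgebra.induction with
    | algebraMap r =>
      intro t ht
      rw [← Algebra.smul_def]; exact Submodule.smul_mem _ _ ht
    | ι v => exact hι v
    | mul a b ha hb => intro t ht; rw [mul_assoc]; exact ha _ (hb _ ht)
    | add a b ha hb => intro t ht; rw [add_mul]; exact add_mem (ha _ ht) (hb _ ht)
  rw [eq_top_iff]
  intro s _
  simpa using hmul s 1 (Submodule.subset_span ⟨[], rfl⟩)

theorem tensor_linearMap_ext (hV : DirectSum.IsInternal 𝒱) {N : Type*} [AddCommGroup N]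
    [Module ℝ N] {f g : TensorAlgebra ℝ V →ₗ[ℝ] N}
    (h : ∀ w : List (Letter 𝒱), f (tens w) = g (tens w)) : f = g :=
  LinearMap.ext_on (span_tens hV) (by rintro _ ⟨w, rfl⟩; exact h w)

/-- The map `b ↦ (-1)^(d * deg b) b`. -/
def signTwist (hV : DirectSum.IsInternal 𝒱) (d : ℤ) : V →ₗ[ℝ] V :=
  gradedLift hV fun i => ((-1 : ℝ) ^ (d * (i - 1))) • (𝒱 i).subtype

theorem signTwist_letter (hV : DirectSum.IsInternal 𝒱) (d : ℤ) (b : Letter 𝒱) :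
    signTwist hV d b.2 = ((-1 : ℝ) ^ (d * letterDeg b)) • (b.2 : V) := by
  rw [signTwist, gradedLift_of_mem hV _ b.2.2]; rfl

/-- The shuffle product by a word. -/
def shuffleMul (hV : DirectSum.IsInternal 𝒱) :
    List (Letter 𝒱) → TensorAlgebra ℝ V →ₗ[ℝ] TensorAlgebra ℝ V
  | [] => LinearMap.id
  | a :: x => tensorRec (tens (a :: x))
      (((LinearMap.mul ℝ (TensorAlgebra ℝ V)).compr₂
        (LinearMap.mulLeft ℝ (lt a) ∘ₗ shuffleMul hV x)) ∘ₗ TensorAlgebra.ι ℝ)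
      (LinearMap.mul ℝ (TensorAlgebra ℝ V) ∘ₗ TensorAlgebra.ι ℝ ∘ₗ signTwist hV (degSum (a :: x)))

variable (hV : DirectSum.IsInternal 𝒱)

@[simp] theorem shuffleMul_nil (t) : shuffleMul hV [] t = t := rfl

@[simp] theorem shuffleMul_one (x) : shuffleMul hV x 1 = tens x := by
  cases x with
  | nil => rfl
  | cons a x => rw [shuffleMul, tensorRec_one]

theorem shuffleMul_cons (a : Letter 𝒱) (x) (b : Letter 𝒱) (t) :
    shuffleMul hV (a :: x) (lt b * t) = lt a * shuffleMul hV x (lt b * t) +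
      ((-1 : ℝ) ^ ((letterDeg a + degSum x) * letterDeg b)) •
        (lt b * shuffleMul hV (a :: x) t) := by
  rw [shuffleMul, lt, lt, tensorRec_ι_mul]
  simp [signTwist_letter, lt]

end WordOperators

namespace GerstenhaberAlgebra

variable {G : Type*} [AddCommGroup G] [Module ℝ G] (A : GerstenhaberAlgebra G)

/-- The product of two letters. -/
def mulLetter (a b : Letter A.grade) : Letter A.grade :=
  ⟨a.1 + b.1, ⟨A.mul a.2 b.2, A.mul_mem a.2.2 b.2.2⟩⟩

/-- The bracket of two letters. -/
def bracketLetter (a b : Letter A.grade) : Letter A.grade :=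
  ⟨a.1 + b.1 - 1, ⟨A.bracket a.2 b.2, A.bracket_mem a.2.2 b.2.2⟩⟩

@[simp] theorem letterDeg_mulLetter (a b : Letter A.grade) :
    letterDeg (A.mulLetter a b) = letterDeg a + letterDeg b + 1 := by
  simp only [letterDeg, mulLetter]; ring

@[simp] theorem letterDeg_bracketLetter (a b : Letter A.grade) :
    letterDeg (A.bracketLetter a b) = letterDeg a + letterDeg b := by
  simp only [letterDeg, bracketLetter]; ring

/-- The operator `{x, ·}` of the bracket of tensors. -/
def bracketMul : List (Letter A.grade) → TensorAlgebra ℝ G →ₗ[ℝ] TensorAlgebra ℝ G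
  | [] => 0
  | a :: x => tensorRec 0
      (((LinearMap.mul ℝ (TensorAlgebra ℝ G)).compr₂
        (LinearMap.mulLeft ℝ (lt a) ∘ₗ bracketMul x)) ∘ₗ TensorAlgebra.ι ℝ +
        ((LinearMap.mul ℝ (TensorAlgebra ℝ G)).compl₂ (shuffleMul A.isInternal x)) ∘ₗ
          TensorAlgebra.ι ℝ ∘ₗ A.bracket a.2 ∘ₗ signTwist A.isInternal (degSum x))
      (LinearMap.mul ℝ (TensorAlgebra ℝ G) ∘ₗ TensorAlgebra.ι ℝ ∘ₗ
        signTwist A.isInternal (degSum (a :: x)))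

@[simp] theorem bracketMul_nil (t) : A.bracketMul [] t = 0 := rfl

@[simp] theorem bracketMul_one (x) : A.bracketMul x 1 = 0 := by
  cases x with
  | nil => rfl
  | cons a x => rw [bracketMul, tensorRec_one]

/-- The last term is the one whose first letter is contracted: `b` has then crossed `x` only, and
the tails are shuffled without further contraction. No `[b, a]` appears because a contracted pair
has its letter of the first word on the left. -/
theorem bracketMul_cons (a : Letter A.grade) (x) (b : Letter A.grade) (t) :
    A.bracketMul (a :: x) (lt b * t) = lt a * A.bracketMul x (lt b * t) +
      ((-1 : ℝ) ^ ((letterDeg a + degSum x) * letterDeg b)) • (lt b * A.bracketMul (a :: x) t) +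
      ((-1 : ℝ) ^ (degSum x * letterDeg b)) •
        (lt (A.bracketLetter a b) * shuffleMul A.isInternal x t) := by
  rw [bracketMul, lt, lt, tensorRec_ι_mul]
  simp [signTwist_letter, lt, bracketLetter]
  abel

/-- `headMul t a` multiplies the first letter of `t` by `a` from the left. -/
def headMul : TensorAlgebra ℝ G →ₗ[ℝ] G →ₗ[ℝ] TensorAlgebra ℝ G :=
  tensorRec 0
    (LinearMap.mk₂ ℝ (fun v s => LinearMap.mulRight ℝ s ∘ₗ TensorAlgebra.ι ℝ ∘ₗ A.mul.flip v)
      (by intros; ext; simp [add_mul]) (by intros; ext; simp)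
      (by intros; ext; simp [mul_add]) (by intros; ext; simp)) 0

@[simp] theorem headMul_one : A.headMul 1 = 0 := tensorRec_one _ _ _

@[simp] theorem headMul_lt_mul (a b : Letter A.grade) (t) :
    A.headMul (lt b * t) a.2 = lt (A.mulLetter a b) * t := by
  rw [headMul, lt, tensorRec_ι_mul]; simp [mulLetter, lt]

/-- The operator `m` on the tensor algebra. -/
def mulOp : TensorAlgebra ℝ G →ₗ[ℝ] TensorAlgebra ℝ G :=
  tensorRec 0 (A.headMul.flip ∘ₗ signTwist A.isInternal 1)
    (LinearMap.mul ℝ (TensorAlgebra ℝ G) ∘ₗ TensorAlgebra.ι ℝ ∘ₗ signTwist A.isInternal 1)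

@[simp] theorem mulOp_one : A.mulOp 1 = 0 := tensorRec_one _ _ _

theorem mulOp_lt_mul (a : Letter A.grade) (t) :
    A.mulOp (lt a * t) =
      ((-1 : ℝ) ^ letterDeg a) • (A.headMul t a.2 + lt a * A.mulOp t) := by
  rw [mulOp, lt, tensorRec_ι_mul]; simp [signTwist_letter]

end GerstenhaberAlgebra
-- Symmetry of shuffles and brackets, and expansions by first letter
section WordIdentities

open GerstenhaberModule (neg_one_zpow_eq)

variable {V : Type*} [AddCommGroup V] [Module ℝ V] {𝒱 : ℤ → Submodule ℝ V}
variable (hV : DirectSum.IsInternal 𝒱)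

theorem shuffleMul_comm (x y : List (Letter 𝒱)) :
    shuffleMul hV x (tens y) = ((-1 : ℝ) ^ (degSum x * degSum y)) • shuffleMul hV y (tens x) := by
  induction x generalizing y with
  | nil => simp
  | cons a x ihx =>
    induction y with
    | nil => simp
    | cons b y ihy =>
      have h := ihx (b :: y)
      simp only [tens_cons, degSum_cons] at h ihy ⊢
      rw [shuffleMul_cons, shuffleMul_cons, h, ihy]
      simp only [mul_smul_comm, smul_add, smul_smul]
      -- Signs depend only on parities of degrees, so comparing the coefficients of each tensor
      -- leaves a propositional identity in these parities. All later sign checks follow this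
      -- pattern.
      generalize letterDeg a = a', letterDeg b = b', degSum x = x', degSum y = y'
      match_scalars
      all_goals
        simp only [neg_one_zpow_eq, Int.even_add, Int.even_mul]
        grind

/-- The first letter of a triple shuffle comes from one of three words. The terms of the two nested
recursions regroup so that each tail is again an iterated shuffle, the shape required by the
induction hypotheses. -/
theorem shuffleMul_shuffleMul_cons (a : Letter 𝒱) (x) (b : Letter 𝒱) (y) (c : Letter 𝒱) (t) :
    shuffleMul hV (a :: x) (shuffleMul hV (b :: y) (lt c * t)) =
      lt a * shuffleMul hV x (shuffleMul hV (b :: y) (lt c * t)) +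
      ((-1 : ℝ) ^ ((letterDeg a + degSum x) * letterDeg b)) •
        (lt b * shuffleMul hV (a :: x) (shuffleMul hV y (lt c * t))) +
      ((-1 : ℝ) ^ ((letterDeg b + degSum y) * letterDeg c) *
        (-1 : ℝ) ^ ((letterDeg a + degSum x) * letterDeg c)) •
        (lt c * shuffleMul hV (a :: x) (shuffleMul hV (b :: y) t)) := by
  simp only [shuffleMul_cons, map_add, map_smul, mul_add, mul_smul_comm]
  module

/-- This takes the place of associativity: the left factor of `shuffleMul` must be a word, so the
triple shuffle is controlled through commutation of operators. -/
theorem shuffleMul_left_comm (x y : List (Letter 𝒱)) (t : TensorAlgebra ℝ V) :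
    shuffleMul hV x (shuffleMul hV y t) =
      ((-1 : ℝ) ^ (degSum x * degSum y)) • shuffleMul hV y (shuffleMul hV x t) := by
  suffices h : ∀ z : List (Letter 𝒱), shuffleMul hV x (shuffleMul hV y (tens z)) =
      ((-1 : ℝ) ^ (degSum x * degSum y)) • shuffleMul hV y (shuffleMul hV x (tens z)) from
    LinearMap.congr_fun (f := shuffleMul hV x ∘ₗ shuffleMul hV y)
      (g := ((-1 : ℝ) ^ (degSum x * degSum y)) • (shuffleMul hV y ∘ₗ shuffleMul hV x))
      (tensor_linearMap_ext hV h) t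
  clear t
  induction x generalizing y with
  | nil => simp
  | cons a x ihx =>
    induction y with
    | nil => simp
    | cons b y ihy =>
      intro z
      induction z with
      | nil => simpa using shuffleMul_comm hV (a :: x) (b :: y)
      | cons c z ihz =>
        have h1 := ihx (b :: y) (c :: z)
        have h2 := ihy (c :: z)
        simp only [tens_cons, degSum_cons] at h1 h2 ihz ⊢
        rw [shuffleMul_shuffleMul_cons, shuffleMul_shuffleMul_cons, h1, h2, ihz]
        simp only [mul_smul_comm, smul_add, smul_smul]
        generalize letterDeg a = a', letterDeg b = b', letterDeg c = c', degSum x = x',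
          degSum y = y'
        match_scalars
        all_goals
          simp only [neg_one_zpow_eq, Int.even_add, Int.even_mul]
          grind

/-- A cyclic permutation of the factors of a triple shuffle product. -/
theorem shuffleMul_rotate (x y z : List (Letter 𝒱)) :
    shuffleMul hV z (shuffleMul hV x (tens y)) =
      ((-1 : ℝ) ^ (degSum z * (degSum x + degSum y))) •
        shuffleMul hV x (shuffleMul hV y (tens z)) := by
  rw [shuffleMul_left_comm, shuffleMul_comm hV z y, map_smul, smul_smul, mul_add,
    zpow_add₀ (by norm_num)]

end WordIdentities

namespace GerstenhaberAlgebra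

open GerstenhaberModule (neg_one_zpow_eq)

variable {G : Type*} [AddCommGroup G] [Module ℝ G] (A : GerstenhaberAlgebra G)

local notation "Sh" => shuffleMul A.isInternal

theorem lt_bracketLetter_comm (a b : Letter A.grade) :
    lt (A.bracketLetter a b) =
      (-(-1 : ℝ) ^ (letterDeg a * letterDeg b)) • lt (A.bracketLetter b a) := by
  simp only [lt, bracketLetter]
  rw [A.antisymm a.2.2 b.2.2, letterDeg, letterDeg, map_neg, map_smul, neg_smul]

theorem lt_mulLetter_comm (a b : Letter A.grade) :
    lt (A.mulLetter a b) =
      ((-1 : ℝ) ^ ((letterDeg a + 1) * (letterDeg b + 1))) • lt (A.mulLetter b a) := by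
  simp only [lt, mulLetter]
  rw [A.mul_comm a.2.2 b.2.2, letterDeg, letterDeg, map_smul, sub_add_cancel, sub_add_cancel]

theorem lt_mulLetter_assoc (a b c : Letter A.grade) :
    lt (A.mulLetter (A.mulLetter a b) c) = lt (A.mulLetter a (A.mulLetter b c)) := by
  simp only [lt, mulLetter]
  rw [A.mul_assoc a.2.2 b.2.2 c.2.2]

theorem lt_bracketLetter_mulLetter (a b c : Letter A.grade) :
    lt (A.bracketLetter a (A.mulLetter b c)) = lt (A.mulLetter (A.bracketLetter a b) c) +
      ((-1 : ℝ) ^ ((letterDeg b + 1) * letterDeg a)) •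
        lt (A.mulLetter b (A.bracketLetter a c)) := by
  simp only [lt, mulLetter, bracketLetter]
  rw [A.leibniz a.2.2 b.2.2 c.2.2, map_add, map_smul, letterDeg, letterDeg, sub_add_cancel]

theorem lt_jacobi (a b c : Letter A.grade) :
    lt (A.bracketLetter a (A.bracketLetter b c)) =
      (-(-1 : ℝ) ^ ((letterDeg a + letterDeg b) * letterDeg c)) •
        lt (A.bracketLetter c (A.bracketLetter a b)) +
      (-(-1 : ℝ) ^ (letterDeg a * (letterDeg b + letterDeg c))) •
        lt (A.bracketLetter b (A.bracketLetter c a)) := by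
  have h := congrArg (TensorAlgebra.ι ℝ) (A.jacobi a.2.2 b.2.2 c.2.2)
  have h' : ((-1 : ℝ) ^ (letterDeg a * letterDeg c)) •
        lt (A.bracketLetter (A.bracketLetter a b) c) +
      ((-1 : ℝ) ^ (letterDeg b * letterDeg a)) •
        lt (A.bracketLetter (A.bracketLetter b c) a) +
      ((-1 : ℝ) ^ (letterDeg c * letterDeg b)) •
        lt (A.bracketLetter (A.bracketLetter c a) b) = 0 := by
    simpa [lt, bracketLetter, letterDeg] using h
  rw [A.lt_bracketLetter_comm (A.bracketLetter a b), A.lt_bracketLetter_comm (A.bracketLetter b c),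
    A.lt_bracketLetter_comm (A.bracketLetter c a)] at h'
  simp only [letterDeg_bracketLetter, smul_smul] at h'
  generalize letterDeg a = a', letterDeg b = b', letterDeg c = c' at h' ⊢
  -- The factor normalises the coefficient of `[a, [b, c]]` to one.
  linear_combination (norm := skip) (-(-1 : ℝ) ^ (a' * c')) • h'
  match_scalars
  all_goals
    simp only [neg_one_zpow_eq, Int.even_add, Int.even_mul]
    grind

theorem bracketMul_antisymm (x y : List (Letter A.grade)) :
    A.bracketMul x (tens y) =
      (-(-1 : ℝ) ^ (degSum x * degSum y)) • A.bracketMul y (tens x) := by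
  induction x generalizing y with
  | nil => simp
  | cons a x ihx =>
    induction y with
    | nil => simp
    | cons b y ihy =>
      have h := ihx (b :: y)
      simp only [tens_cons, degSum_cons] at h ihy ⊢
      rw [bracketMul_cons, bracketMul_cons, h, ihy, shuffleMul_comm A.isInternal x y,
        A.lt_bracketLetter_comm a b]
      simp only [mul_smul_comm, smul_mul_assoc, smul_add, smul_smul]
      generalize letterDeg a = a', letterDeg b = b', degSum x = x', degSum y = y'
      match_scalars
      all_goals
        simp only [neg_one_zpow_eq, Int.even_add, Int.even_mul]
        grind

variable (a b c : Letter A.grade) (x y : List (Letter A.grade)) (t : TensorAlgebra ℝ G)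

/-- The five terms are the three uncontracted first letters and the contractions of `a` with `b` or
`c`. A pair `b, c` is never contracted here, as both belong to the second argument of the bracket.
-/
theorem bracketMul_shuffleMul_cons :
    A.bracketMul (a :: x) (Sh (b :: y) (lt c * t)) =
      lt a * A.bracketMul x (Sh (b :: y) (lt c * t)) +
      ((-1 : ℝ) ^ ((letterDeg a + degSum x) * letterDeg b)) •
        (lt b * A.bracketMul (a :: x) (Sh y (lt c * t))) +
      ((-1 : ℝ) ^ ((letterDeg b + degSum y) * letterDeg c) *
        (-1 : ℝ) ^ ((letterDeg a + degSum x) * letterDeg c)) •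
        (lt c * A.bracketMul (a :: x) (Sh (b :: y) t)) +
      ((-1 : ℝ) ^ (degSum x * letterDeg b)) •
        (lt (A.bracketLetter a b) * Sh x (Sh y (lt c * t))) +
      ((-1 : ℝ) ^ ((letterDeg b + degSum y) * letterDeg c) *
        (-1 : ℝ) ^ (degSum x * letterDeg c)) •
        (lt (A.bracketLetter a c) * Sh x (Sh (b :: y) t)) := by
  simp only [shuffleMul_cons, bracketMul_cons, map_add, map_smul, mul_add, mul_smul_comm]
  module

theorem shuffleMul_bracketMul_cons :
    Sh (a :: x) (A.bracketMul (b :: y) (lt c * t)) =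
      lt a * Sh x (A.bracketMul (b :: y) (lt c * t)) +
      ((-1 : ℝ) ^ ((letterDeg a + degSum x) * letterDeg b)) •
        (lt b * Sh (a :: x) (A.bracketMul y (lt c * t))) +
      ((-1 : ℝ) ^ ((letterDeg b + degSum y) * letterDeg c) *
        (-1 : ℝ) ^ ((letterDeg a + degSum x) * letterDeg c)) •
        (lt c * Sh (a :: x) (A.bracketMul (b :: y) t)) +
      ((-1 : ℝ) ^ (degSum y * letterDeg c) *
        (-1 : ℝ) ^ ((letterDeg a + degSum x) * (letterDeg b + letterDeg c))) •
        (lt (A.bracketLetter b c) * Sh (a :: x) (Sh y t)) := by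
  simp only [shuffleMul_cons, bracketMul_cons, letterDeg_bracketLetter, map_add, map_smul,
    mul_add, mul_smul_comm]
  match_scalars <;> ring

/-- Seven possible first letters: three uncontracted ones, three simple contractions, and the double
contraction `[a, [b, c]]`. In the simple contractions one bracket is left over in the tail, and in
the double one only shuffles are. -/
theorem bracketMul_bracketMul_cons :
    A.bracketMul (a :: x) (A.bracketMul (b :: y) (lt c * t)) =
      lt a * A.bracketMul x (A.bracketMul (b :: y) (lt c * t)) +
      ((-1 : ℝ) ^ ((letterDeg a + degSum x) * letterDeg b)) •
        (lt b * A.bracketMul (a :: x) (A.bracketMul y (lt c * t))) +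
      ((-1 : ℝ) ^ ((letterDeg b + degSum y) * letterDeg c) *
        (-1 : ℝ) ^ ((letterDeg a + degSum x) * letterDeg c)) •
        (lt c * A.bracketMul (a :: x) (A.bracketMul (b :: y) t)) +
      ((-1 : ℝ) ^ (degSum x * letterDeg b)) •
        (lt (A.bracketLetter a b) * Sh x (A.bracketMul y (lt c * t))) +
      ((-1 : ℝ) ^ ((letterDeg b + degSum y) * letterDeg c) *
        (-1 : ℝ) ^ (degSum x * letterDeg c)) •
        (lt (A.bracketLetter a c) * Sh x (A.bracketMul (b :: y) t)) +
      ((-1 : ℝ) ^ (degSum y * letterDeg c) *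
        (-1 : ℝ) ^ ((letterDeg a + degSum x) * (letterDeg b + letterDeg c))) •
        (lt (A.bracketLetter b c) * A.bracketMul (a :: x) (Sh y t)) +
      ((-1 : ℝ) ^ (degSum y * letterDeg c) *
        (-1 : ℝ) ^ (degSum x * (letterDeg b + letterDeg c))) •
        (lt (A.bracketLetter a (A.bracketLetter b c)) * Sh x (Sh y t)) := by
  simp only [bracketMul_cons, letterDeg_bracketLetter, map_add, map_smul,
    mul_add, mul_smul_comm]
  match_scalars <;> ring

end GerstenhaberAlgebra
-- Derivation property and Jacobi identity for the bracket of words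
namespace GerstenhaberAlgebra

open GerstenhaberModule (neg_one_zpow_eq)

variable {G : Type*} [AddCommGroup G] [Module ℝ G] (A : GerstenhaberAlgebra G)

local notation "Sh" => shuffleMul A.isInternal

/-- The bracket with a word is a graded derivation of the shuffle product. -/
theorem bracketMul_shuffleMul (x y z : List (Letter A.grade)) :
    A.bracketMul x (Sh y (tens z)) =
      ((-1 : ℝ) ^ ((degSum x + degSum y) * degSum z)) • Sh z (A.bracketMul x (tens y)) +
      ((-1 : ℝ) ^ (degSum x * degSum y)) • Sh y (A.bracketMul x (tens z)) := by
  induction x generalizing y z with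
  | nil => simp
  | cons a x ihx =>
    induction y generalizing z with
    | nil => simp
    | cons b y ihy =>
      induction z with
      | nil => simp
      | cons c z ihz =>
        have h1 := ihx (b :: y) (c :: z)
        have h2 := ihy (c :: z)
        -- The terms headed by `[a, b]` and `[a, c]` carry pure triple shuffles and match after
        -- reordering factors. The terms headed by an uncontracted letter are the induction
        -- hypotheses.
        have h3 := shuffleMul_rotate A.isInternal x y (c :: z)
        have h4 := shuffleMul_left_comm A.isInternal (b :: y) x (tens z)
        simp only [tens_cons, degSum_cons] at h1 h2 h3 ihz ⊢
        rw [bracketMul_shuffleMul_cons, shuffleMul_bracketMul_cons, shuffleMul_bracketMul_cons,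
          h1, h2, ihz, h3, h4]
        simp only [mul_smul_comm, smul_add, smul_smul, mul_add, degSum_cons]
        generalize letterDeg a = a', letterDeg b = b', letterDeg c = c', degSum x = x',
          degSum y = y', degSum z = z'
        match_scalars
        all_goals
          simp only [neg_one_zpow_eq, Int.even_add, Int.even_mul]
          grind

set_option maxHeartbeats 2000000 in
/-- The graded Jacobi identity for the bracket of words. -/
theorem bracketMul_jacobi (x y z : List (Letter A.grade)) :
    A.bracketMul x (A.bracketMul y (tens z)) =
      (-(-1 : ℝ) ^ ((degSum x + degSum y) * degSum z)) •
        A.bracketMul z (A.bracketMul x (tens y)) +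
      (-(-1 : ℝ) ^ (degSum x * (degSum y + degSum z))) •
        A.bracketMul y (A.bracketMul z (tens x)) := by
  induction x generalizing y z with
  | nil => simp
  | cons a x ihx =>
    induction y generalizing z with
    | nil => simp
    | cons b y ihy =>
      induction z with
      | nil => simp
      | cons c z ihz =>
        have h1 := ihx (b :: y) (c :: z)
        have h2 := ihy (c :: z)
        -- Double contractions are followed by the same triple shuffle up to order, so the Jacobi
        -- identity for letters disposes of them.
        have t1 := shuffleMul_rotate A.isInternal x y z
        have t2 := shuffleMul_rotate A.isInternal z x y
        rw [t1, smul_smul] at t2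
        -- For each simple contraction, such as `[a, b]`, one of the three double brackets leaves a
        -- bracket with a shuffle in the tail. The derivation property splits it into the tails
        -- coming from the other two.
        have p1 := A.bracketMul_shuffleMul (c :: z) x y
        have p2 := A.bracketMul_shuffleMul (b :: y) z x
        have p3 := A.bracketMul_shuffleMul (a :: x) y z
        rw [A.bracketMul_antisymm (c :: z) y] at p1
        rw [A.bracketMul_antisymm (b :: y) x] at p2
        rw [A.bracketMul_antisymm (a :: x) z] at p3
        simp only [tens_cons, degSum_cons, map_smul, smul_smul] at h1 h2 ihz p1 p2 p3 ⊢
        rw [bracketMul_bracketMul_cons, bracketMul_bracketMul_cons, bracketMul_bracketMul_cons,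
          h1, h2, ihz, p1, p2, p3, t1, t2, A.lt_jacobi a b c, A.lt_bracketLetter_comm b a,
          A.lt_bracketLetter_comm c b, A.lt_bracketLetter_comm c a]
        simp only [mul_smul_comm, smul_mul_assoc, smul_add, smul_smul, mul_add, add_mul]
        generalize letterDeg a = a', letterDeg b = b', letterDeg c = c', degSum x = x',
          degSum y = y', degSum z = z'
        match_scalars
        all_goals
          simp only [neg_one_zpow_eq, Int.even_add, Int.even_mul]
          grind

end GerstenhaberAlgebra
-- The operator `m`: square zero, derivation of the shuffle product and of the bracket
namespace GerstenhaberAlgebra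

open GerstenhaberModule (neg_one_zpow_eq)

variable {G : Type*} [AddCommGroup G] [Module ℝ G] (A : GerstenhaberAlgebra G)

local notation "Sh" => shuffleMul A.isInternal

theorem headMul_headMul (a b : Letter A.grade) (x : List (Letter A.grade)) :
    A.headMul (A.headMul (tens x) b.2) a.2 = A.headMul (tens x) (A.mulLetter a b).2 := by
  cases x with
  | nil => simp
  | cons c x =>
    simp only [tens_cons]
    rw [headMul_lt_mul, headMul_lt_mul, headMul_lt_mul, lt_mulLetter_assoc]

/-- Overlapping products `(ab)c` and `a(bc)` cancel by associativity, disjoint ones by sign, because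
the product of letters raises the shifted degree by one. -/
theorem mulOp_mulOp (t : TensorAlgebra ℝ G) : A.mulOp (A.mulOp t) = 0 := by
  refine LinearMap.congr_fun (f := A.mulOp ∘ₗ A.mulOp) (g := 0)
    (tensor_linearMap_ext A.isInternal fun w => ?_) t
  simp only [LinearMap.comp_apply, LinearMap.zero_apply]
  induction w with
  | nil => simp
  | cons a w ih =>
    cases w with
    | nil => rw [tens_cons, mulOp_lt_mul]; simp
    | cons b w =>
      have h := A.headMul_headMul a b w
      simp only [tens_cons] at ih ⊢
      rw [mulOp_lt_mul, map_smul, map_add, mulOp_lt_mul, ih, headMul_lt_mul, mulOp_lt_mul,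
        mulOp_lt_mul, map_smul, map_add]
      simp only [LinearMap.smul_apply, LinearMap.add_apply, headMul_lt_mul, h,
        letterDeg_mulLetter, mul_zero, add_zero, smul_add, smul_smul]
      generalize letterDeg a = a', letterDeg b = b'
      match_scalars
      all_goals
        simp only [neg_one_zpow_eq, Int.even_add, Int.not_even_one]
        grind

/-- The part of `a · (x ⧢ y)` with the first letter of `x` absorbed by `a`. -/
def headShuffle (a : Letter A.grade) : List (Letter A.grade) → List (Letter A.grade) →
    TensorAlgebra ℝ G
  | [], _ => 0
  | b :: x, y => lt (A.mulLetter a b) * Sh x (tens y)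

theorem headMul_shuffleMul (a : Letter A.grade) (x y : List (Letter A.grade)) :
    A.headMul (Sh x (tens y)) a.2 = A.headShuffle a x y +
      ((-1 : ℝ) ^ (degSum x * degSum y)) • A.headShuffle a y x := by
  cases x with
  | nil =>
    cases y with
    | nil => simp [headShuffle]
    | cons b y => simp [headShuffle]
  | cons b x =>
    cases y with
    | nil => simp [headShuffle]
    | cons c y =>
      simp only [tens_cons, headShuffle, shuffleMul_cons]
      rw [map_add, map_smul]
      simp only [LinearMap.smul_apply, LinearMap.add_apply, headMul_lt_mul, degSum_cons]
      have h := shuffleMul_comm A.isInternal (b :: x) y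
      simp only [tens_cons, degSum_cons] at h
      rw [h]
      simp only [mul_smul_comm, smul_smul]
      generalize letterDeg b = b', letterDeg c = c', degSum x = x', degSum y = y'
      match_scalars
      all_goals
        simp only [neg_one_zpow_eq, Int.even_add, Int.even_mul] <;> grind

/-- Splits off the shuffles that begin with the fused letter formed by `a` and the head of `x`; this
also covers the empty `x`, which has no head. -/
theorem shuffleMul_headMul (a b : Letter A.grade) (x y : List (Letter A.grade)) :
    Sh (b :: y) (A.headMul (tens x) a.2) = lt b * Sh y (A.headMul (tens x) a.2) +
      ((-1 : ℝ) ^ ((letterDeg b + degSum y) * (letterDeg a + degSum x + 1))) •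
        A.headShuffle a x (b :: y) := by
  cases x with
  | nil => simp [headShuffle]
  | cons c x =>
    have h := shuffleMul_comm A.isInternal (b :: y) x
    simp only [tens_cons, headShuffle, headMul_lt_mul, shuffleMul_cons, degSum_cons] at h ⊢
    rw [h]
    simp only [mul_smul_comm, smul_smul, letterDeg_mulLetter]
    generalize letterDeg b = b', letterDeg c = c', degSum x = x', degSum y = y', letterDeg a = a'
    match_scalars
    all_goals
      simp only [neg_one_zpow_eq, Int.even_add, Int.even_mul, Int.not_even_one] <;> grind

theorem headShuffle_bracketLetter_comm (a b : Letter A.grade) (x y : List (Letter A.grade)) :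
    A.headShuffle (A.bracketLetter a b) x y =
      (-(-1 : ℝ) ^ (letterDeg a * letterDeg b)) •
        A.headShuffle (A.bracketLetter b a) x y := by
  cases x with
  | nil => simp [headShuffle]
  | cons c x =>
    have h : lt (A.mulLetter (A.bracketLetter a b) c) =
        (-(-1 : ℝ) ^ (letterDeg a * letterDeg b)) •
          lt (A.mulLetter (A.bracketLetter b a) c) := by
      simp only [lt, mulLetter, bracketLetter]
      rw [A.antisymm a.2.2 b.2.2, letterDeg, letterDeg]
      simp
    simp only [headShuffle, h, smul_mul_assoc]

/-- The operator `m` is a graded derivation of the shuffle product. -/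
theorem mulOp_shuffleMul (x y : List (Letter A.grade)) :
    A.mulOp (Sh x (tens y)) =
      ((-1 : ℝ) ^ ((degSum x + 1) * degSum y)) • Sh y (A.mulOp (tens x)) +
      ((-1 : ℝ) ^ degSum x) • Sh x (A.mulOp (tens y)) := by
  induction x generalizing y with
  | nil => simp
  | cons a x ihx =>
    induction y with
    | nil => simp
    | cons b y ihy =>
      have h1 := ihx (b :: y)
      have h2 := A.headMul_shuffleMul a x (b :: y)
      have h3 : A.headMul (Sh (a :: x) (tens y)) b.2 = _ := A.headMul_shuffleMul b (a :: x) y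
      have h4 := A.shuffleMul_headMul a b x y
      have h5 := A.shuffleMul_headMul b a y x
      have h6 := shuffleMul_comm A.isInternal x y
      have hm : ∀ (a b : Letter A.grade) (x y : List (Letter A.grade)),
          Sh (b :: y) (lt a * A.mulOp (tens x)) = lt b * Sh y (lt a * A.mulOp (tens x)) +
      ((-1 : ℝ) ^ ((letterDeg b + degSum y) * letterDeg a)) •
        (lt a * Sh (b :: y) (A.mulOp (tens x))) := fun a b x y => shuffleMul_cons _ _ _ _ _
      simp only [tens_cons, headShuffle, degSum_cons, mulOp_lt_mul, map_smul, map_add] at *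
      -- The only terms absent from the right-hand side are headed by `ab` and `ba`, products of
      -- letters of different words. They carry the same shuffle of `x` and `y` and cancel by graded
      -- commutativity.
      rw [shuffleMul_cons, map_add, map_smul, mulOp_lt_mul, mulOp_lt_mul, h1, h2, h3, h4, h5, ihy,
        hm, hm, h6, A.lt_mulLetter_comm a b]
      simp only [mul_smul_comm, smul_mul_assoc, smul_smul, smul_add, mul_add]
      generalize letterDeg b = b', degSum x = x', degSum y = y', letterDeg a = a'
      match_scalars
      all_goals
        simp only [neg_one_zpow_eq, Int.even_add, Int.even_mul, Int.not_even_one]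
        grind

/-- The difference of brackets on the right collects the terms in which `a` has fused with the head
`c` of `x` and that do not begin with an uncontracted `b`. Among them `[b, ac]` splits by the
Leibniz rule: one half is the wanted `a[b, c]`, and the other is removed by the `headShuffle` term.
-/
theorem headMul_bracketMul (a b : Letter A.grade) (x y : List (Letter A.grade)) :
    A.headMul (A.bracketMul x (tens (b :: y))) a.2 =
      (-(-1 : ℝ) ^ ((letterDeg a + degSum x + 1) * (letterDeg b + degSum y))) •
        (A.bracketMul (b :: y) (A.headMul (tens x) a.2) -
          lt b * A.bracketMul y (A.headMul (tens x) a.2)) +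
      ((-1 : ℝ) ^ (degSum x * letterDeg b)) •
        (lt (A.mulLetter a b) * A.bracketMul x (tens y)) +
      (-(-1 : ℝ) ^ (letterDeg b * (degSum x + 1))) •
        A.headShuffle (A.bracketLetter a b) x y := by
  cases x with
  | nil => simp [headShuffle]
  | cons c x =>
    have h := A.bracketMul_antisymm (b :: y) x
    have h' := shuffleMul_comm A.isInternal y x
    have hl : lt (A.mulLetter (A.bracketLetter b a) c) =
        (-(-1 : ℝ) ^ (letterDeg b * letterDeg a)) •
          lt (A.mulLetter (A.bracketLetter a b) c) := by
      simp only [lt, mulLetter, bracketLetter]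
      rw [A.antisymm b.2.2 a.2.2, letterDeg, letterDeg]
      simp
    have hl' : lt (A.mulLetter a (A.bracketLetter b c)) =
        (-(-1 : ℝ) ^ (letterDeg b * letterDeg c)) •
          lt (A.mulLetter a (A.bracketLetter c b)) := by
      simp only [lt, mulLetter, bracketLetter]
      rw [A.antisymm b.2.2 c.2.2, letterDeg, letterDeg]
      simp
    simp only [tens_cons, headShuffle, headMul_lt_mul, bracketMul_cons, degSum_cons, map_add,
      map_smul, LinearMap.add_apply, LinearMap.smul_apply] at h ⊢
    rw [h, h', lt_bracketLetter_mulLetter, hl, hl']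
    simp only [mul_smul_comm, smul_mul_assoc, smul_smul, smul_add, mul_add, add_mul,
      letterDeg_mulLetter]
    generalize letterDeg b = b', letterDeg c = c', degSum x = x', degSum y = y', letterDeg a = a'
    match_scalars
    all_goals
      simp only [neg_one_zpow_eq, Int.even_add, Int.even_mul, Int.not_even_one] <;> grind

/-- The operator `m` is a graded derivation of the bracket. -/
theorem mulOp_bracketMul (x y : List (Letter A.grade)) :
    A.mulOp (A.bracketMul x (tens y)) =
      (-(-1 : ℝ) ^ ((degSum x + 1) * degSum y)) • A.bracketMul y (A.mulOp (tens x)) +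
      ((-1 : ℝ) ^ degSum x) • A.bracketMul x (A.mulOp (tens y)) := by
  induction x generalizing y with
  | nil => simp
  | cons a x ihx =>
    induction y with
    | nil => simp
    | cons b y ihy =>
      have h1 := ihx (b :: y)
      have h2 := A.headMul_bracketMul a b x y
      have h3 := A.headMul_bracketMul b a y x
      have h4 := A.headMul_shuffleMul (A.bracketLetter a b) x y
      have h5 := A.bracketMul_antisymm x y
      have h6 := A.bracketMul_antisymm (a :: x) y
      have h7 := A.mulOp_shuffleMul x y
      have h8 := A.headShuffle_bracketLetter_comm b a y x
      have hm : ∀ (a b : Letter A.grade) (x y : List (Letter A.grade)),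
          A.bracketMul (b :: y) (lt a * A.mulOp (tens x)) = _ :=
        fun a b x y => A.bracketMul_cons b y a _
      rw [h8] at h3
      -- The two Leibniz corrections in `h2` and `h3` cancel against `h4`, where the contracted
      -- letter `[a, b]` is multiplied by the next letter. The terms headed by `ab` and `ba` cancel
      -- by commutativity of the product and antisymmetry of the bracket.
      simp only [tens_cons, degSum_cons, mulOp_lt_mul, map_smul, map_add] at h1 h2 h3 h4 h6 ihy ⊢
      rw [bracketMul_cons, map_add, map_add, map_smul, map_smul, mulOp_lt_mul, mulOp_lt_mul,
        mulOp_lt_mul, h1, h2, ihy, h4, h6, map_smul, LinearMap.smul_apply, h3,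
        hm, hm, h5, h7, A.lt_mulLetter_comm a b, A.lt_bracketLetter_comm b a]
      simp only [mul_smul_comm, smul_mul_assoc, smul_smul, smul_add, mul_add, smul_sub,
        letterDeg_bracketLetter]
      generalize letterDeg b = b', degSum x = x', degSum y = y', letterDeg a = a'
      match_scalars
      all_goals
        simp only [neg_one_zpow_eq, Int.even_add, Int.even_mul, Int.not_even_one]
        grind

end GerstenhaberAlgebra

/-! ### Permutations sorted by the index sent to the first position -/

section InsertPerm

/-- The permutation sending `i` to `0` and acting on the other indices as `e`. -/
def insertPerm {n : ℕ} (i : Fin (n + 1)) (e : Equiv.Perm (Fin n)) : Equiv.Perm (Fin (n + 1)) :=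
  (finSuccEquiv' i).trans ((Equiv.optionCongr e).trans (finSuccEquiv' 0).symm)

variable {n : ℕ} (i : Fin (n + 1)) (e : Equiv.Perm (Fin n))

@[simp] theorem insertPerm_self : insertPerm i e i = 0 := by simp [insertPerm]

@[simp] theorem insertPerm_succAbove (k : Fin n) :
    insertPerm i e (i.succAbove k) = (e k).succ := by simp [insertPerm]

@[simp] theorem insertPerm_inv_zero : (insertPerm i e)⁻¹ 0 = i := by
  rw [Equiv.Perm.inv_eq_iff_eq]; simp

@[simp] theorem insertPerm_inv_succ (k : Fin n) :
    (insertPerm i e)⁻¹ k.succ = i.succAbove (e⁻¹ k) := by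
  rw [Equiv.Perm.inv_eq_iff_eq]; simp

theorem insertPerm_bijective :
    Function.Bijective fun q : Fin (n + 1) × Equiv.Perm (Fin n) => insertPerm q.1 q.2 := by
  rw [Fintype.bijective_iff_injective_and_card]
  constructor
  · rintro ⟨i, e⟩ ⟨i', e'⟩ h
    simp only at h
    have hi : i = i' := by
      rw [← insertPerm_inv_zero i e, h, insertPerm_inv_zero]
    subst hi
    congr 1
    ext k : 1
    have := congrArg (fun f => f (i.succAbove k)) h
    simpa using this
  · simp [Fintype.card_perm, Nat.factorial_succ]

theorem sum_perm_succ {N : Type*} [AddCommMonoid N] (f : Equiv.Perm (Fin (n + 1)) → N) :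
    ∑ σ, f σ = ∑ i, ∑ e, f (insertPerm i e) := by
  rw [← Fintype.sum_prod_type' fun i e => f (insertPerm i e)]
  exact (insertPerm_bijective.sum_comp f).symm

theorem mem_shuffles {p : ℕ} {σ : Equiv.Perm (Fin n)} : σ ∈ shuffles p n ↔
    ∀ i j : Fin n, i < j → ((j : ℕ) < p ∨ p ≤ (i : ℕ)) → σ i < σ j := by
  simp [shuffles]

/-- The first letter of a shuffle must be the first letter of its own block, since otherwise an
earlier letter of that block would have to precede position `0`. -/
theorem eq_of_insertPerm_mem_shuffles {p : ℕ} (h : insertPerm i e ∈ shuffles p (n + 1)) :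
    i = 0 ∨ (i : ℕ) = p := by
  rw [mem_shuffles] at h
  by_contra! hi
  rcases lt_or_gt_of_ne hi.2 with hp | hp
  · have := h 0 i (Fin.pos_iff_ne_zero.2 hi.1) (Or.inl hp)
    simp at this
  · have := h ⟨p, hp.trans i.2⟩ i hp (Or.inr le_rfl)
    simp at this

theorem insertPerm_zero_mem_shuffles (q : ℕ) :
    insertPerm 0 e ∈ shuffles (q + 1) (n + 1) ↔ e ∈ shuffles q n := by
  rw [mem_shuffles, mem_shuffles]
  constructor
  · intro h i j hij hq
    have := h i.succ j.succ (Fin.succ_lt_succ_iff.2 hij) (by simpa using hq)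
    rw [← Fin.zero_succAbove, ← Fin.zero_succAbove, insertPerm_succAbove,
      insertPerm_succAbove] at this
    simpa using this
  · intro h i j hij hq
    rcases Fin.eq_zero_or_eq_succ j with rfl | ⟨j, rfl⟩
    · simp at hij
    rcases Fin.eq_zero_or_eq_succ i with rfl | ⟨i, rfl⟩
    · rw [insertPerm_self, ← Fin.zero_succAbove, insertPerm_succAbove]
      exact Fin.succ_pos _
    · rw [← Fin.zero_succAbove, ← Fin.zero_succAbove, insertPerm_succAbove,
        insertPerm_succAbove, Fin.succ_lt_succ_iff]
      exact h i j (Fin.succ_lt_succ_iff.1 hij) (by simpa using hq)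

theorem succAbove_val_lt_iff (k : Fin n) : (i.succAbove k : ℕ) < i ↔ (k : ℕ) < i := by
  rcases lt_or_ge (k : ℕ) i with h | h
  · rw [Fin.succAbove_of_castSucc_lt _ _ h]; simp
  · rw [Fin.succAbove_of_le_castSucc _ _ h]; simp; omega

/-- Here the block size is `i` itself, so the deleted index is the first of the second block and the
size of the first block is unchanged. -/
theorem insertPerm_mem_shuffles :
    insertPerm i e ∈ shuffles i (n + 1) ↔ e ∈ shuffles i n := by
  rw [mem_shuffles, mem_shuffles]
  constructor
  · intro h j k hjk hq
    have := h (i.succAbove j) (i.succAbove k) (Fin.succAbove_lt_succAbove_iff.2 hjk) (by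
      rwa [succAbove_val_lt_iff, ← not_lt, succAbove_val_lt_iff, not_lt])
    simpa using this
  · intro h j k hjk hq
    rcases Fin.eq_self_or_eq_succAbove i k with rfl | ⟨k, rfl⟩
    · have : (j : ℕ) < k := hjk
      omega
    rcases Fin.eq_self_or_eq_succAbove i j with rfl | ⟨j, rfl⟩
    · simp
    · rw [succAbove_val_lt_iff, ← not_lt, succAbove_val_lt_iff, not_lt] at hq
      simpa using h j k (Fin.succAbove_lt_succAbove_iff.1 hjk) hq

end InsertPerm

/-! ### Signed sums over shuffles by recursion on the first letter -/

section ShuffleSum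

variable {V N : Type*} [AddCommGroup V] [Module ℝ V] {𝒱 : ℤ → Submodule ℝ V}
  [AddCommGroup N] [Module ℝ N]

/-- The Koszul sign of a permutation of a finite family of letters. -/
def koszulFam {n : ℕ} (b : Fin n → Letter 𝒱) (σ : Equiv.Perm (Fin n)) : ℝ :=
  ∏ i, ∏ j, if i < j ∧ σ j < σ i then (-1 : ℝ) ^ (letterDeg (b i) * letterDeg (b j)) else 1

/-- The signed sum over all shuffles of the values of `F` on the shuffled word, in which each
letter is marked according to the block it comes from. -/
def shuffleSumFam {n : ℕ} (F : List (Letter 𝒱 × Bool) → N) (b : Fin n → Letter 𝒱) (p : ℕ) : N :=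
  ∑ σ ∈ shuffles p n, koszulFam b σ •
    F (List.ofFn fun k => (b (σ⁻¹ k), decide (((σ⁻¹ k : Fin n) : ℕ) < p)))

/-- Moving letter `i` to the front inverts it with exactly the letters before it; the remaining
inversions are those of `e`. -/
theorem koszulFam_insertPerm {n : ℕ} (b : Fin (n + 1) → Letter 𝒱) (i : Fin (n + 1))
    (e : Equiv.Perm (Fin n)) : koszulFam b (insertPerm i e) =
      (∏ k : Fin n, if (k : ℕ) < i then
        (-1 : ℝ) ^ (letterDeg (b (i.succAbove k)) * letterDeg (b i)) else 1) *
      koszulFam (fun k => b (i.succAbove k)) e := by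
  have h : ∀ k, (i.succAbove k < i) = ((k : ℕ) < i) := fun k =>
    propext (succAbove_val_lt_iff i k)
  simp only [koszulFam]
  rw [Fin.prod_univ_succAbove _ i, ← Finset.prod_mul_distrib]
  simp only [insertPerm_self, Fin.not_lt_zero, and_false, if_false, Finset.prod_const_one, one_mul]
  refine Finset.prod_congr rfl fun k _ => ?_
  rw [Fin.prod_univ_succAbove _ i]
  simp only [insertPerm_self, insertPerm_succAbove, h, Fin.succ_pos, and_true,
    Fin.succAbove_lt_succAbove_iff, Fin.succ_lt_succ_iff]

theorem shuffleSumFam_succ {n : ℕ} (F : List (Letter 𝒱 × Bool) → N) (b : Fin (n + 1) → Letter 𝒱)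
    (p : ℕ) (hp : p ≤ n + 1) :
    shuffleSumFam F b p =
      (if 0 < p then
        shuffleSumFam (fun w => F ((b 0, true) :: w)) (fun k => b k.succ) (p - 1) else 0) +
      (if h : p < n + 1 then
        (∏ k : Fin n, if (k : ℕ) < p then (-1 : ℝ) ^ (letterDeg (b (Fin.succAbove ⟨p, h⟩ k)) *
          letterDeg (b ⟨p, h⟩)) else 1) •
        shuffleSumFam (fun w => F ((b ⟨p, h⟩, false) :: w))
          (fun k => b (Fin.succAbove ⟨p, h⟩ k)) p else 0) := by
  have hterm : ∀ i : Fin (n + 1), ∑ e : Equiv.Perm (Fin n),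
      (if insertPerm i e ∈ shuffles p (n + 1) then koszulFam b (insertPerm i e) •
        F (List.ofFn fun k => (b ((insertPerm i e)⁻¹ k),
          decide ((((insertPerm i e)⁻¹ k : Fin (n + 1)) : ℕ) < p))) else 0) =
      (if i = 0 ∧ 0 < p then
        shuffleSumFam (fun w => F ((b 0, true) :: w)) (fun k => b k.succ) (p - 1) else 0) +
      (if (i : ℕ) = p then
        (∏ k : Fin n, if (k : ℕ) < i then (-1 : ℝ) ^ (letterDeg (b (Fin.succAbove i k)) *
          letterDeg (b i)) else 1) •
        shuffleSumFam (fun w => F ((b i, false) :: w))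
          (fun k => b (Fin.succAbove i k)) p else 0) := by
    intro i
    -- For `p = 0` the index `0` starts the second block, so the condition `0 < p` keeps the two
    -- cases disjoint.
    by_cases h1 : i = 0 ∧ 0 < p
    · obtain ⟨rfl, hp⟩ := h1
      obtain ⟨q, rfl⟩ := Nat.exists_eq_succ_of_ne_zero hp.ne'
      simp only [Nat.succ_eq_add_one, insertPerm_zero_mem_shuffles, List.ofFn_succ]
      rw [if_pos ⟨trivial, hp⟩, if_neg (by simp), add_zero, shuffleSumFam, ← Finset.sum_filter]
      refine Finset.sum_congr (by ext; simp) fun e _ => ?_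
      rw [koszulFam_insertPerm]
      simp
    · by_cases h2 : (i : ℕ) = p
      · subst h2
        simp only [insertPerm_mem_shuffles, List.ofFn_succ]
        rw [if_neg h1, if_pos trivial, zero_add, shuffleSumFam, ← Finset.sum_filter,
          Finset.smul_sum]
        refine Finset.sum_congr (by ext; simp) fun e _ => ?_
        rw [koszulFam_insertPerm, mul_smul]
        simp only [insertPerm_inv_zero, insertPerm_inv_succ, succAbove_val_lt_iff,
          lt_self_iff_false, decide_false]
      · rw [if_neg h1, if_neg h2, add_zero]
        refine Finset.sum_eq_zero fun e _ => if_neg fun h => ?_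
        rcases eq_of_insertPerm_mem_shuffles i e h with h | h
        · subst h
          simp at h1 h2
          omega
        · exact h2 h
  have h0 : shuffleSumFam F b p = ∑ σ : Equiv.Perm (Fin (n + 1)),
      (if σ ∈ shuffles p (n + 1) then koszulFam b σ •
        F (List.ofFn fun k => (b (σ⁻¹ k), decide (((σ⁻¹ k : Fin (n + 1)) : ℕ) < p))) else 0) := by
    rw [shuffleSumFam, ← Finset.sum_filter]
    exact Finset.sum_congr (by ext; simp) fun _ _ => rfl
  rw [h0, sum_perm_succ, Finset.sum_congr rfl fun i _ => hterm i, Finset.sum_add_distrib]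
  congr 1
  · by_cases h : 0 < p <;> simp [h]
  · split_ifs with h
    · rw [Finset.sum_eq_single ⟨p, h⟩ (fun j _ hj => if_neg fun h' => hj (Fin.ext h')) (by simp),
        if_pos rfl]
    · exact Finset.sum_eq_zero fun i _ => if_neg (by omega)

theorem shuffleSumFam_cast {n m : ℕ} (h : n = m) (F : List (Letter 𝒱 × Bool) → N)
    (b : Fin n → Letter 𝒱) (b' : Fin m → Letter 𝒱) (hb : ∀ k, b k = b' (Fin.cast h k)) (p : ℕ) :
    shuffleSumFam F b p = shuffleSumFam F b' p := by
  subst h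
  congr 1
  exact funext hb

/-- The signed sum of the values of `F` over all shuffles of two words. -/
def shuffleSum (F : List (Letter 𝒱 × Bool) → N) (x y : List (Letter 𝒱)) : N :=
  shuffleSumFam F (x ++ y).get x.length

theorem shuffleSum_nil_nil (F : List (Letter 𝒱 × Bool) → N) :
    shuffleSum F ([] : List (Letter 𝒱)) [] = F [] := by
  have : shuffles 0 0 = {1} := by decide
  simp [shuffleSum, shuffleSumFam, this, koszulFam]

theorem shuffleSum_nil_cons (F : List (Letter 𝒱 × Bool) → N) (b : Letter 𝒱) (y) :
    shuffleSum F [] (b :: y) = shuffleSum (fun w => F ((b, false) :: w)) [] y := by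
  refine (shuffleSumFam_succ (n := y.length) F _ 0 (by simp)).trans ?_
  simp [shuffleSum]
  rfl

theorem shuffleSum_cons_nil (F : List (Letter 𝒱 × Bool) → N) (a : Letter 𝒱) (x) :
    shuffleSum F (a :: x) [] = shuffleSum (fun w => F ((a, true) :: w)) x [] := by
  refine (shuffleSumFam_succ (n := (x ++ []).length) F _ (x.length + 1) (by simp)).trans ?_
  rw [if_pos (Nat.succ_pos _), dif_neg (by simp), add_zero]
  rfl

theorem prod_koszul_block (x : List (Letter 𝒱)) (b : Letter 𝒱) {n : ℕ} (hn : x.length ≤ n)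
    (f : Fin n → Letter 𝒱) (hf : ∀ (k : ℕ) (hk : k < x.length), f ⟨k, hk.trans_le hn⟩ = x[k]) :
    (∏ k : Fin n, if (k : ℕ) < x.length then (-1 : ℝ) ^ (letterDeg (f k) * letterDeg b) else 1) =
      (-1 : ℝ) ^ (degSum x * letterDeg b) := by
  induction x generalizing n with
  | nil => simp
  | cons a x ih =>
    obtain ⟨n, rfl⟩ : ∃ m, n = m + 1 := ⟨n - 1, by simp at hn; omega⟩
    have h0 : f 0 = a := hf 0 (by simp)
    have := ih (n := n) (by simpa using hn) (fun k => f k.succ)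
      (fun k hk => hf (k + 1) (by simpa using hk))
    rw [Fin.prod_univ_succ]
    simp only [List.length_cons, Fin.val_zero, Nat.zero_lt_succ, if_true, Fin.val_succ,
      Nat.add_lt_add_iff_right, this, h0, degSum_cons]
    rw [add_mul, zpow_add₀ (by norm_num)]

theorem shuffleSum_cons_cons (F : List (Letter 𝒱 × Bool) → N) (a : Letter 𝒱) (x) (b : Letter 𝒱)
    (y) : shuffleSum F (a :: x) (b :: y) =
      shuffleSum (fun w => F ((a, true) :: w)) x (b :: y) +
      ((-1 : ℝ) ^ ((letterDeg a + degSum x) * letterDeg b)) •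
        shuffleSum (fun w => F ((b, false) :: w)) (a :: x) y := by
  have hlen : x.length + 1 < (x ++ b :: y).length + 1 := by simp
  -- Skipping the position just after `a :: x` deletes `b` from the concatenated word.
  have hget : ∀ k, (a :: x ++ b :: y).get (Fin.succAbove (n := (x ++ b :: y).length)
      ⟨x.length + 1, hlen⟩ k) = (a :: x ++ y).get (Fin.cast (by simp; omega) k) := by
    intro k
    rcases lt_or_ge (k : ℕ) (x.length + 1) with h | h
    · rw [Fin.succAbove_of_castSucc_lt _ _ h]
      simp only [List.get_eq_getElem, Fin.val_castSucc, Fin.val_cast]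
      rw [List.getElem_append_left (by simpa using h), List.getElem_append_left (by simpa using h)]
    · rw [Fin.succAbove_of_le_castSucc _ _ h]
      simp only [List.get_eq_getElem, Fin.val_succ, Fin.val_cast]
      rw [List.getElem_append_right (by simp; omega), List.getElem_append_right (by simpa using h)]
      simp only [List.length_cons, Nat.sub_add_comm h, List.getElem_cons_succ]
  refine (shuffleSumFam_succ (n := (x ++ b :: y).length) F _ (x.length + 1) (by simp)).trans ?_
  have hb : (a :: x ++ b :: y).get ⟨x.length + 1, hlen⟩ = b := by simp
  rw [if_pos (Nat.succ_pos _), dif_pos hlen]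
  congr 1
  have hs := prod_koszul_block (a :: x) b (n := (x ++ b :: y).length) (by simp)
    (fun k => (a :: x ++ b :: y).get (Fin.succAbove ⟨x.length + 1, hlen⟩ k)) (by
      intro k hk
      rw [hget]
      simp only [List.get_eq_getElem, Fin.val_cast]
      rw [List.getElem_append_left hk])
  rw [degSum_cons] at hs
  rw [← hs]
  congr 1
  · rw [hb]; rfl
  · rw [hb]
    exact shuffleSumFam_cast _ _ _ _ hget _

theorem shuffleSum_nil (F : List (Letter 𝒱 × Bool) → N) (y : List (Letter 𝒱)) :
    shuffleSum F [] y = F (y.map fun b => (b, false)) := by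
  induction y generalizing F with
  | nil => exact shuffleSum_nil_nil F
  | cons b y ih => rw [shuffleSum_nil_cons, ih]; rfl

theorem shuffleSum_nil_right (F : List (Letter 𝒱 × Bool) → N) (x : List (Letter 𝒱)) :
    shuffleSum F x [] = F (x.map fun b => (b, true)) := by
  induction x generalizing F with
  | nil => exact shuffleSum_nil_nil F
  | cons b y ih => rw [shuffleSum_cons_nil, ih]; rfl

theorem shuffleSum_add (F F' : List (Letter 𝒱 × Bool) → N) (x y : List (Letter 𝒱)) :
    shuffleSum (fun w => F w + F' w) x y = shuffleSum F x y + shuffleSum F' x y := by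
  simp [shuffleSum, shuffleSumFam, Finset.sum_add_distrib]

theorem shuffleSum_map {N' : Type*} [AddCommGroup N'] [Module ℝ N'] (φ : N →ₗ[ℝ] N')
    (F : List (Letter 𝒱 × Bool) → N) (x y : List (Letter 𝒱)) :
    shuffleSum (fun w => φ (F w)) x y = φ (shuffleSum F x y) := by
  simp [shuffleSum, shuffleSumFam]

end ShuffleSum

/-! ### Sums over adjacent pairs of letters -/

section AdjacentSum

variable {α N : Type*} [AddCommGroup N]

/-- The sum over all pairs of adjacent entries of a list. -/
def adjSum (g : List α → α → α → List α → N) (w : List α) : N :=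
  ∑ k : Fin w.length, ∑ k' : Fin w.length,
    if (k' : ℕ) = k + 1 then g (w.take k) (w.get k) (w.get k') (w.drop (k + 2)) else 0

variable (g : List α → α → α → List α → N)

@[simp] theorem adjSum_nil : adjSum g [] = 0 := rfl

@[simp] theorem adjSum_singleton (a : α) : adjSum g [a] = 0 := by simp [adjSum]

theorem adjSum_cons_cons (a b : α) (w : List α) :
    adjSum g (a :: b :: w) = g [] a b w + adjSum (fun u => g (a :: u)) (b :: w) := by
  refine (Fin.sum_univ_succ (n := (b :: w).length) _).trans ?_
  congr 1
  · refine (Fin.sum_univ_succ (n := (b :: w).length) _).trans ?_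
    refine (congrArg₂ (· + ·) (if_neg (by simp)) (Fin.sum_univ_succ (n := w.length) _)).trans ?_
    simp
  · refine Finset.sum_congr rfl fun k _ => ?_
    refine (Fin.sum_univ_succ (n := (b :: w).length) _).trans ?_
    refine (congrArg (· + _) (if_neg (by simp))).trans ?_
    simp

theorem smul_adjSum {R : Type*} [Semiring R] [Module R N] (c : R) (w : List α) :
    c • adjSum g w = adjSum (fun u a b v => c • g u a b v) w := by
  simp only [adjSum, Finset.smul_sum, smul_ite, smul_zero]

theorem mul_adjSum {R : Type*} [Ring R] (c : R) (g : List α → α → α → List α → R) (w : List α) :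
    c * adjSum g w = adjSum (fun u a b v => c * g u a b v) w := by
  simp only [adjSum, Finset.mul_sum, mul_ite, mul_zero]

theorem adjSum_ofFn {n : ℕ} (f : Fin n → α) : adjSum g (List.ofFn f) =
    ∑ k : Fin n, ∑ k' : Fin n, if (k' : ℕ) = k + 1 then
      g ((List.ofFn f).take k) (f k) (f k') ((List.ofFn f).drop (k + 2)) else 0 := by
  refine Fintype.sum_equiv (finCongr (List.length_ofFn)) _ _ fun k =>
    Fintype.sum_equiv (finCongr (List.length_ofFn)) _ _ fun k' => ?_
  simp
  rfl

end AdjacentSum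

/-! ### Agreement of the closed sums with the recursive operators -/

section ShuffleProd

variable {V : Type*} [AddCommGroup V] [Module ℝ V] {𝒱 : ℤ → Submodule ℝ V}

theorem shuffleProd_eq_shuffleSum (x y : List (Letter 𝒱)) :
    shuffleProd x y = shuffleSum (fun w => tens (w.map Prod.fst)) x y := by
  simp only [shuffleProd, shuffleSum, shuffleSumFam, List.map_ofFn]
  rfl

theorem shuffleSum_tens (hV : DirectSum.IsInternal 𝒱) (x y : List (Letter 𝒱)) :
    shuffleSum (fun w => tens (w.map Prod.fst)) x y = shuffleMul hV x (tens y) := by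
  induction x generalizing y with
  | nil => simp [shuffleSum_nil, Function.comp_def]
  | cons a x ihx =>
    induction y with
    | nil => simp [shuffleSum_nil_right, Function.comp_def]
    | cons b y ihy =>
      have h := fun (c : Letter 𝒱) => shuffleSum_map (LinearMap.mulLeft ℝ (lt c))
        (fun w : List (Letter 𝒱 × Bool) => tens (w.map Prod.fst))
      simp only [LinearMap.mulLeft_apply] at h
      simp only [shuffleSum_cons_cons, List.map_cons, tens_cons, h, ihx, ihy, shuffleMul_cons]

theorem shuffleProd_eq (hV : DirectSum.IsInternal 𝒱) (x y : List (Letter 𝒱)) :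
    shuffleProd x y = shuffleMul hV x (tens y) := by
  rw [shuffleProd_eq_shuffleSum, shuffleSum_tens hV]

end ShuffleProd

namespace GerstenhaberAlgebra

variable {G : Type*} [AddCommGroup G] [Module ℝ G] (A : GerstenhaberAlgebra G)

theorem mulTens_eq_adjSum (w : List (Letter A.grade)) : A.mulTens w =
    adjSum (fun u a b v => ((-1 : ℝ) ^ (degSum u + letterDeg a)) •
      (tens u * lt (A.mulLetter a b) * tens v)) w := by
  simp only [mulTens, adjSum]
  refine Finset.sum_congr rfl fun k _ => Finset.sum_congr rfl fun k' _ => ?_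
  have h : ((w.take (k + 1)).map letterDeg).sum = degSum (w.take k) + letterDeg (w.get k) := by
    rw [List.take_add_one, degSum]
    simp
  rw [h]
  rfl

theorem mulTens_eq (w : List (Letter A.grade)) : A.mulTens w = A.mulOp (tens w) := by
  rw [mulTens_eq_adjSum]
  induction w with
  | nil => simp
  | cons a w ih =>
    cases w with
    | nil => rw [tens_cons, mulOp_lt_mul]; simp
    | cons b w =>
      rw [adjSum_cons_cons, tens_cons, mulOp_lt_mul, ← ih, mul_adjSum, smul_add, tens_cons,
        headMul_lt_mul, smul_adjSum]
      congr 1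
      · simp
      · congr 1
        ext u c d v
        simp [smul_smul, _root_.mul_assoc, add_assoc, zpow_add₀]

/-- The contraction of the adjacent pairs of a marked word that come from different blocks. -/
def contract (w : List (Letter A.grade × Bool)) : TensorAlgebra ℝ G :=
  adjSum (fun u a b v => if a.2 = true ∧ b.2 = false then
    tens (u.map Prod.fst) * lt (A.bracketLetter a.1 b.1) * tens (v.map Prod.fst) else 0) w

/-- The contraction of the first pair of a word, if its second letter is in the second block. -/
def contractHead (a : Letter A.grade) : List (Letter A.grade × Bool) → TensorAlgebra ℝ G
  | [] => 0
  | b :: w => if b.2 = false then lt (A.bracketLetter a b.1) * tens (w.map Prod.fst) else 0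

theorem contract_cons (a : Letter A.grade × Bool) (w : List (Letter A.grade × Bool)) :
    A.contract (a :: w) = (if a.2 = true then A.contractHead a.1 w else 0) +
      lt a.1 * A.contract w := by
  cases w with
  | nil => simp [contract, contractHead]
  | cons b w =>
    rw [contract, adjSum_cons_cons, contract, mul_adjSum]
    congr 1
    · by_cases h : a.2 = true <;> simp [contractHead, h]
    · congr 1
      ext u c d v
      split_ifs <;> simp [_root_.mul_assoc]

theorem bracketTens_eq_shuffleSum (x y : List (Letter A.grade)) :
    A.bracketTens x y = shuffleSum A.contract x y := by
  simp only [bracketTens, shuffleSum, shuffleSumFam, contract, adjSum_ofFn, List.map_take,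
    List.map_drop, List.map_ofFn, Finset.smul_sum]
  refine Finset.sum_congr rfl fun σ _ => Finset.sum_congr rfl fun k _ =>
    Finset.sum_congr rfl fun k' _ => ?_
  by_cases h : (k' : ℕ) = k + 1
  · simp only [h, true_and, if_true, decide_eq_true_eq, decide_eq_false_iff_not, not_lt]
    split_ifs
    · rfl
    · simp
  · simp [h]

theorem shuffleSum_contractHead (a : Letter A.grade) (x : List (Letter A.grade))
    (b : Letter A.grade) (y : List (Letter A.grade)) :
    shuffleSum (A.contractHead a) x (b :: y) = ((-1 : ℝ) ^ (degSum x * letterDeg b)) •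
      (lt (A.bracketLetter a b) * shuffleMul A.isInternal x (tens y)) := by
  have h := shuffleSum_map (LinearMap.mulLeft ℝ (lt (A.bracketLetter a b)))
    (fun w : List (Letter A.grade × Bool) => tens (w.map Prod.fst)) x y
  simp only [LinearMap.mulLeft_apply, shuffleSum_tens A.isInternal] at h
  rw [← h]
  cases x with
  | nil => simp [shuffleSum_nil_cons, contractHead]
  | cons c x =>
    rw [shuffleSum_cons_cons]
    -- Shuffles whose next letter is again in the first block allow no contraction with `a`, so that
    -- half of the sum vanishes.
    have h0 := shuffleSum_map (0 : TensorAlgebra ℝ G →ₗ[ℝ] TensorAlgebra ℝ G)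
      (fun w : List (Letter A.grade × Bool) => tens (w.map Prod.fst)) x (b :: y)
    simp only [LinearMap.zero_apply] at h0
    simp [contractHead, h0]

theorem bracketTens_eq (x y : List (Letter A.grade)) :
    A.bracketTens x y = A.bracketMul x (tens y) := by
  rw [bracketTens_eq_shuffleSum]
  have hF : ∀ (c : Letter A.grade) (u v : List (Letter A.grade)),
      shuffleSum (fun w => lt c * A.contract w) u v = lt c * shuffleSum A.contract u v :=
    fun c => shuffleSum_map (LinearMap.mulLeft ℝ (lt c)) A.contract
  induction x generalizing y with
  | nil =>
    rw [shuffleSum_nil, bracketMul_nil]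
    induction y with
    | nil => rfl
    | cons b y ih => rw [List.map_cons, contract_cons, ih]; simp
  | cons a x ihx =>
    induction y with
    | nil =>
      rw [shuffleSum_nil_right, tens_nil, bracketMul_one]
      clear ihx
      -- With an empty second word every mark is `true`, so nothing is ever contracted.
      induction (a :: x) with
      | nil => rfl
      | cons b z ih =>
        rw [List.map_cons, contract_cons, ih]
        cases z <;> simp [contractHead]
    | cons b y ihy =>
      rw [shuffleSum_cons_cons]
      simp only [contract_cons, if_true, Bool.false_eq_true, if_false, zero_add]
      rw [shuffleSum_add, hF, hF, ihx, ihy, shuffleSum_contractHead, tens_cons, bracketMul_cons]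
      abel

end GerstenhaberAlgebra

/-! ### Linear and bilinear maps prescribed on a spanning family -/

section Extension

variable {I E N : Type*} [AddCommGroup E] [Module ℝ E] [AddCommGroup N] [Module ℝ N]

theorem exists_linearMap_of_span {q : I → E} (hq : Submodule.span ℝ (Set.range q) = ⊤) (g : I → N)
    (h : ∀ c : I →₀ ℝ, Finsupp.linearCombination ℝ q c = 0 →
      Finsupp.linearCombination ℝ g c = 0) : ∃ φ : E →ₗ[ℝ] N, ∀ i, φ (q i) = g i := by
  have hsurj : Function.Surjective (Finsupp.linearCombination ℝ q) := by
    rw [← LinearMap.range_eq_top, Finsupp.range_linearCombination, hq]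
  let e := (Finsupp.linearCombination ℝ q).quotKerEquivOfSurjective hsurj
  refine ⟨(Submodule.liftQ _ (Finsupp.linearCombination ℝ g) fun c hc => h c hc) ∘ₗ
    e.symm.toLinearMap, fun i => ?_⟩
  have : e.symm (q i) = Submodule.Quotient.mk (Finsupp.single i 1) := by
    rw [LinearEquiv.symm_apply_eq]
    simp [e]
  rw [LinearMap.comp_apply, LinearEquiv.coe_coe, this]
  exact (Submodule.liftQ_apply _ _ _).trans (by simp)

/-- A function of two indices which is linear in each of them extends to a bilinear map. -/
theorem exists_bilinear_of_span {q : I → E} (hq : Submodule.span ℝ (Set.range q) = ⊤)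
    (f : I → I → N) (h₁ : ∀ i, ∃ φ : E →ₗ[ℝ] N, ∀ j, φ (q j) = f i j)
    (h₂ : ∀ j, ∃ φ : E →ₗ[ℝ] N, ∀ i, φ (q i) = f i j) :
    ∃ B : E →ₗ[ℝ] E →ₗ[ℝ] N, ∀ i j, B (q i) (q j) = f i j := by
  choose φ hφ using h₁
  choose ψ hψ using h₂
  obtain ⟨B, hB⟩ := exists_linearMap_of_span hq φ fun c hc => by
    refine LinearMap.ext_on hq ?_
    rintro _ ⟨j, rfl⟩
    have := congrArg (ψ j) hc
    simp only [Finsupp.linearCombination_apply, Finsupp.sum, map_sum, map_smul, hψ,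
      map_zero] at this
    simpa [Finsupp.linearCombination_apply, Finsupp.sum, hφ] using this
  exact ⟨B, fun i j => by rw [hB, hφ]⟩

end Extension

/-! ### Homogeneous tensors for an additive degree of letters -/

section Homogeneous

variable {V D : Type*} [AddCommGroup V] [Module ℝ V] {𝒱 : ℤ → Submodule ℝ V} [AddCommMonoid D]

/-- The words whose letters have degrees, in the sense of the relation `r`, of given sum. -/
inductive WordHasDeg (r : Letter 𝒱 → D → Prop) : List (Letter 𝒱) → D → Prop
  | nil : WordHasDeg r [] 0
  | cons {a : Letter 𝒱} {w : List (Letter 𝒱)} {δ ε : D} :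
      r a δ → WordHasDeg r w ε → WordHasDeg r (a :: w) (δ + ε)

/-- The span of the words of a given degree. -/
def homTens (r : Letter 𝒱 → D → Prop) (δ : D) : Submodule ℝ (TensorAlgebra ℝ V) :=
  Submodule.span ℝ {t | ∃ w, WordHasDeg r w δ ∧ t = tens w}

variable {r : Letter 𝒱 → D → Prop} {δ ε : D}

theorem tens_mem_homTens {w : List (Letter 𝒱)} (h : WordHasDeg r w δ) : tens w ∈ homTens r δ :=
  Submodule.subset_span ⟨w, h, rfl⟩

theorem map_mem_of_homTens {N : Type*} [AddCommGroup N] [Module ℝ N]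
    (f : TensorAlgebra ℝ V →ₗ[ℝ] N) {K : Submodule ℝ N}
    (h : ∀ w, WordHasDeg r w δ → f (tens w) ∈ K) {t : TensorAlgebra ℝ V} (ht : t ∈ homTens r δ) :
    f t ∈ K := by
  have : homTens r δ ≤ K.comap f := Submodule.span_le.2 (by rintro _ ⟨w, hw, rfl⟩; exact h w hw)
  exact this ht

theorem lt_mul_mem_homTens {a : Letter 𝒱} (ha : r a δ) {t : TensorAlgebra ℝ V}
    (ht : t ∈ homTens r ε) : lt a * t ∈ homTens r (δ + ε) :=
  map_mem_of_homTens (LinearMap.mulLeft ℝ (lt a)) (fun w hw => by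
    rw [LinearMap.mulLeft_apply, ← tens_cons]; exact tens_mem_homTens (.cons ha hw)) ht

theorem shuffleMul_mem_homTens (hV : DirectSum.IsInternal 𝒱) {x : List (Letter 𝒱)}
    (hx : WordHasDeg r x δ) {t : TensorAlgebra ℝ V} (ht : t ∈ homTens r ε) :
    shuffleMul hV x t ∈ homTens r (δ + ε) := by
  refine map_mem_of_homTens _ (fun y hy => ?_) ht
  clear ht
  induction hx generalizing y ε with
  | nil => rw [zero_add]; exact tens_mem_homTens hy
  | @cons a x δ₁ δ₂ ha hx ih =>
    induction hy with
    | nil => rw [add_zero, tens_nil, shuffleMul_one]; exact tens_mem_homTens (.cons ha hx)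
    | @cons b y ε₁ ε₂ hb hy ih' =>
      have h1 := lt_mul_mem_homTens ha (ih _ (.cons hb hy))
      have h2 := lt_mul_mem_homTens hb ih'
      rw [tens_cons] at h1 ⊢
      rw [shuffleMul_cons]
      refine add_mem ?_ (Submodule.smul_mem _ _ ?_)
      · convert h1 using 2; abel
      · convert h2 using 2; abel

theorem wordHasDeg_letterDeg (w : List (Letter 𝒱)) :
    WordHasDeg (fun (a : Letter 𝒱) d => letterDeg a = d) w (degSum w) := by
  induction w with
  | nil => exact .nil
  | cons a w ih => exact .cons rfl ih

theorem WordHasDeg.degSum_eq {w : List (Letter 𝒱)} {d : ℤ}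
    (h : WordHasDeg (fun (a : Letter 𝒱) d => letterDeg a = d) w d) : degSum w = d := by
  induction h with
  | nil => rfl
  | cons ha _ ih => rw [degSum_cons, ha, ih]

/-- The operator `x ↦ (-1)^(d * deg x) x` on tensors. -/
def degTwist (hV : DirectSum.IsInternal 𝒱) (d : ℤ) :
    TensorAlgebra ℝ V →ₗ[ℝ] TensorAlgebra ℝ V :=
  tensorRec 1 0 (LinearMap.mul ℝ (TensorAlgebra ℝ V) ∘ₗ TensorAlgebra.ι ℝ ∘ₗ signTwist hV d)

theorem degTwist_tens (hV : DirectSum.IsInternal 𝒱) (d : ℤ) (w : List (Letter 𝒱)) :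
    degTwist hV d (tens w) = ((-1 : ℝ) ^ (d * degSum w)) • tens w := by
  induction w with
  | nil => simp [degTwist, tensorRec_one]
  | cons a w ih =>
    rw [tens_cons, lt, degTwist, tensorRec_ι_mul, ← degTwist, ih]
    simp [signTwist_letter, mul_add, zpow_add₀, smul_smul, mul_comm]

theorem degTwist_homTens (hV : DirectSum.IsInternal 𝒱) (d : ℤ) {e : ℤ} {t : TensorAlgebra ℝ V}
    (ht : t ∈ homTens (fun (a : Letter 𝒱) d => letterDeg a = d) e) :
    degTwist hV d t = ((-1 : ℝ) ^ (d * e)) • t := by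
  have := map_mem_of_homTens (degTwist hV d - ((-1 : ℝ) ^ (d * e)) • LinearMap.id) (K := ⊥)
    (fun w hw => by simp [degTwist_tens, hw.degSum_eq]) ht
  simpa [sub_eq_zero] using this

end Homogeneous

/-! ### Passage to the quotient by shuffles -/

section Quotient

variable {V : Type*} [AddCommGroup V] [Module ℝ V] {𝒱 : ℤ → Submodule ℝ V}

theorem wordDeg_eq (w : List (Letter 𝒱)) : wordDeg w = degSum w - 1 := rfl

/-- The class in `𝓗` of a word. -/
def cls (w : List (Letter 𝒱)) : ShuffleQuot 𝒱 := (shuffleRel 𝒱).mkQ (tens w)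

@[simp] theorem cls_nil : cls ([] : List (Letter 𝒱)) = 0 := by
  rw [cls, Submodule.mkQ_apply, Submodule.Quotient.mk_eq_zero, tens_nil]
  exact Submodule.subset_span (Or.inl rfl)

theorem span_cls (hV : DirectSum.IsInternal 𝒱) :
    Submodule.span ℝ (Set.range (cls (𝒱 := 𝒱))) = ⊤ := by
  have : Set.range (cls (𝒱 := 𝒱)) = (shuffleRel 𝒱).mkQ '' Set.range (tens (𝒱 := 𝒱)) := by
    rw [← Set.range_comp]; rfl
  rw [this, Submodule.span_image, span_tens hV, Submodule.map_top, Submodule.range_mkQ]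

/-- The span of the nonempty words. -/
def posTens (𝒱 : ℤ → Submodule ℝ V) : Submodule ℝ (TensorAlgebra ℝ V) :=
  Submodule.span ℝ {t | ∃ w : List (Letter 𝒱), w ≠ [] ∧ t = tens w}

theorem map_mem_of_tens (hV : DirectSum.IsInternal 𝒱) {N : Type*} [AddCommGroup N] [Module ℝ N]
    (f : TensorAlgebra ℝ V →ₗ[ℝ] N) {K : Submodule ℝ N}
    (h : ∀ w : List (Letter 𝒱), f (tens w) ∈ K) (t : TensorAlgebra ℝ V) : f t ∈ K := by
  have : (⊤ : Submodule ℝ (TensorAlgebra ℝ V)) ≤ K.comap f := by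
    rw [← span_tens hV]
    exact Submodule.span_le.2 (by rintro _ ⟨w, rfl⟩; exact h w)
  exact this trivial

theorem lt_mul_mem_posTens (hV : DirectSum.IsInternal 𝒱) (a : Letter 𝒱) (t : TensorAlgebra ℝ V) :
    lt a * t ∈ posTens 𝒱 :=
  map_mem_of_tens hV (LinearMap.mulLeft ℝ (lt a))
    (K := posTens 𝒱) (fun w => Submodule.subset_span ⟨a :: w, by simp, by simp⟩) t

theorem map_mem_of_posTens {N : Type*} [AddCommGroup N] [Module ℝ N]
    (f : TensorAlgebra ℝ V →ₗ[ℝ] N) {K : Submodule ℝ N}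
    (h : ∀ w : List (Letter 𝒱), w ≠ [] → f (tens w) ∈ K) {t : TensorAlgebra ℝ V}
    (ht : t ∈ posTens 𝒱) : f t ∈ K := by
  have : posTens 𝒱 ≤ K.comap f := Submodule.span_le.2 (by rintro _ ⟨w, hw, rfl⟩; exact h w hw)
  exact this ht

theorem shuffleMul_mem_shuffleRel (hV : DirectSum.IsInternal 𝒱) {x : List (Letter 𝒱)}
    (hx : x ≠ []) {t : TensorAlgebra ℝ V} (ht : t ∈ posTens 𝒱) :
    shuffleMul hV x t ∈ shuffleRel 𝒱 :=
  map_mem_of_posTens (shuffleMul hV x) (K := shuffleRel 𝒱) (fun y hy => Submodule.subset_span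
    (Or.inr ⟨x, y, hx, hy, (shuffleProd_eq hV x y).symm⟩)) ht

theorem map_shuffleRel (hV : DirectSum.IsInternal 𝒱) {N : Type*} [AddCommGroup N] [Module ℝ N]
    (f : TensorAlgebra ℝ V →ₗ[ℝ] N) {K : Submodule ℝ N} (h1 : f 1 ∈ K)
    (h : ∀ x y : List (Letter 𝒱), x ≠ [] → y ≠ [] → f (shuffleMul hV x (tens y)) ∈ K) :
    shuffleRel 𝒱 ≤ K.comap f := by
  refine Submodule.span_le.2 ?_
  rintro _ (rfl | ⟨x, y, hx, hy, rfl⟩)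
  · exact h1
  · rw [shuffleProd_eq hV]; exact h x y hx hy

/-- A shuffle of two words is homogeneous, so the twist acts on each defining relation by a sign.
Degree signs thus become linear operators on `𝓗` without a direct sum decomposition of `𝓗`. -/
theorem degTwist_mem_shuffleRel (hV : DirectSum.IsInternal 𝒱) (d : ℤ) :
    shuffleRel 𝒱 ≤ (shuffleRel 𝒱).comap (degTwist hV d) := by
  refine map_shuffleRel hV _ ?_ fun x y hx hy => ?_
  · rw [← tens_nil (𝒱 := 𝒱), degTwist_tens]
    exact Submodule.smul_mem _ _ (Submodule.subset_span (Or.inl rfl))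
  · rw [degTwist_homTens hV d (shuffleMul_mem_homTens hV (wordHasDeg_letterDeg x)
      (tens_mem_homTens (wordHasDeg_letterDeg y)))]
    exact Submodule.smul_mem _ _ (shuffleMul_mem_shuffleRel hV hx
      (Submodule.subset_span ⟨y, hy, rfl⟩))

/-- The operator induced on `𝓗` by `degTwist`. -/
def clsTwist (hV : DirectSum.IsInternal 𝒱) (d : ℤ) : ShuffleQuot 𝒱 →ₗ[ℝ] ShuffleQuot 𝒱 :=
  Submodule.mapQ _ _ (degTwist hV d) (degTwist_mem_shuffleRel hV d)

theorem clsTwist_cls (hV : DirectSum.IsInternal 𝒱) (d : ℤ) (w : List (Letter 𝒱)) :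
    clsTwist hV d (cls w) = ((-1 : ℝ) ^ (d * degSum w)) • cls w := by
  simp only [clsTwist, cls, Submodule.mkQ_apply, Submodule.mapQ_apply, degTwist_tens,
    Submodule.Quotient.mk_smul]

/-- The classes in `𝓗` of the words of a given degree. -/
def homCls {D : Type*} [AddCommMonoid D] (r : Letter 𝒱 → D → Prop) (δ : D) :
    Submodule ℝ (ShuffleQuot 𝒱) := (homTens r δ).map (shuffleRel 𝒱).mkQ

/-- The classes in `𝓗` of the tensors of degree `e`. -/
abbrev degCls (𝒱 : ℤ → Submodule ℝ V) (e : ℤ) : Submodule ℝ (ShuffleQuot 𝒱) :=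
  homCls (fun (a : Letter 𝒱) d => letterDeg a = d) e

theorem map_mem_of_homCls {D : Type*} [AddCommMonoid D] {r : Letter 𝒱 → D → Prop} {δ : D}
    {N : Type*} [AddCommGroup N] [Module ℝ N]
    (f : ShuffleQuot 𝒱 →ₗ[ℝ] N) {K : Submodule ℝ N}
    (h : ∀ w, WordHasDeg r w δ → f (cls w) ∈ K) {t : ShuffleQuot 𝒱} (ht : t ∈ homCls r δ) :
    f t ∈ K := by
  obtain ⟨t, ht, rfl⟩ := ht
  exact map_mem_of_homTens (f ∘ₗ (shuffleRel 𝒱).mkQ) h ht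

theorem eq_of_degCls {e : ℤ} {N : Type*} [AddCommGroup N] [Module ℝ N]
    (f g : ShuffleQuot 𝒱 →ₗ[ℝ] N) (h : ∀ w, degSum w = e → f (cls w) = g (cls w))
    {t : ShuffleQuot 𝒱} (ht : t ∈ degCls 𝒱 e) : f t = g t := by
  have := map_mem_of_homCls (f - g) (K := ⊥)
    (fun w hw => by simp [h w hw.degSum_eq]) ht
  simpa [sub_eq_zero] using this

theorem cls_mem_degCls (w : List (Letter 𝒱)) : cls w ∈ degCls 𝒱 (degSum w) :=
  Submodule.mem_map_of_mem (tens_mem_homTens (wordHasDeg_letterDeg w))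

theorem clsTwist_degCls (hV : DirectSum.IsInternal 𝒱) (d : ℤ) {e : ℤ} {h : ShuffleQuot 𝒱}
    (hh : h ∈ degCls 𝒱 e) : clsTwist hV d h = ((-1 : ℝ) ^ (d * e)) • h :=
  eq_of_degCls (clsTwist hV d) (((-1 : ℝ) ^ (d * e)) • LinearMap.id)
    (fun w hw => by simp [clsTwist_cls, hw]) hh

end Quotient

/-! ### The operators `m` and `ℓ` on `𝓗` -/

namespace GerstenhaberAlgebra

open GerstenhaberModule (neg_one_zpow_eq)

variable {G D : Type*} [AddCommGroup G] [Module ℝ G] (A : GerstenhaberAlgebra G) [AddCommMonoid D]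
  {r : Letter A.grade → D → Prop} {δ ε μ : D}

theorem bracketMul_mem_homTens
    (hr : ∀ {a b : Letter A.grade} {δ ε : D}, r a δ → r b ε → r (A.bracketLetter a b) (δ + ε + μ))
    {x : List (Letter A.grade)}
    (hx : WordHasDeg r x δ) {t : TensorAlgebra ℝ G} (ht : t ∈ homTens r ε) :
    A.bracketMul x t ∈ homTens r (δ + ε + μ) := by
  refine map_mem_of_homTens _ (fun y hy => ?_) ht
  clear ht
  induction hx generalizing y ε with
  | nil => simp
  | @cons a x δ₁ δ₂ ha hx ih =>
    induction hy with
    | nil => simp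
    | @cons b y ε₁ ε₂ hb hy ih' =>
      have h1 := lt_mul_mem_homTens ha (ih _ (.cons hb hy))
      have h2 := lt_mul_mem_homTens hb ih'
      have h3 := lt_mul_mem_homTens (hr ha hb)
        (shuffleMul_mem_homTens A.isInternal hx (tens_mem_homTens hy))
      rw [tens_cons] at h1 ⊢
      rw [bracketMul_cons]
      refine add_mem (add_mem ?_ (Submodule.smul_mem _ _ ?_)) (Submodule.smul_mem _ _ ?_)
      · convert h1 using 2; abel
      · convert h2 using 2; abel
      · convert h3 using 2; abel

theorem mulOp_mem_homTens
    (hr : ∀ {a b : Letter A.grade} {δ ε : D}, r a δ → r b ε → r (A.mulLetter a b) (δ + ε + μ))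
    {t : TensorAlgebra ℝ G} (ht : t ∈ homTens r δ) : A.mulOp t ∈ homTens r (δ + μ) := by
  refine map_mem_of_homTens _ (fun y hy => ?_) ht
  clear ht
  induction hy with
  | nil => simp
  | @cons a x δ₁ δ₂ ha hx ih =>
    have h1 := lt_mul_mem_homTens ha ih
    rw [tens_cons, mulOp_lt_mul]
    refine Submodule.smul_mem _ _ (add_mem ?_ (by rwa [add_assoc]))
    cases hx with
    | nil => simp
    | cons hb hx =>
      rw [tens_cons, headMul_lt_mul]
      have h2 := lt_mul_mem_homTens (hr ha hb) (tens_mem_homTens hx)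
      convert h2 using 2; abel

theorem mulOp_mem_posTens (t : TensorAlgebra ℝ G) : A.mulOp t ∈ posTens A.grade := by
  refine map_mem_of_tens A.isInternal _ (fun w => ?_) t
  cases w with
  | nil => simp
  | cons a w =>
    rw [tens_cons, mulOp_lt_mul]
    refine Submodule.smul_mem _ _ (add_mem ?_ (lt_mul_mem_posTens A.isInternal _ _))
    cases w with
    | nil => simp
    | cons b w =>
      rw [tens_cons, headMul_lt_mul]
      exact lt_mul_mem_posTens A.isInternal _ _

theorem bracketMul_mem_posTens (x : List (Letter A.grade)) (t : TensorAlgebra ℝ G) :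
    A.bracketMul x t ∈ posTens A.grade := by
  refine map_mem_of_tens A.isInternal _ (fun y => ?_) t
  cases x with
  | nil => simp
  | cons a x =>
    cases y with
    | nil => simp
    | cons b y =>
      rw [tens_cons, bracketMul_cons]
      refine add_mem (add_mem ?_ (Submodule.smul_mem _ _ ?_)) (Submodule.smul_mem _ _ ?_) <;>
        exact lt_mul_mem_posTens A.isInternal _ _

/-- By the derivation property the image of a shuffle is a sum of shuffles. Their factors still have
positive length, which is essential because shuffling with a scalar gives no relation. -/
theorem mulOp_shuffleRel : shuffleRel A.grade ≤ (shuffleRel A.grade).comap A.mulOp := by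
  refine map_shuffleRel A.isInternal _ (by simp) fun x y hx hy => ?_
  rw [mulOp_shuffleMul]
  exact add_mem
    (Submodule.smul_mem _ _ (shuffleMul_mem_shuffleRel _ hy (A.mulOp_mem_posTens _)))
    (Submodule.smul_mem _ _ (shuffleMul_mem_shuffleRel _ hx (A.mulOp_mem_posTens _)))

theorem bracketMul_shuffleRel (z : List (Letter A.grade)) :
    shuffleRel A.grade ≤ (shuffleRel A.grade).comap (A.bracketMul z) := by
  refine map_shuffleRel A.isInternal _ (by simp) fun x y hx hy => ?_
  rw [bracketMul_shuffleMul]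
  exact add_mem
    (Submodule.smul_mem _ _ (shuffleMul_mem_shuffleRel _ hy (A.bracketMul_mem_posTens _ _)))
    (Submodule.smul_mem _ _ (shuffleMul_mem_shuffleRel _ hx (A.bracketMul_mem_posTens _ _)))

/-- The operator `m` on `𝓗`. -/
def mulCls : ShuffleQuot A.grade →ₗ[ℝ] ShuffleQuot A.grade :=
  Submodule.mapQ _ _ A.mulOp A.mulOp_shuffleRel

/-- The operator `{x, ·}` on `𝓗`. -/
def bracketCls (x : List (Letter A.grade)) : ShuffleQuot A.grade →ₗ[ℝ] ShuffleQuot A.grade :=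
  Submodule.mapQ _ _ (A.bracketMul x) (A.bracketMul_shuffleRel x)

theorem mulCls_mkQ (t : TensorAlgebra ℝ G) :
    A.mulCls ((shuffleRel A.grade).mkQ t) = (shuffleRel A.grade).mkQ (A.mulOp t) := rfl

theorem bracketCls_mkQ (x : List (Letter A.grade)) (t : TensorAlgebra ℝ G) :
    A.bracketCls x ((shuffleRel A.grade).mkQ t) = (shuffleRel A.grade).mkQ (A.bracketMul x t) :=
  rfl

theorem bracketCls_antisymm (x y : List (Letter A.grade)) :
    A.bracketCls x (cls y) =
      (-(-1 : ℝ) ^ (degSum x * degSum y)) • A.bracketCls y (cls x) := by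
  rw [cls, cls, bracketCls_mkQ, bracketMul_antisymm, map_smul]; rfl

/-- The bracket is so far linear only in its second argument, the first being a word. Antisymmetry
transfers linearity and compatibility with the relations to the first argument. -/
theorem exists_lieCls : ∃ B : ShuffleQuot A.grade →ₗ[ℝ] ShuffleQuot A.grade →ₗ[ℝ]
    ShuffleQuot A.grade, ∀ x y : List (Letter A.grade),
      B (cls x) (cls y) = ((-1 : ℝ) ^ wordDeg x) • A.bracketCls x (cls y) := by
  refine exists_bilinear_of_span (span_cls A.isInternal) _
    (fun x => ⟨((-1 : ℝ) ^ wordDeg x) • A.bracketCls x, fun y => rfl⟩)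
    -- The twist by `degSum y + 1` combines the sign of antisymmetry with the prefactor `(-1)^(deg
    -- X)` of `ℓ`.
    (fun y => ⟨A.bracketCls y ∘ₗ clsTwist A.isInternal (degSum y + 1), fun x => ?_⟩)
  rw [LinearMap.comp_apply, clsTwist_cls, map_smul, bracketCls_antisymm, smul_smul]
  congr 1
  rw [wordDeg_eq]
  generalize degSum x = a, degSum y = b
  simp only [neg_one_zpow_eq, Int.even_add, Int.even_mul, Int.even_sub, Int.not_even_one]
  grind

/-- The bracket `ℓ` on `𝓗[1]`. -/
def lieCls : ShuffleQuot A.grade →ₗ[ℝ] ShuffleQuot A.grade →ₗ[ℝ] ShuffleQuot A.grade :=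
  A.exists_lieCls.choose

theorem lieCls_cls (x : List (Letter A.grade)) (h : ShuffleQuot A.grade) :
    A.lieCls (cls x) h = ((-1 : ℝ) ^ wordDeg x) • A.bracketCls x h := by
  have := LinearMap.ext_on (f := A.lieCls (cls x)) (g := ((-1 : ℝ) ^ wordDeg x) • A.bracketCls x)
    (span_cls A.isInternal) (by rintro _ ⟨y, rfl⟩; exact A.exists_lieCls.choose_spec x y)
  rw [this]; rfl

/-- The sign prefactor in `ℓ` turns antisymmetry for `degSum` into symmetry for the shifted degree,
as needed for a map on symmetric powers. -/
theorem lieCls_symm {e : ℤ} {h : ShuffleQuot A.grade} (hh : h ∈ degCls A.grade e)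
    (y : List (Letter A.grade)) :
    A.lieCls h (cls y) = ((-1 : ℝ) ^ ((e - 1) * wordDeg y)) • A.lieCls (cls y) h := by
  refine eq_of_degCls (A.lieCls.flip (cls y))
    (((-1 : ℝ) ^ ((e - 1) * wordDeg y)) • A.lieCls (cls y)) (fun x hx => ?_) hh
  rw [LinearMap.flip_apply, LinearMap.smul_apply, lieCls_cls, lieCls_cls, bracketCls_antisymm,
    smul_smul, smul_smul, ← hx]
  congr 1
  rw [wordDeg_eq, wordDeg_eq]
  generalize degSum x = a, degSum y = b
  simp only [neg_one_zpow_eq, Int.even_mul, Int.even_sub, Int.not_even_one]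
  grind

theorem mulCls_mulCls (h : ShuffleQuot A.grade) : A.mulCls (A.mulCls h) = 0 := by
  obtain ⟨t, rfl⟩ := Submodule.mkQ_surjective _ h
  rw [mulCls_mkQ, mulCls_mkQ, mulOp_mulOp, map_zero]

theorem mulCls_mem_homCls
    (hr : ∀ {a b : Letter A.grade} {δ ε : D}, r a δ → r b ε → r (A.mulLetter a b) (δ + ε + μ))
    {h : ShuffleQuot A.grade} (hh : h ∈ homCls r δ) : A.mulCls h ∈ homCls r (δ + μ) := by
  obtain ⟨t, ht, rfl⟩ := hh
  exact Submodule.mem_map_of_mem (A.mulOp_mem_homTens hr ht)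

theorem lieCls_mem_homCls
    (hr : ∀ {a b : Letter A.grade} {δ ε : D}, r a δ → r b ε → r (A.bracketLetter a b) (δ + ε + μ))
    {h h' : ShuffleQuot A.grade} (hh : h ∈ homCls r δ) (hh' : h' ∈ homCls r ε) :
    A.lieCls h h' ∈ homCls r (δ + ε + μ) := by
  refine map_mem_of_homCls (A.lieCls.flip h') (fun x hx => ?_) hh
  obtain ⟨t, ht, rfl⟩ := hh'
  rw [LinearMap.flip_apply, lieCls_cls, bracketCls_mkQ]
  exact Submodule.smul_mem _ _ (Submodule.mem_map_of_mem (A.bracketMul_mem_homTens hr hx ht))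

theorem mulCls_mem_degCls {e : ℤ} {h : ShuffleQuot A.grade} (hh : h ∈ degCls A.grade e) :
    A.mulCls h ∈ degCls A.grade (e + 1) :=
  A.mulCls_mem_homCls (by rintro a b _ _ rfl rfl; simp) hh

theorem lieCls_mem_degCls {e e' : ℤ} {h h' : ShuffleQuot A.grade} (hh : h ∈ degCls A.grade e)
    (hh' : h' ∈ degCls A.grade e') : A.lieCls h h' ∈ degCls A.grade (e + e') := by
  have := A.lieCls_mem_homCls (μ := 0) (by rintro a b _ _ rfl rfl; simp) hh hh'
  rwa [add_zero] at this

theorem mulCls_lieCls (x y : List (Letter A.grade)) :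
    A.mulCls (A.lieCls (cls x) (cls y)) = (-1 : ℝ) • A.lieCls (A.mulCls (cls x)) (cls y) +
      (-(-1 : ℝ) ^ wordDeg x) • A.lieCls (cls x) (A.mulCls (cls y)) := by
  have h := congrArg (shuffleRel A.grade).mkQ (A.mulOp_bracketMul x y)
  simp only [map_add, map_smul, ← bracketCls_mkQ, ← mulCls_mkQ] at h
  rw [A.lieCls_symm (A.mulCls_mem_degCls (cls_mem_degCls x)), lieCls_cls, lieCls_cls, lieCls_cls,
    map_smul, cls, cls, h]
  simp only [smul_add, smul_smul, wordDeg_eq]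
  generalize degSum x = a, degSum y = b
  match_scalars
  all_goals
    simp only [neg_one_zpow_eq, Int.even_add, Int.even_mul, Int.even_sub, Int.not_even_one]
    grind

/-- In this arrangement the left side is the component of `ℓ(ℓ(X · Y · Z))` in `S¹`. -/
theorem lieCls_jacobi (x y z : List (Letter A.grade)) :
    A.lieCls (A.lieCls (cls x) (cls y)) (cls z) +
      ((-1 : ℝ) ^ ((wordDeg x + 1) * wordDeg y)) •
        A.lieCls (cls y) (A.lieCls (cls x) (cls z)) +
      ((-1 : ℝ) ^ wordDeg x) • A.lieCls (cls x) (A.lieCls (cls y) (cls z)) = 0 := by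
  have h := congrArg (shuffleRel A.grade).mkQ (A.bracketMul_jacobi x y z)
  simp only [map_add, map_smul, ← bracketCls_mkQ] at h
  have hs : (shuffleRel A.grade).mkQ (tens x) = cls x := rfl
  rw [A.lieCls_symm (A.lieCls_mem_degCls (cls_mem_degCls x) (cls_mem_degCls y))]
  simp only [lieCls_cls, map_smul]
  rw [A.bracketCls_antisymm x z, map_smul, cls, cls, cls, h]
  simp only [smul_add, smul_smul, wordDeg_eq]
  generalize degSum x = a, degSum y = b, degSum z = c
  match_scalars
  all_goals
    simp only [neg_one_zpow_eq, Int.even_add, Int.even_mul, Int.even_sub, Int.not_even_one]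
    grind

end GerstenhaberAlgebra

/-! ### Linear maps on the graded symmetric algebra by recursion on the first factor -/

section SymRec

variable {V N : Type*} [AddCommGroup V] [Module ℝ V] {𝒱 : ℤ → Submodule ℝ V}
  [AddCommGroup N] [Module ℝ N]

/-- The inclusion of `𝓗[1]` in the symmetric algebra. -/
def symι (𝒱 : ℤ → Submodule ℝ V) : ShuffleQuot 𝒱 →ₗ[ℝ] SymH 𝒱 :=
  (RingQuot.mkAlgHom ℝ (symRel 𝒱)).toLinearMap ∘ₗ TensorAlgebra.ι ℝ

theorem proj_tens (w : List (Letter 𝒱)) : proj 𝒱 (tens w) = symι 𝒱 (cls w) := rfl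

@[simp] theorem symProd_nil : symProd ([] : List (List (Letter 𝒱))) = 1 := rfl

@[simp] theorem symProd_cons (x : List (Letter 𝒱)) (X : List (List (Letter 𝒱))) :
    symProd (x :: X) = symι 𝒱 (cls x) * symProd X := by
  simp [symProd, proj_tens]

theorem symProd_append (X Y : List (List (Letter 𝒱))) :
    symProd (X ++ Y) = symProd X * symProd Y := by
  simp [symProd]

theorem symι_cls_comm (x y : List (Letter 𝒱)) : symι 𝒱 (cls x) * symι 𝒱 (cls y) =
    ((-1 : ℝ) ^ (wordDeg x * wordDeg y)) • (symι 𝒱 (cls y) * symι 𝒱 (cls x)) := by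
  have := RingQuot.mkAlgHom_rel ℝ (s := symRel 𝒱) ⟨x, y, rfl, rfl⟩
  simpa [symι, cls] using this

theorem symι_comm {e : ℤ} {h : ShuffleQuot 𝒱} (hh : h ∈ degCls 𝒱 e) (y : List (Letter 𝒱)) :
    symι 𝒱 h * symι 𝒱 (cls y) =
      ((-1 : ℝ) ^ ((e - 1) * wordDeg y)) • (symι 𝒱 (cls y) * symι 𝒱 h) :=
  eq_of_degCls (LinearMap.mulRight ℝ (symι 𝒱 (cls y)) ∘ₗ symι 𝒱)
    (((-1 : ℝ) ^ ((e - 1) * wordDeg y)) • (LinearMap.mulLeft ℝ (symι 𝒱 (cls y)) ∘ₗ symι 𝒱))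
    (fun w hw => by simp [symι_cls_comm w y, ← hw, wordDeg_eq]) hh

theorem symι_comm_mul {e : ℤ} {h : ShuffleQuot 𝒱} (hh : h ∈ degCls 𝒱 e) (y : List (Letter 𝒱))
    (s : SymH 𝒱) : symι 𝒱 h * (symι 𝒱 (cls y) * s) =
      ((-1 : ℝ) ^ ((e - 1) * wordDeg y)) • (symι 𝒱 (cls y) * (symι 𝒱 h * s)) := by
  rw [← mul_assoc, symι_comm hh, smul_mul_assoc, mul_assoc]

theorem span_symProd (hV : DirectSum.IsInternal 𝒱) :
    Submodule.span ℝ (Set.range (symProd (𝒱 := 𝒱))) = ⊤ := by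
  have hι : ∀ h : ShuffleQuot 𝒱, ∀ t ∈ Submodule.span ℝ (Set.range (symProd (𝒱 := 𝒱))),
      symι 𝒱 h * t ∈ Submodule.span ℝ (Set.range (symProd (𝒱 := 𝒱))) := by
    intro h t ht
    have hh : h ∈ Submodule.span ℝ (Set.range (cls (𝒱 := 𝒱))) := by rw [span_cls hV]; trivial
    induction hh using Submodule.span_induction with
    | mem _ h =>
      obtain ⟨x, rfl⟩ := h
      induction ht using Submodule.span_induction with
      | mem _ h =>
        obtain ⟨X, rfl⟩ := h
        exact Submodule.subset_span ⟨x :: X, by simp⟩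
      | zero => simp
      | add _ _ _ _ h1 h2 => rw [mul_add]; exact add_mem h1 h2
      | smul c _ _ h => rw [mul_smul_comm]; exact Submodule.smul_mem _ _ h
    | zero => simp
    | add _ _ _ _ h1 h2 => rw [map_add, add_mul]; exact add_mem h1 h2
    | smul c _ _ h => rw [map_smul, smul_mul_assoc]; exact Submodule.smul_mem _ _ h
  have hmul : ∀ s : TensorAlgebra ℝ (ShuffleQuot 𝒱), ∀ t : SymH 𝒱,
      t ∈ Submodule.span ℝ (Set.range (symProd (𝒱 := 𝒱))) →
      RingQuot.mkAlgHom ℝ (symRel 𝒱) s * t ∈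
        Submodule.span ℝ (Set.range (symProd (𝒱 := 𝒱))) := by
    intro s
    induction s using TensorAlgebra.induction with
    | algebraMap r =>
      intro t ht
      rw [AlgHom.commutes, ← Algebra.smul_def]; exact Submodule.smul_mem _ _ ht
    | ι v => exact hι v
    | mul a b ha hb => intro t ht; rw [map_mul, mul_assoc]; exact ha _ (hb _ ht)
    | add a b ha hb => intro t ht; rw [map_add, add_mul]; exact add_mem (ha _ ht) (hb _ ht)
  rw [eq_top_iff]
  intro s _
  obtain ⟨s, rfl⟩ := RingQuot.mkAlgHom_surjective ℝ (symRel 𝒱) s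
  simpa using hmul s 1 (Submodule.subset_span ⟨[], rfl⟩)

theorem sym_linearMap_ext (hV : DirectSum.IsInternal 𝒱) {f g : SymH 𝒱 →ₗ[ℝ] N}
    (h : ∀ X : List (List (Letter 𝒱)), f (symProd X) = g (symProd X)) : f = g :=
  LinearMap.ext_on (span_symProd hV) (by rintro _ ⟨w, rfl⟩; exact h w)

/-- Two linear maps on the symmetric algebra agree if they agree at `1` and satisfy compatible
recursions. -/
theorem sym_linearMap_ext_of_mul (hV : DirectSum.IsInternal 𝒱) {f g : SymH 𝒱 →ₗ[ℝ] N}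
    (h1 : f 1 = g 1) (h : ∀ (x : List (Letter 𝒱)) (s : SymH 𝒱), f s = g s →
      f (symι 𝒱 (cls x) * s) = g (symι 𝒱 (cls x) * s)) : f = g :=
  sym_linearMap_ext hV fun X => by
    induction X with
    | nil => exact h1
    | cons x X ih => rw [symProd_cons]; exact h x _ ih

/-- One step of `symRec`. -/
def symRecStep (β : ShuffleQuot 𝒱 →ₗ[ℝ] SymH 𝒱 →ₗ[ℝ] N) (γ : ShuffleQuot 𝒱 →ₗ[ℝ] N →ₗ[ℝ] N) :
    ShuffleQuot 𝒱 →ₗ[ℝ] Module.End ℝ (SymH 𝒱 × N) :=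
  LinearMap.mk₂ ℝ (fun v p => (symι 𝒱 v * p.1, β v p.1 + γ v p.2))
    (by intros; ext <;> simp [add_mul]; abel) (by intros; ext <;> simp)
    (by intros; ext <;> simp [mul_add]; abel) (by intros; ext <;> simp)

theorem symRecStep_apply (β : ShuffleQuot 𝒱 →ₗ[ℝ] SymH 𝒱 →ₗ[ℝ] N)
    (γ : ShuffleQuot 𝒱 →ₗ[ℝ] N →ₗ[ℝ] N) (v : ShuffleQuot 𝒱) (p : SymH 𝒱 × N) :
    symRecStep β γ v p = (symι 𝒱 v * p.1, β v p.1 + γ v p.2) := rfl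

/-- The compatibility of a recursion rule with graded commutativity. -/
def SymCompatible (β : ShuffleQuot 𝒱 →ₗ[ℝ] SymH 𝒱 →ₗ[ℝ] N)
    (γ : ShuffleQuot 𝒱 →ₗ[ℝ] N →ₗ[ℝ] N) : Prop :=
  ∀ (x y : List (Letter 𝒱)) (s : SymH 𝒱) (n : N),
    β (cls x) (symι 𝒱 (cls y) * s) + γ (cls x) (β (cls y) s + γ (cls y) n) =
      ((-1 : ℝ) ^ (wordDeg x * wordDeg y)) •
        (β (cls y) (symι 𝒱 (cls x) * s) + γ (cls y) (β (cls x) s + γ (cls x) n))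

variable (n₀ : N) {β : ShuffleQuot 𝒱 →ₗ[ℝ] SymH 𝒱 →ₗ[ℝ] N} {γ : ShuffleQuot 𝒱 →ₗ[ℝ] N →ₗ[ℝ] N}

/-- The representation of the symmetric algebra underlying `symRec`. -/
def symRep (hc : SymCompatible β γ) : SymH 𝒱 →ₐ[ℝ] Module.End ℝ (SymH 𝒱 × N) :=
  RingQuot.liftAlgHom ℝ ⟨TensorAlgebra.lift ℝ (symRecStep β γ), by
    rintro _ _ ⟨x, y, rfl, rfl⟩
    refine LinearMap.ext fun ⟨s, n⟩ => ?_
    simp only [map_mul, map_smul, TensorAlgebra.lift_ι_apply, Module.End.mul_apply,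
      LinearMap.smul_apply, symRecStep_apply, Prod.smul_mk, Prod.mk.injEq]
    refine ⟨?_, hc x y s n⟩
    have := symι_comm_mul (cls_mem_degCls x) y s
    exact this⟩

/-- The linear map `F` on the symmetric algebra with `F 1 = n₀` and
`F (X · s) = β X s + γ X (F s)`. -/
def symRec (hc : SymCompatible β γ) : SymH 𝒱 →ₗ[ℝ] N :=
  LinearMap.snd ℝ _ _ ∘ₗ (LinearMap.applyₗ (R := ℝ) ((1, n₀) : SymH 𝒱 × N)) ∘ₗ
    (symRep hc).toLinearMap

theorem symRep_symι (hc : SymCompatible β γ) (h : ShuffleQuot 𝒱) :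
    symRep hc (symι 𝒱 h) = symRecStep β γ h := by
  simp only [symRep, symι, LinearMap.comp_apply, AlgHom.toLinearMap_apply,
    RingQuot.liftAlgHom_mkAlgHom_apply, TensorAlgebra.lift_ι_apply]

theorem fst_symRep (hV : DirectSum.IsInternal 𝒱) (hc : SymCompatible β γ) (s : SymH 𝒱)
    (p : SymH 𝒱 × N) : (symRep hc s p).1 = s * p.1 := by
  refine LinearMap.congr_fun (f := LinearMap.fst ℝ _ _ ∘ₗ LinearMap.applyₗ (R := ℝ) p ∘ₗ
    (symRep hc).toLinearMap) (g := LinearMap.mulRight ℝ p.1)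
    (sym_linearMap_ext_of_mul hV (by simp) fun x s h => ?_) s
  simp only [LinearMap.comp_apply, AlgHom.toLinearMap_apply, LinearMap.applyₗ_apply_apply,
    LinearMap.fst_apply, LinearMap.mulRight_apply, map_mul, Module.End.mul_apply, symRep_symι,
    symRecStep_apply, mul_assoc] at h ⊢
  rw [h]

theorem symRec_one (hc : SymCompatible β γ) : symRec n₀ hc 1 = n₀ := by
  simp [symRec]

theorem symRec_mul (hV : DirectSum.IsInternal 𝒱) (hc : SymCompatible β γ) (h : ShuffleQuot 𝒱)
    (s : SymH 𝒱) : symRec n₀ hc (symι 𝒱 h * s) = β h s + γ h (symRec n₀ hc s) := by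
  have hs := fst_symRep hV hc s (1, n₀)
  simp only [mul_one] at hs
  simp only [symRec, LinearMap.comp_apply, AlgHom.toLinearMap_apply,
    LinearMap.applyₗ_apply_apply, map_mul, Module.End.mul_apply, symRep_symι, symRecStep_apply,
    LinearMap.snd_apply, hs]

end SymRec

/-! ### Extension of `m` and `ℓ` to the symmetric algebra, and the differential -/

namespace GerstenhaberAlgebra

open GerstenhaberModule (neg_one_zpow_eq)

variable {G : Type*} [AddCommGroup G] [Module ℝ G] (A : GerstenhaberAlgebra G)

/-- The operator `X ↦ (-1)^(deg X) X` on `𝓗[1]`. -/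
def shiftTwist : ShuffleQuot A.grade →ₗ[ℝ] ShuffleQuot A.grade := -clsTwist A.isInternal 1

theorem shiftTwist_degCls {e : ℤ} {h : ShuffleQuot A.grade} (hh : h ∈ degCls A.grade e) :
    A.shiftTwist h = ((-1 : ℝ) ^ (e - 1)) • h := by
  rw [shiftTwist, LinearMap.neg_apply, clsTwist_degCls _ _ hh, one_mul, zpow_sub₀ (by norm_num)]
  simp [div_neg]

theorem shiftTwist_cls (x : List (Letter A.grade)) :
    A.shiftTwist (cls x) = ((-1 : ℝ) ^ wordDeg x) • cls x :=
  A.shiftTwist_degCls (cls_mem_degCls x)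

theorem mulSym_compatible : SymCompatible
    (LinearMap.mul ℝ (SymH A.grade) ∘ₗ symι A.grade ∘ₗ A.mulCls)
    (LinearMap.mul ℝ (SymH A.grade) ∘ₗ symι A.grade ∘ₗ A.shiftTwist) := by
  intro x y s n
  simp only [LinearMap.comp_apply, LinearMap.mul_apply', LinearMap.smul_apply, shiftTwist_cls,
    map_smul, mul_add, mul_smul_comm]
  rw [symι_comm_mul (A.mulCls_mem_degCls (cls_mem_degCls x)) y,
    symι_comm_mul (A.mulCls_mem_degCls (cls_mem_degCls y)) x,
    symι_comm_mul (cls_mem_degCls x) y]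
  simp only [smul_add, smul_smul, wordDeg_eq]
  generalize degSum x = a, degSum y = b
  match_scalars
  all_goals
    simp only [neg_one_zpow_eq, Int.even_add, Int.even_mul, Int.even_sub, Int.not_even_one]
    grind

/-- The operator `m` on the symmetric algebra. -/
def mulSym : SymH A.grade →ₗ[ℝ] SymH A.grade := symRec 0 A.mulSym_compatible

@[simp] theorem mulSym_one : A.mulSym 1 = 0 := symRec_one _ _

theorem mulSym_mul {e : ℤ} {h : ShuffleQuot A.grade} (hh : h ∈ degCls A.grade e)
    (s : SymH A.grade) : A.mulSym (symι A.grade h * s) = symι A.grade (A.mulCls h) * s +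
      ((-1 : ℝ) ^ (e - 1)) • (symι A.grade h * A.mulSym s) := by
  rw [mulSym, symRec_mul _ A.isInternal]
  simp [A.shiftTwist_degCls hh]

/-- The sign rule in the recursion for the operators `ℓ(X, ·)`. -/
def adTwist : ShuffleQuot A.grade →ₗ[ℝ] (ShuffleQuot A.grade →ₗ[ℝ] SymH A.grade) →ₗ[ℝ]
    (ShuffleQuot A.grade →ₗ[ℝ] SymH A.grade) :=
  -- The sign `(-1)^(e * deg k)` must be linear in `k`. The halves of `k ± shiftTwist k` are its
  -- even and odd parts, and only the odd part receives `(-1)^e` through `clsTwist`.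
  LinearMap.mk₂ ℝ (fun k n =>
      (2⁻¹ : ℝ) • (LinearMap.mulLeft ℝ (symι A.grade (k + A.shiftTwist k)) ∘ₗ n +
        LinearMap.mulLeft ℝ (symι A.grade (k - A.shiftTwist k)) ∘ₗ n ∘ₗ
          clsTwist A.isInternal 1))
    (by intros; ext; simp [add_mul, sub_mul]; module)
    (by intros; ext; simp [add_mul, sub_mul]; module)
    (by intros; ext; simp [add_mul, sub_mul, mul_add]; module)
    (by intros; ext; simp [add_mul, sub_mul]; module)

theorem adTwist_apply (y : List (Letter A.grade)) (n : ShuffleQuot A.grade →ₗ[ℝ] SymH A.grade)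
    {e : ℤ} {h : ShuffleQuot A.grade} (hh : h ∈ degCls A.grade e) :
    A.adTwist (cls y) n h = ((-1 : ℝ) ^ (e * wordDeg y)) • (symι A.grade (cls y) * n h) := by
  simp only [adTwist, LinearMap.mk₂_apply, LinearMap.smul_apply, LinearMap.add_apply,
    LinearMap.comp_apply, LinearMap.mulLeft_apply, shiftTwist_cls, clsTwist_degCls _ _ hh,
    map_add, map_sub, map_smul, add_mul, sub_mul, smul_mul_assoc]
  generalize wordDeg y = b
  match_scalars
  simp only [neg_one_zpow_eq, Int.even_mul]
  grind

/-- The recursion rule for the operators `ℓ(X, ·)`. -/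
def adStep : ShuffleQuot A.grade →ₗ[ℝ] SymH A.grade →ₗ[ℝ]
    (ShuffleQuot A.grade →ₗ[ℝ] SymH A.grade) :=
  LinearMap.mk₂ ℝ (fun k s => LinearMap.mulRight ℝ s ∘ₗ symι A.grade ∘ₗ A.lieCls.flip k)
    (by intros; ext; simp [add_mul]) (by intros; ext; simp)
    (by intros; ext; simp [mul_add]) (by intros; ext; simp)

theorem adStep_apply (k : ShuffleQuot A.grade) (s : SymH A.grade) (h : ShuffleQuot A.grade) :
    A.adStep k s h = symι A.grade (A.lieCls h k) * s := rfl

theorem adSym_compatible : SymCompatible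
    (N := ShuffleQuot A.grade →ₗ[ℝ] SymH A.grade) A.adStep A.adTwist := by
  intro x y s n
  refine LinearMap.ext_on (span_cls A.isInternal) ?_
  rintro _ ⟨z, rfl⟩
  have hz := cls_mem_degCls z
  simp only [LinearMap.add_apply, LinearMap.smul_apply, map_add, adStep_apply,
    A.adTwist_apply _ _ hz, mul_smul_comm]
  rw [symι_comm_mul (A.lieCls_mem_degCls hz (cls_mem_degCls x)) y,
    symι_comm_mul (A.lieCls_mem_degCls hz (cls_mem_degCls y)) x,
    symι_comm_mul (cls_mem_degCls x) y]
  simp only [smul_add, smul_smul, wordDeg_eq]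
  generalize degSum x = a, degSum y = b, degSum z = c
  match_scalars
  all_goals
    simp only [neg_one_zpow_eq, Int.even_add, Int.even_mul, Int.even_sub, Int.not_even_one]
    grind

/-- The operators `ℓ(X, ·)`, extended to the symmetric algebra as derivations. -/
def adSym : ShuffleQuot A.grade →ₗ[ℝ] SymH A.grade →ₗ[ℝ] SymH A.grade :=
  (symRec 0 A.adSym_compatible).flip

@[simp] theorem adSym_one (h : ShuffleQuot A.grade) : A.adSym h 1 = 0 := by
  rw [adSym, LinearMap.flip_apply, symRec_one, LinearMap.zero_apply]

theorem adSym_mul {e : ℤ} {h : ShuffleQuot A.grade} (hh : h ∈ degCls A.grade e)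
    (y : List (Letter A.grade)) (s : SymH A.grade) :
    A.adSym h (symι A.grade (cls y) * s) = symι A.grade (A.lieCls h (cls y)) * s +
      ((-1 : ℝ) ^ (e * wordDeg y)) • (symι A.grade (cls y) * A.adSym h s) := by
  rw [adSym, LinearMap.flip_apply, symRec_mul _ A.isInternal, LinearMap.add_apply,
    A.adTwist_apply _ _ hh, adStep_apply]
  rfl

/-- Needed when the factor is `m(Y)` or `ℓ(Y, Z)`, which is homogeneous but not the class of a
single word. -/
theorem adSym_mul' {e e' : ℤ} {h k : ShuffleQuot A.grade} (hh : h ∈ degCls A.grade e)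
    (hk : k ∈ degCls A.grade e') (s : SymH A.grade) :
    A.adSym h (symι A.grade k * s) = symι A.grade (A.lieCls h k) * s +
      ((-1 : ℝ) ^ (e * (e' - 1))) • (symι A.grade k * A.adSym h s) :=
  eq_of_degCls (A.adSym h ∘ₗ LinearMap.mulRight ℝ s ∘ₗ symι A.grade)
    (LinearMap.mulRight ℝ s ∘ₗ symι A.grade ∘ₗ A.lieCls h +
      ((-1 : ℝ) ^ (e * (e' - 1))) • (LinearMap.mulRight ℝ (A.adSym h s) ∘ₗ symι A.grade))
    (fun w hw => by simp [A.adSym_mul hh, wordDeg_eq, hw]) hk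

/-- The bracket term `ℓ(X, Y) s` is compatible by graded symmetry of `ℓ`, and the remaining terms
pair off under exchange of `X` and `Y`. -/
theorem lieSym_compatible : SymCompatible A.adSym
    (LinearMap.mul ℝ (SymH A.grade) ∘ₗ symι A.grade ∘ₗ A.shiftTwist) := by
  intro x y s n
  simp only [LinearMap.comp_apply, LinearMap.mul_apply', LinearMap.smul_apply, shiftTwist_cls,
    map_smul, mul_add, mul_smul_comm]
  rw [A.adSym_mul (cls_mem_degCls x) y, A.adSym_mul (cls_mem_degCls y) x,
    A.lieCls_symm (cls_mem_degCls x) y, symι_comm_mul (cls_mem_degCls x) y]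
  simp only [smul_mul_assoc, map_smul, smul_add, smul_smul, wordDeg_eq]
  generalize degSum x = a, degSum y = b
  match_scalars
  all_goals
    simp only [neg_one_zpow_eq, Int.even_mul, Int.even_sub, Int.not_even_one] <;> grind

/-- The operator `ℓ` on the symmetric algebra. -/
def lieSym : SymH A.grade →ₗ[ℝ] SymH A.grade := symRec 0 A.lieSym_compatible

@[simp] theorem lieSym_one : A.lieSym 1 = 0 := symRec_one _ _

theorem lieSym_mul {e : ℤ} {h : ShuffleQuot A.grade} (hh : h ∈ degCls A.grade e)
    (s : SymH A.grade) : A.lieSym (symι A.grade h * s) = A.adSym h s +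
      ((-1 : ℝ) ^ (e - 1)) • (symι A.grade h * A.lieSym s) := by
  rw [lieSym, symRec_mul _ A.isInternal]
  simp [A.shiftTwist_degCls hh]

theorem mulSym_mulSym (s : SymH A.grade) : A.mulSym (A.mulSym s) = 0 := by
  refine LinearMap.congr_fun (f := A.mulSym ∘ₗ A.mulSym) (g := 0)
    (sym_linearMap_ext_of_mul A.isInternal (by simp) fun x s hs => ?_) s
  have hx := cls_mem_degCls x
  simp only [LinearMap.comp_apply, LinearMap.zero_apply] at hs ⊢
  rw [A.mulSym_mul hx, map_add, map_smul, A.mulSym_mul (A.mulCls_mem_degCls hx),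
    A.mulSym_mul hx, hs, mulCls_mulCls]
  simp only [map_zero, zero_mul, mul_zero, smul_zero, add_zero, zero_add]
  generalize degSum x = a
  match_scalars
  simp only [neg_one_zpow_eq, Int.even_add, Int.even_sub, Int.not_even_one]
  grind

/-- The graded commutator of the derivations `m` and `ad_X` is a derivation. On a single factor it
is given by `mulCls_lieCls`. -/
theorem mulSym_adSym (x : List (Letter A.grade)) (s : SymH A.grade) :
    A.mulSym (A.adSym (cls x) s) = (-1 : ℝ) • A.adSym (A.mulCls (cls x)) s +
      (-(-1 : ℝ) ^ wordDeg x) • A.adSym (cls x) (A.mulSym s) := by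
  have hx := cls_mem_degCls x
  refine LinearMap.congr_fun (f := A.mulSym ∘ₗ A.adSym (cls x))
    (g := (-1 : ℝ) • A.adSym (A.mulCls (cls x)) +
      (-(-1 : ℝ) ^ wordDeg x) • (A.adSym (cls x) ∘ₗ A.mulSym))
    (sym_linearMap_ext_of_mul A.isInternal (by simp) fun y s hs => ?_) s
  have hy := cls_mem_degCls y
  simp only [LinearMap.comp_apply, LinearMap.add_apply, LinearMap.smul_apply] at hs ⊢
  rw [A.adSym_mul hx, map_add, map_smul, A.mulSym_mul (A.lieCls_mem_degCls hx hy),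
    A.mulSym_mul hy, A.mulSym_mul hy, map_add, map_smul, A.adSym_mul hx, hs,
    A.adSym_mul' hx (A.mulCls_mem_degCls hy), A.adSym_mul (A.mulCls_mem_degCls hx),
    mulCls_lieCls]
  simp only [map_add, map_smul, add_mul, mul_add, smul_mul_assoc, mul_smul_comm, smul_add,
    smul_smul, wordDeg_eq]
  generalize degSum x = a, degSum y = b
  match_scalars
  all_goals
    try simp only [neg_one_zpow_eq, Int.even_add, Int.even_mul, Int.even_sub, Int.not_even_one]
  all_goals grind

theorem mulSym_lieSym (s : SymH A.grade) :
    A.mulSym (A.lieSym s) = (-1 : ℝ) • A.lieSym (A.mulSym s) := by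
  refine LinearMap.congr_fun (f := A.mulSym ∘ₗ A.lieSym) (g := (-1 : ℝ) • (A.lieSym ∘ₗ A.mulSym))
    (sym_linearMap_ext_of_mul A.isInternal (by simp) fun x s hs => ?_) s
  have hx := cls_mem_degCls x
  simp only [LinearMap.comp_apply, LinearMap.smul_apply] at hs ⊢
  rw [A.lieSym_mul hx, map_add, map_smul, A.mulSym_mul hx, A.mulSym_mul hx, map_add, map_smul,
    A.lieSym_mul hx, A.lieSym_mul (A.mulCls_mem_degCls hx), mulSym_adSym, hs]
  simp only [mul_smul_comm, smul_add, smul_smul, wordDeg_eq]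
  generalize degSum x = a
  match_scalars
  all_goals
    try simp only [neg_one_zpow_eq, Int.even_add, Int.even_sub, Int.not_even_one]
  all_goals grind

/-- Jacobi in operator form: up to sign, `ad` of a bracket is the graded commutator of two
derivations, so it is enough to compare them on one factor. -/
theorem adSym_lieCls (x y : List (Letter A.grade)) (s : SymH A.grade) :
    A.adSym (A.lieCls (cls x) (cls y)) s =
      -((-1 : ℝ) ^ ((wordDeg x + 1) * wordDeg y)) • A.adSym (cls y) (A.adSym (cls x) s) +
      (-(-1 : ℝ) ^ wordDeg x) • A.adSym (cls x) (A.adSym (cls y) s) := by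
  have hx := cls_mem_degCls x
  have hy := cls_mem_degCls y
  refine LinearMap.congr_fun (f := A.adSym (A.lieCls (cls x) (cls y)))
    (g := -((-1 : ℝ) ^ ((wordDeg x + 1) * wordDeg y)) • (A.adSym (cls y) ∘ₗ A.adSym (cls x)) +
      (-(-1 : ℝ) ^ wordDeg x) • (A.adSym (cls x) ∘ₗ A.adSym (cls y)))
    (sym_linearMap_ext_of_mul A.isInternal (by simp) fun z s hs => ?_) s
  have hz := cls_mem_degCls z
  have hj := congrArg (fun h => symι A.grade h * s) (A.lieCls_jacobi x y z)
  simp only [map_add, map_smul, map_zero, add_mul, smul_mul_assoc, zero_mul] at hj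
  simp only [LinearMap.comp_apply, LinearMap.add_apply, LinearMap.smul_apply] at hs ⊢
  rw [A.adSym_mul (A.lieCls_mem_degCls hx hy), A.adSym_mul hx, A.adSym_mul hy, map_add, map_smul,
    map_add, map_smul, A.adSym_mul hx, A.adSym_mul hy,
    A.adSym_mul' hx (A.lieCls_mem_degCls hy hz), A.adSym_mul' hy (A.lieCls_mem_degCls hx hz), hs]
  -- Jacobi cancels the terms where both brackets involve `z`; the rest reduces to the hypothesis on
  -- `s` and to mixed terms cancelling by sign.
  linear_combination (norm := skip) (1 : ℝ) • hj
  simp only [mul_add, mul_smul_comm, smul_add, smul_smul, wordDeg_eq]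
  generalize degSum x = a, degSum y = b, degSum z = c
  match_scalars
  all_goals
    try simp only [neg_one_zpow_eq, Int.even_add, Int.even_mul, Int.even_sub, Int.not_even_one]
  all_goals grind

/-- Each `ad_X` commutes with `ℓ` up to sign. Peeling off a factor `Y` produces `ad` of `ℓ(X, Y)`,
which the commutator formula rewrites into the missing terms. With this, `ℓ² = 0` follows at once.
-/
theorem lieSym_adSym (x : List (Letter A.grade)) (s : SymH A.grade) :
    A.lieSym (A.adSym (cls x) s) =
      -((-1 : ℝ) ^ wordDeg x) • A.adSym (cls x) (A.lieSym s) := by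
  have hx := cls_mem_degCls x
  refine LinearMap.congr_fun (f := A.lieSym ∘ₗ A.adSym (cls x))
    (g := -((-1 : ℝ) ^ wordDeg x) • (A.adSym (cls x) ∘ₗ A.lieSym))
    (sym_linearMap_ext_of_mul A.isInternal (by simp) fun y s hs => ?_) s
  have hy := cls_mem_degCls y
  simp only [LinearMap.comp_apply, LinearMap.smul_apply] at hs ⊢
  rw [A.adSym_mul hx, map_add, map_smul, A.lieSym_mul (A.lieCls_mem_degCls hx hy),
    A.lieSym_mul hy, A.lieSym_mul hy, map_add, map_smul, A.adSym_mul hx, hs, adSym_lieCls]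
  simp only [mul_smul_comm, smul_add, smul_smul, wordDeg_eq]
  generalize degSum x = a, degSum y = b
  match_scalars
  all_goals
    try simp only [neg_one_zpow_eq, Int.even_add, Int.even_mul, Int.even_sub, Int.not_even_one]
  all_goals grind

theorem lieSym_lieSym (s : SymH A.grade) : A.lieSym (A.lieSym s) = 0 := by
  refine LinearMap.congr_fun (f := A.lieSym ∘ₗ A.lieSym) (g := 0)
    (sym_linearMap_ext_of_mul A.isInternal (by simp) fun x s hs => ?_) s
  have hx := cls_mem_degCls x
  simp only [LinearMap.comp_apply, LinearMap.zero_apply] at hs ⊢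
  rw [A.lieSym_mul hx, map_add, map_smul, A.lieSym_mul hx, hs, lieSym_adSym, mul_zero, smul_zero,
    add_zero, wordDeg_eq]
  module

/-- The operator `m + ℓ` is a differential. -/
theorem boundary_comp_boundary :
    (A.mulSym + A.lieSym) ∘ₗ (A.mulSym + A.lieSym) = 0 := by
  ext1 s
  simp only [LinearMap.comp_apply, LinearMap.add_apply, map_add, mulSym_mulSym, lieSym_lieSym,
    mulSym_lieSym, LinearMap.zero_apply, zero_add, add_zero]
  module

end GerstenhaberAlgebra

/-! ### Closed formulas for the extended operators -/

namespace GerstenhaberAlgebra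

open GerstenhaberModule (neg_one_zpow_eq)

variable {G : Type*} [AddCommGroup G] [Module ℝ G] (A : GerstenhaberAlgebra G)

theorem mBlock_eq (x : List (Letter A.grade)) :
    A.mBlock x = symι A.grade (A.mulCls (cls x)) := by
  rw [mBlock, mulTens_eq, cls, mulCls_mkQ]; rfl

theorem lBlock_eq (x y : List (Letter A.grade)) :
    A.lBlock x y = symι A.grade (A.lieCls (cls x) (cls y)) := by
  rw [lBlock, bracketTens_eq, lieCls_cls, map_smul, cls, bracketCls_mkQ]; rfl

theorem lBlock_mul (x y z : List (Letter A.grade)) (s : SymH A.grade) :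
    A.lBlock x y * (symι A.grade (cls z) * s) =
      ((-1 : ℝ) ^ ((wordDeg x + wordDeg y + 1) * wordDeg z)) •
        (symι A.grade (cls z) * (A.lBlock x y * s)) := by
  rw [lBlock_eq, symι_comm_mul (A.lieCls_mem_degCls (cls_mem_degCls x) (cls_mem_degCls y))]
  simp only [wordDeg_eq]
  ring_nf

theorem mul_lBlock_mul (x y z : List (Letter A.grade)) (s : SymH A.grade) :
    symι A.grade (cls z) * (A.lBlock x y * s) =
      ((-1 : ℝ) ^ ((wordDeg x + wordDeg y + 1) * wordDeg z)) •
        (A.lBlock x y * (symι A.grade (cls z) * s)) := by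
  rw [lBlock_mul, smul_smul, ← zpow_add₀ (by norm_num), Even.neg_one_zpow ⟨_, rfl⟩,
    one_smul]

theorem isProductExtension_mulSym : A.IsProductExtension A.mulSym := by
  intro X
  induction X with
  | nil => simp
  | cons x X ih =>
    rw [symProd_cons, A.mulSym_mul (cls_mem_degCls x), ih]
    refine Eq.trans ?_ (Fin.sum_univ_succ (n := X.length) _).symm
    simp [mBlock_eq, Finset.mul_sum, Finset.smul_sum, smul_smul, zpow_add₀, _root_.mul_assoc,
      wordDeg_eq]

theorem adSym_symProd (x : List (Letter A.grade)) (Z : List (List (Letter A.grade))) :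
    A.adSym (cls x) (symProd Z) = ∑ j : Fin Z.length,
      ((-1 : ℝ) ^ (wordDeg (Z.get j) * ((Z.take j).map wordDeg).sum)) •
        (A.lBlock x (Z.get j) * symProd (Z.eraseIdx j)) := by
  induction Z with
  | nil => simp
  | cons z Z ih =>
    rw [symProd_cons, A.adSym_mul (cls_mem_degCls x), ih]
    refine Eq.trans ?_ (Fin.sum_univ_succ (n := Z.length) _).symm
    simp only [List.get_eq_getElem, Fin.val_zero, List.getElem_cons_zero, List.take_zero,
      List.map_nil, List.sum_nil, mul_zero, zpow_zero, one_smul, List.eraseIdx_cons_zero,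
      lBlock_eq, Fin.val_succ, List.getElem_cons_succ, List.take_succ_cons, List.map_cons,
      List.sum_cons, List.eraseIdx_cons_succ, symProd_cons, Finset.mul_sum, Finset.smul_sum,
      mul_smul_comm, smul_smul]
    congr 1
    refine Finset.sum_congr rfl fun j _ => ?_
    rw [← lBlock_eq, mul_lBlock_mul, smul_smul]
    congr 1
    simp only [wordDeg_eq, neg_one_zpow_eq, Int.even_add, Int.even_mul, Int.even_sub,
      Int.not_even_one]
    grind

/-- The pairs with `i = 0` make up `ad` of the first factor; those with `i > 0` are the formula for
the remaining factors, moved past the first one. -/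
theorem isBracketExtension_lieSym : A.IsBracketExtension A.lieSym := by
  intro X
  induction X with
  | nil => simp
  | cons x X ih =>
    rw [symProd_cons, A.lieSym_mul (cls_mem_degCls x), ih, adSym_symProd]
    refine Eq.trans ?_ (Fin.sum_univ_succ (n := X.length) _).symm
    congr 1
    · refine Eq.trans ?_ (Fin.sum_univ_succ (n := X.length) _).symm
      simp
    · rw [Finset.mul_sum, Finset.smul_sum]
      refine Finset.sum_congr rfl fun i _ => ?_
      refine Eq.trans ?_ (Fin.sum_univ_succ (n := X.length) _).symm
      rw [if_neg (by simp), zero_add, Finset.mul_sum, Finset.smul_sum]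
      refine Finset.sum_congr rfl fun j _ => ?_
      simp only [Fin.succ_lt_succ_iff]
      split_ifs with h
      · simp only [List.get_eq_getElem, Fin.val_succ, List.getElem_cons_succ, List.take_succ_cons,
          List.map_cons, List.sum_cons, List.eraseIdx_cons_succ, symProd_cons, mul_smul_comm,
          mul_lBlock_mul, smul_smul]
        congr 1
        simp only [wordDeg_eq, neg_one_zpow_eq, Int.even_add, Int.even_mul, Int.even_sub,
          Int.not_even_one]
        grind
      · simp

theorem IsProductExtension.unique {m m' : SymH A.grade →ₗ[ℝ] SymH A.grade}
    (h : A.IsProductExtension m) (h' : A.IsProductExtension m') : m = m' :=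
  sym_linearMap_ext A.isInternal fun X => by rw [h X, h' X]

theorem IsBracketExtension.unique {l l' : SymH A.grade →ₗ[ℝ] SymH A.grade}
    (h : A.IsBracketExtension l) (h' : A.IsBracketExtension l') : l = l' :=
  sym_linearMap_ext A.isInternal fun X => by rw [h X, h' X]

theorem mulSym_symProd_mul (X : List (List (Letter A.grade))) (y : List (Letter A.grade)) :
    A.mulSym (symProd X * symι A.grade (cls y)) = A.mulSym (symProd X) * symι A.grade (cls y) +
      ((-1 : ℝ) ^ (X.map wordDeg).sum) • (symProd X * A.mBlock y) := by
  induction X with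
  | nil =>
    have := A.mulSym_mul (cls_mem_degCls y) 1
    simpa [mBlock_eq] using this
  | cons x X ih =>
    rw [symProd_cons, _root_.mul_assoc, A.mulSym_mul (cls_mem_degCls x), ih,
      A.mulSym_mul (cls_mem_degCls x)]
    simp [mul_add, add_mul, smul_smul, zpow_add₀, _root_.mul_assoc, wordDeg_eq, add_assoc]

theorem adSym_symProd_mul (x : List (Letter A.grade)) (Z : List (List (Letter A.grade)))
    (y : List (Letter A.grade)) :
    A.adSym (cls x) (symProd Z * symι A.grade (cls y)) =
      A.adSym (cls x) (symProd Z) * symι A.grade (cls y) +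
      ((-1 : ℝ) ^ ((wordDeg x + 1) * (Z.map wordDeg).sum)) • (symProd Z * A.lBlock x y) := by
  induction Z with
  | nil =>
    have := A.adSym_mul (cls_mem_degCls x) y 1
    simpa [lBlock_eq] using this
  | cons z Z ih =>
    rw [symProd_cons, _root_.mul_assoc, A.adSym_mul (cls_mem_degCls x), ih,
      A.adSym_mul (cls_mem_degCls x)]
    simp [mul_add, add_mul, smul_smul, zpow_add₀, _root_.mul_assoc, wordDeg_eq, add_assoc]

/-- The first sign is the cost of moving the degree-one operation `ℓ` past the remaining factors,
the second that of moving the `i`-th factor to the right end. The map `f` lets the index run over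
`X`, as in the final formula. -/
theorem lieSym_map_symProd_mul {α : Type*} (f : α → List (Letter A.grade)) (X : List α)
    (y : List (Letter A.grade)) :
    A.lieSym (symProd (X.map f) * symι A.grade (cls y)) =
      A.lieSym (symProd (X.map f)) * symι A.grade (cls y) +
      ∑ i : Fin X.length, ((-1 : ℝ) ^ (((X.eraseIdx i).map f).map wordDeg).sum *
          (-1 : ℝ) ^ (wordDeg (f (X.get i)) * (((X.drop (i + 1)).map f).map wordDeg).sum)) •
        (symProd ((X.eraseIdx i).map f) * A.lBlock (f (X.get i)) y) := by
  induction X with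
  | nil =>
    have := A.lieSym_mul (cls_mem_degCls y) 1
    simpa using this
  | cons x X ih =>
    rw [List.map_cons, symProd_cons, _root_.mul_assoc, A.lieSym_mul (cls_mem_degCls _), ih,
      A.lieSym_mul (cls_mem_degCls _), adSym_symProd_mul]
    refine Eq.trans ?_ (congrArg _ (Fin.sum_univ_succ (n := X.length) _).symm)
    simp only [mul_add, add_mul, smul_add, Finset.mul_sum, Finset.smul_sum]
    simp only [List.get_eq_getElem, Fin.val_zero, List.getElem_cons_zero, List.drop_succ_cons,
      List.drop_zero, List.eraseIdx_cons_zero, Fin.val_succ, List.getElem_cons_succ,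
      List.eraseIdx_cons_succ, List.map_cons, List.sum_cons, symProd_cons, mul_smul_comm,
      smul_mul_assoc, smul_smul, _root_.mul_assoc, zpow_add₀ (show (-1 : ℝ) ≠ 0 by norm_num),
      wordDeg_eq, one_mul]
    rw [add_add_add_comm, _root_.mul_comm ((-1 : ℝ) ^ ((degSum (f x) - 1) * _)), add_assoc]

end GerstenhaberAlgebra

/-! ### Additive degrees on products, and stability of chains -/

section Homogeneous

variable {V D : Type*} [AddCommGroup V] [Module ℝ V] {𝒱 : ℤ → Submodule ℝ V} [AddCommMonoid D]

/-- The lists of words whose letters have degrees, in the sense of the relation `r`, of given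
sum. -/
inductive ProdHasDeg (r : Letter 𝒱 → D → Prop) : List (List (Letter 𝒱)) → D → Prop
  | nil : ProdHasDeg r [] 0
  | cons {x : List (Letter 𝒱)} {X : List (List (Letter 𝒱))} {δ ε : D} :
      WordHasDeg r x δ → ProdHasDeg r X ε → ProdHasDeg r (x :: X) (δ + ε)

/-- The span of the products of at least one word of a given degree. -/
def homSym (r : Letter 𝒱 → D → Prop) (δ : D) : Submodule ℝ (SymH 𝒱) :=
  Submodule.span ℝ {z | ∃ X, X ≠ [] ∧ ProdHasDeg r X δ ∧ z = symProd X}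

variable {r : Letter 𝒱 → D → Prop} {δ ε : D}

theorem symProd_mem_homSym {X : List (List (Letter 𝒱))} (h0 : X ≠ []) (h : ProdHasDeg r X δ) :
    symProd X ∈ homSym r δ := Submodule.subset_span ⟨X, h0, h, rfl⟩

theorem cls_mem_homCls {w : List (Letter 𝒱)} (h : WordHasDeg r w δ) : cls w ∈ homCls r δ :=
  Submodule.mem_map_of_mem (tens_mem_homTens h)

theorem symι_mul_symProd_mem_homSym {h : ShuffleQuot 𝒱} (hh : h ∈ homCls r δ)
    {X : List (List (Letter 𝒱))} (hX : ProdHasDeg r X ε) :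
    symι 𝒱 h * symProd X ∈ homSym r (δ + ε) :=
  map_mem_of_homCls (LinearMap.mulRight ℝ (symProd X) ∘ₗ symι 𝒱)
    (fun w hw => symProd_mem_homSym (X := w :: X) (by simp) (.cons hw hX)) hh

theorem symι_mul_mem_homSym {h : ShuffleQuot 𝒱} (hh : h ∈ homCls r δ) {s : SymH 𝒱}
    (hs : s ∈ homSym r ε) : symι 𝒱 h * s ∈ homSym r (δ + ε) := by
  have : homSym r ε ≤ (homSym r (δ + ε)).comap (LinearMap.mulLeft ℝ (symι 𝒱 h)) :=
    Submodule.span_le.2 (by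
      rintro _ ⟨X, -, hX, rfl⟩
      exact symι_mul_symProd_mem_homSym hh hX)
  exact this hs

theorem wordHasDeg_length (w : List (Letter 𝒱)) :
    WordHasDeg (fun _ (n : ℤ) => n = 1) w w.length := by
  induction w with
  | nil => exact .nil
  | cons a w ih => rw [List.length_cons, Nat.cast_succ, add_comm]; exact .cons rfl ih

theorem prodHasDeg_length (X : List (List (Letter 𝒱))) :
    ProdHasDeg (fun _ (n : ℤ) => n = 1) X ((X.map List.length).sum : ℕ) := by
  induction X with
  | nil => exact .nil
  | cons x X ih =>
    rw [List.map_cons, List.sum_cons, Nat.cast_add]; exact .cons (wordHasDeg_length x) ih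

theorem WordHasDeg.length_eq {w : List (Letter 𝒱)} {n : ℤ}
    (h : WordHasDeg (fun _ (n : ℤ) => n = 1) w n) : (w.length : ℤ) = n := by
  induction h with
  | nil => rfl
  | cons ha _ ih => rw [List.length_cons, Nat.cast_succ, ih, ha, add_comm]

theorem ProdHasDeg.length_eq {X : List (List (Letter 𝒱))} {n : ℤ}
    (h : ProdHasDeg (fun _ (n : ℤ) => n = 1) X n) : ((X.map List.length).sum : ℤ) = n := by
  induction h with
  | nil => rfl
  | cons hx _ ih => rw [List.map_cons, List.sum_cons, Nat.cast_add, ih, hx.length_eq]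

theorem symProd_eq_zero {X : List (List (Letter 𝒱))} (h : [] ∈ X) : symProd X = 0 := by
  induction X with
  | nil => simp at h
  | cons x X ih =>
    rw [symProd_cons]
    rcases List.mem_cons.1 h with rfl | h
    · simp
    · rw [ih h, mul_zero]

end Homogeneous

namespace GerstenhaberAlgebra

variable {G D : Type*} [AddCommGroup G] [Module ℝ G] (A : GerstenhaberAlgebra G) [AddCommMonoid D]
  {r : Letter A.grade → D → Prop} {δ ε μ : D}

theorem mulSym_symProd_mem
    (hr : ∀ {a b : Letter A.grade} {δ ε : D}, r a δ → r b ε → r (A.mulLetter a b) (δ + ε + μ))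
    {X : List (List (Letter A.grade))} (hX : ProdHasDeg r X δ) :
    A.mulSym (symProd X) ∈ homSym r (δ + μ) := by
  induction hX with
  | nil => simp
  | @cons x X δ ε hx hX ih =>
    rw [symProd_cons, A.mulSym_mul (cls_mem_degCls x)]
    refine add_mem ?_ (Submodule.smul_mem _ _ ?_)
    · convert symι_mul_symProd_mem_homSym (A.mulCls_mem_homCls hr (cls_mem_homCls hx)) hX using 2
      abel
    · convert symι_mul_mem_homSym (cls_mem_homCls hx) ih using 2
      abel

theorem adSym_symProd_mem
    (hr : ∀ {a b : Letter A.grade} {δ ε : D}, r a δ → r b ε → r (A.bracketLetter a b) (δ + ε + μ))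
    {x : List (Letter A.grade)} (hx : WordHasDeg r x δ)
    {X : List (List (Letter A.grade))} (hX : ProdHasDeg r X ε) :
    A.adSym (cls x) (symProd X) ∈ homSym r (δ + ε + μ) := by
  induction hX with
  | nil => simp
  | @cons y X ε ε' hy hX ih =>
    rw [symProd_cons, A.adSym_mul (cls_mem_degCls x)]
    refine add_mem ?_ (Submodule.smul_mem _ _ ?_)
    · convert symι_mul_symProd_mem_homSym
        (A.lieCls_mem_homCls hr (cls_mem_homCls hx) (cls_mem_homCls hy)) hX using 2
      abel
    · convert symι_mul_mem_homSym (cls_mem_homCls hy) ih using 2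
      abel

theorem lieSym_symProd_mem
    (hr : ∀ {a b : Letter A.grade} {δ ε : D}, r a δ → r b ε → r (A.bracketLetter a b) (δ + ε + μ))
    {X : List (List (Letter A.grade))} (hX : ProdHasDeg r X δ) :
    A.lieSym (symProd X) ∈ homSym r (δ + μ) := by
  induction hX with
  | nil => simp
  | @cons x X δ ε hx hX ih =>
    rw [symProd_cons, A.lieSym_mul (cls_mem_degCls x)]
    refine add_mem (A.adSym_symProd_mem hr hx hX) (Submodule.smul_mem _ _ ?_)
    convert symι_mul_mem_homSym (cls_mem_homCls hx) ih using 2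
    abel

/-- The boundary changes a degree by `μ` if the product and the bracket of `G` do. -/
theorem boundary_mem_homSym
    (hr : ∀ {a b : Letter A.grade} {δ ε : D}, r a δ → r b ε → r (A.mulLetter a b) (δ + ε + μ))
    (hr' : ∀ {a b : Letter A.grade} {δ ε : D}, r a δ → r b ε → r (A.bracketLetter a b) (δ + ε + μ))
    {z : SymH A.grade} (hz : z ∈ homSym r δ) :
    (A.mulSym + A.lieSym) z ∈ homSym r (δ + μ) := by
  have : homSym r δ ≤ (homSym r (δ + μ)).comap (A.mulSym + A.lieSym) :=
    Submodule.span_le.2 (by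
      rintro _ ⟨X, -, hX, rfl⟩
      exact add_mem (A.mulSym_symProd_mem hr hX) (A.lieSym_symProd_mem hr' hX))
  exact this hz

theorem wordHasDeg_true (w : List (Letter A.grade)) :
    WordHasDeg (fun _ (_ : PUnit) => True) w 0 := by
  induction w with
  | nil => exact .nil
  | cons a w ih => exact .cons (δ := 0) trivial ih

theorem prodHasDeg_true (X : List (List (Letter A.grade))) :
    ProdHasDeg (fun _ (_ : PUnit) => True) X 0 := by
  induction X with
  | nil => exact .nil
  | cons x X ih => exact .cons (A.wordHasDeg_true x) ih

theorem homSym_true : homSym (fun (_ : Letter A.grade) (_ : PUnit) => True) 0 = A.gInf := by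
  simp only [homSym, gInf, A.prodHasDeg_true, true_and]

theorem boundary_mem_gInf {z : SymH A.grade} (hz : z ∈ A.gInf) :
    (A.mulSym + A.lieSym) z ∈ A.gInf := by
  rw [← homSym_true] at hz ⊢
  exact A.boundary_mem_homSym (μ := 0) (fun _ _ => trivial) (fun _ _ => trivial) hz

/-- The degree is the number of letters, valued in `ℤ` so that the boundary can have degree `-1`. -/
theorem homSym_length (N : ℕ) :
    homSym (fun (_ : Letter A.grade) (n : ℤ) => n = 1) (N : ℤ) = A.chains N := by
  apply le_antisymm
  · refine Submodule.span_le.2 ?_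
    rintro _ ⟨X, h0, hX, rfl⟩
    -- Empty words are not excluded by the degree, but their class is zero because scalars are among
    -- the relations.
    by_cases h : [] ∈ X
    · rw [symProd_eq_zero h]; exact zero_mem _
    · exact Submodule.subset_span ⟨X, h0, fun x hx hx' => h (hx' ▸ hx),
        by exact_mod_cast hX.length_eq, rfl⟩
  · refine Submodule.span_le.2 ?_
    rintro _ ⟨X, h0, -, rfl, rfl⟩
    exact symProd_mem_homSym h0 (prodHasDeg_length X)

theorem boundary_mem_chains {N : ℕ} {z : SymH A.grade} (hz : z ∈ A.chains (N + 1)) :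
    (A.mulSym + A.lieSym) z ∈ A.chains N := by
  rw [← homSym_length] at hz ⊢
  have := A.boundary_mem_homSym (μ := -1) (by rintro _ _ _ _ rfl rfl; norm_num)
    (by rintro _ _ _ _ rfl rfl; norm_num) hz
  simpa using this

end GerstenhaberAlgebra

/-! ### The bidegree counting letters in `M`, and the subcomplex -/

namespace GerstenhaberModule

variable {G M : Type*} [AddCommGroup G] [Module ℝ G] [AddCommGroup M] [Module ℝ M]
  {A : GerstenhaberAlgebra G} (P : GerstenhaberModule A M)

/-- The pairs `(1, k)` where `k` is the number of letters from `M`: a letter from `G` has `k = 0`,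
a letter from `M` has `k = 1`, and only `0` has `k ≥ 2`. -/
def HasBidegree (a : Letter P.semidirect.grade) (δ : ℤ × ℕ) : Prop :=
  δ.1 = 1 ∧ (δ.2 ≠ 1 → (a.2 : G × M).2 = 0) ∧ (δ.2 ≠ 0 → (a.2 : G × M).1 = 0)

variable {P}

/-- Two letters become one, hence the shift `(-1, 0)`. The number of letters in `M` is additive
because the product of two elements of `M` vanishes and zero is allowed every count. -/
theorem HasBidegree.mulLetter {a b : Letter P.semidirect.grade} {δ ε : ℤ × ℕ}
    (ha : P.HasBidegree a δ) (hb : P.HasBidegree b ε) :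
    P.HasBidegree (P.semidirect.mulLetter a b) (δ + ε + (-1, 0)) := by
  obtain ⟨n, k⟩ := δ
  obtain ⟨n', k'⟩ := ε
  obtain ⟨h1, h2, h3⟩ := ha
  obtain ⟨h1', h2', h3'⟩ := hb
  refine ⟨by simp_all, fun h => ?_, fun h => ?_⟩ <;>
    simp only [GerstenhaberAlgebra.mulLetter, semidirect, sdMul_apply, Prod.snd_add, add_zero] at *
  · rcases Nat.eq_zero_or_pos k with hk | hk <;> rcases Nat.eq_zero_or_pos k' with hk' | hk'
    · rw [h2 (by omega), h2' (by omega)]; simp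
    · rw [h2 (by omega), h2' (by omega)]; simp
    · rw [h2 (by omega), h2' (by omega)]; simp
    · rw [h3 (by omega), h3' (by omega)]; simp
  · by_cases hk : k = 0
    · rw [h3' (by omega)]; simp
    · rw [h3 hk]; simp

theorem HasBidegree.bracketLetter {a b : Letter P.semidirect.grade} {δ ε : ℤ × ℕ}
    (ha : P.HasBidegree a δ) (hb : P.HasBidegree b ε) :
    P.HasBidegree (P.semidirect.bracketLetter a b) (δ + ε + (-1, 0)) := by
  obtain ⟨n, k⟩ := δ
  obtain ⟨n', k'⟩ := ε
  obtain ⟨h1, h2, h3⟩ := ha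
  obtain ⟨h1', h2', h3'⟩ := hb
  refine ⟨by simp_all, fun h => ?_, fun h => ?_⟩ <;>
    simp only [GerstenhaberAlgebra.bracketLetter, semidirect, sdBracket_apply, Prod.snd_add,
      add_zero] at *
  · rcases Nat.eq_zero_or_pos k with hk | hk <;> rcases Nat.eq_zero_or_pos k' with hk' | hk'
    · rw [h2 (by omega), h2' (by omega)]; simp
    · rw [h2 (by omega), h2' (by omega)]; simp
    · rw [h2 (by omega), h2' (by omega)]; simp
    · rw [h3 (by omega), h3' (by omega)]; simp
  · by_cases hk : k = 0
    · rw [h3' (by omega)]; simp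
    · rw [h3 hk]; simp

theorem hasBidegree_inG (a : Letter A.grade) : P.HasBidegree (P.inG a) (1, 0) :=
  ⟨rfl, fun _ => rfl, fun h => (h rfl).elim⟩

theorem hasBidegree_inM (v : Letter P.grade) : P.HasBidegree (P.inM v) (1, 1) :=
  ⟨rfl, fun h => (h rfl).elim, fun _ => rfl⟩

theorem HasBidegree.exists_inG {a : Letter P.semidirect.grade} {n : ℤ}
    (h : P.HasBidegree a (n, 0)) : ∃ b, a = P.inG b := by
  obtain ⟨i, ⟨⟨b, v⟩, hb, hv⟩⟩ := a
  obtain rfl : v = 0 := h.2.1 (by simp)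
  exact ⟨⟨i, b, hb⟩, rfl⟩

theorem HasBidegree.exists_inM {a : Letter P.semidirect.grade} {n : ℤ}
    (h : P.HasBidegree a (n, 1)) : ∃ v, a = P.inM v := by
  obtain ⟨i, ⟨⟨b, v⟩, hb, hv⟩⟩ := a
  obtain rfl : b = 0 := h.2.2 (by simp)
  exact ⟨⟨i, v, hv⟩, rfl⟩

theorem wordHasDeg_gWord (x : List (Letter A.grade)) :
    WordHasDeg P.HasBidegree (P.gWord x) ((x.length : ℤ), 0) := by
  induction x with
  | nil => exact .nil
  | cons a x ih =>
    have := WordHasDeg.cons (P.hasBidegree_inG a) ih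
    simpa [gWord, add_comm] using this

theorem wordHasDeg_mWord (y : List (Letter A.grade)) (v : Letter P.grade)
    (y' : List (Letter A.grade)) :
    WordHasDeg P.HasBidegree (P.mWord y v y') ((y.length : ℤ) + y'.length + 1, 1) := by
  induction y with
  | nil =>
    have := WordHasDeg.cons (P.hasBidegree_inM v) (P.wordHasDeg_gWord y')
    simpa [mWord, gWord, add_comm] using this
  | cons a y ih =>
    have := WordHasDeg.cons (P.hasBidegree_inG a) ih
    simp only [mWord, gWord, List.map_cons, List.cons_append, List.length_cons] at this ⊢
    convert this using 1
    simp only [Prod.mk_add_mk, Prod.mk.injEq]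
    push_cast
    exact ⟨by ring, trivial⟩

theorem exists_gWord {w : List (Letter P.semidirect.grade)} {δ : ℤ × ℕ}
    (h : WordHasDeg P.HasBidegree w δ) (hδ : δ.2 = 0) :
    ∃ x, w = P.gWord x ∧ (x.length : ℤ) = δ.1 := by
  induction h with
  | nil => exact ⟨[], rfl, rfl⟩
  | @cons a w δ ε ha _ ih =>
    obtain ⟨n, k⟩ := δ
    simp only [Prod.snd_add] at hδ
    obtain rfl : k = 0 := by omega
    obtain ⟨b, rfl⟩ := ha.exists_inG
    obtain ⟨x, rfl, hx⟩ := ih (by omega)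
    have := ha.1
    exact ⟨b :: x, rfl, by simp_all [add_comm]⟩

theorem exists_mWord {w : List (Letter P.semidirect.grade)} {δ : ℤ × ℕ}
    (h : WordHasDeg P.HasBidegree w δ) (hδ : δ.2 = 1) :
    ∃ y v y', w = P.mWord y v y' ∧ (y.length : ℤ) + y'.length + 1 = δ.1 := by
  induction h with
  | nil => simp at hδ
  | @cons a w δ ε ha hw ih =>
    obtain ⟨n, k⟩ := δ
    obtain rfl : n = 1 := ha.1
    simp only [Prod.snd_add] at hδ
    obtain rfl | rfl : k = 0 ∨ k = 1 := by omega
    · obtain ⟨b, rfl⟩ := ha.exists_inG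
      obtain ⟨y, v, y', rfl, hy⟩ := ih (by omega)
      exact ⟨b :: y, v, y', rfl, by rw [Prod.fst_add, ← hy, List.length_cons]; push_cast; ring⟩
    · obtain ⟨v, rfl⟩ := ha.exists_inM
      obtain ⟨x, rfl, hx⟩ := exists_gWord hw (by omega)
      exact ⟨[], v, x, rfl, by rw [Prod.fst_add, ← hx, List.length_nil]; push_cast; ring⟩

theorem exists_map_gWord {X : List (List (Letter P.semidirect.grade))} {δ : ℤ × ℕ}
    (h : ProdHasDeg P.HasBidegree X δ) (hδ : δ.2 = 0) :
    ∃ X' : List (List (Letter A.grade)), X = X'.map P.gWord ∧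
      ((X'.map List.length).sum : ℤ) = δ.1 := by
  induction h with
  | nil => exact ⟨[], rfl, rfl⟩
  | @cons x X δ ε hx _ ih =>
    simp only [Prod.snd_add] at hδ
    obtain ⟨x, rfl, hlen⟩ := exists_gWord hx (by omega)
    obtain ⟨X, rfl, hX⟩ := ih (by omega)
    exact ⟨x :: X, rfl, by rw [Prod.fst_add, ← hlen, ← hX]; simp⟩

theorem gWord_mul_mem_moduleChains (x : List (Letter A.grade)) {N : ℕ}
    {z : SymH P.semidirect.grade} (hz : z ∈ P.moduleChains N) :
    symι _ (cls (P.gWord x)) * z ∈ P.moduleChains (x.length + N) := by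
  rcases eq_or_ne x [] with rfl | h0
  · simp [gWord]
  have : P.moduleChains N ≤ (P.moduleChains (x.length + N)).comap
      (LinearMap.mulLeft ℝ (symι _ (cls (P.gWord x)))) := Submodule.span_le.2 (by
    rintro _ ⟨X, y, v, y', hX, rfl, rfl⟩
    refine Submodule.subset_span ⟨x :: X, y, v, y', ?_, by simp; ring, ?_⟩
    · simpa [h0] using hX
    · rw [List.map_cons, symProd_cons (P.gWord x), LinearMap.mulLeft_apply, mul_assoc])
  exact this hz

theorem symProd_mul_mem_moduleChains (X : List (List (Letter A.grade)))
    (y : List (Letter A.grade)) (v : Letter P.grade) (y' : List (Letter A.grade)) :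
    symProd (X.map P.gWord) * symProd [P.mWord y v y'] ∈
      P.moduleChains ((X.map List.length).sum + (y.length + y'.length)) := by
  induction X with
  | nil => exact Submodule.subset_span ⟨[], y, v, y', by simp, by simp, rfl⟩
  | cons x X ih =>
    have := gWord_mul_mem_moduleChains x ih
    rw [List.map_cons, List.map_cons, symProd_cons (P.gWord x), mul_assoc, List.sum_cons,
      add_assoc]
    exact this

theorem symι_mul_symProd (y : List (Letter P.semidirect.grade))
    (X : List (List (Letter P.semidirect.grade))) : ∃ c : ℝ,
      symι _ (cls y) * symProd X = c • (symProd X * symι _ (cls y)) := by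
  induction X with
  | nil => exact ⟨1, by simp⟩
  | cons x X ih =>
    obtain ⟨c, hc⟩ := ih
    exact ⟨_, by rw [symProd_cons, symι_comm_mul (cls_mem_degCls y), hc, mul_smul_comm, smul_smul,
      mul_assoc]⟩

/-- Exactly one factor contains the letter of `M`, and graded commutativity moves it to the end at
the cost of a scalar. -/
theorem symProd_mem_moduleChains {X : List (List (Letter P.semidirect.grade))} {δ : ℤ × ℕ}
    (h : ProdHasDeg P.HasBidegree X δ) (hδ : δ.2 = 1) :
    ∃ N : ℕ, δ.1 = N + 1 ∧ symProd X ∈ P.moduleChains N := by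
  induction h with
  | nil => simp at hδ
  | @cons x X δ ε hx hX ih =>
    simp only [Prod.snd_add, Prod.fst_add] at hδ ⊢
    obtain hk | hk : δ.2 = 0 ∨ δ.2 = 1 := by omega
    · obtain ⟨x, rfl, hlen⟩ := exists_gWord hx hk
      obtain ⟨N, hN, hX⟩ := ih (by omega)
      refine ⟨x.length + N, by rw [← hlen, hN]; push_cast; ring, ?_⟩
      rw [symProd_cons]
      exact gWord_mul_mem_moduleChains x hX
    · obtain ⟨y, v, y', rfl, hy⟩ := exists_mWord hx hk
      obtain ⟨X, rfl, hlen⟩ := exists_map_gWord hX (by omega)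
      refine ⟨(X.map List.length).sum + (y.length + y'.length), ?_, ?_⟩
      · rw [← hy, ← hlen]; push_cast; ring
      · obtain ⟨c, hc⟩ := symι_mul_symProd (P.mWord y v y') (X.map P.gWord)
        rw [symProd_cons, hc]
        have := symProd_mul_mem_moduleChains X y v y'
        rw [symProd_cons, symProd_nil, mul_one] at this
        exact Submodule.smul_mem _ _ this

theorem prodHasDeg_moduleChains (X : List (List (Letter A.grade)))
    (y : List (Letter A.grade)) (v : Letter P.grade) (y' : List (Letter A.grade)) :
    ProdHasDeg P.HasBidegree (X.map P.gWord ++ [P.mWord y v y'])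
      ((((X.map List.length).sum + (y.length + y'.length) : ℕ) : ℤ) + 1, 1) := by
  induction X with
  | nil => simpa using ProdHasDeg.cons (P.wordHasDeg_mWord y v y') .nil
  | cons x X ih =>
    have := ProdHasDeg.cons (P.wordHasDeg_gWord x) ih
    simp only [List.map_cons, List.cons_append, List.sum_cons] at this ⊢
    convert this using 1
    simp only [Prod.mk_add_mk, Prod.mk.injEq]
    push_cast
    exact ⟨by ring, trivial⟩

variable (P)

theorem moduleChains_le_homSym (N : ℕ) :
    P.moduleChains N ≤ homSym P.HasBidegree ((N : ℤ) + 1, 1) := by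
  refine Submodule.span_le.2 ?_
  rintro _ ⟨X, y, v, y', -, rfl, rfl⟩
  rw [← symProd_append]
  exact symProd_mem_homSym (by simp) (prodHasDeg_moduleChains X y v y')

theorem homSym_le_moduleChains (N : ℕ) :
    homSym P.HasBidegree ((N : ℤ) + 1, 1) ≤ P.moduleChains N := by
  refine Submodule.span_le.2 ?_
  rintro _ ⟨X, -, hX, rfl⟩
  obtain ⟨N', hN, h⟩ := symProd_mem_moduleChains hX rfl
  obtain rfl : N = N' := by simpa using hN
  exact h

/-- One letter in `M` forces at least one letter in total. This is why the boundary vanishes on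
chains without letters in `G`. -/
theorem homSym_zero_one : homSym P.HasBidegree (0, 1) = ⊥ := by
  rw [eq_bot_iff]
  refine Submodule.span_le.2 ?_
  rintro _ ⟨X, -, hX, rfl⟩
  obtain ⟨N, hN, -⟩ := symProd_mem_moduleChains hX rfl
  simp only at hN
  omega

theorem boundary_mem_homSym {n : ℤ} {k : ℕ} {z : SymH P.semidirect.grade}
    (hz : z ∈ homSym P.HasBidegree (n + 1, k)) :
    (P.semidirect.mulSym + P.semidirect.lieSym) z ∈ homSym P.HasBidegree (n, k) := by
  simpa using P.semidirect.boundary_mem_homSym HasBidegree.mulLetter HasBidegree.bracketLetter hz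

theorem boundary_mem_moduleChains {N : ℕ} {z : SymH P.semidirect.grade}
    (hz : z ∈ P.moduleChains (N + 1)) :
    (P.semidirect.mulSym + P.semidirect.lieSym) z ∈ P.moduleChains N :=
  P.homSym_le_moduleChains N (P.boundary_mem_homSym
    (by simpa using P.moduleChains_le_homSym (N + 1) hz))

theorem boundary_moduleChains_zero {z : SymH P.semidirect.grade} (hz : z ∈ P.moduleChains 0) :
    (P.semidirect.mulSym + P.semidirect.lieSym) z = 0 := by
  have := P.boundary_mem_homSym (P.moduleChains_le_homSym 0 hz)
  rwa [Nat.cast_zero, homSym_zero_one, Submodule.mem_bot] at this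

theorem moduleChains_le_chains (N : ℕ) : P.moduleChains N ≤ P.semidirect.chains (N + 1) := by
  refine Submodule.span_le.2 ?_
  rintro _ ⟨X, y, v, y', hX, rfl, rfl⟩
  refine Submodule.subset_span ⟨X.map P.gWord ++ [P.mWord y v y'], by simp, ?_, ?_,
    (symProd_append _ _).symm⟩
  · intro x hx
    simp only [List.mem_append, List.mem_map, List.mem_singleton] at hx
    rcases hx with ⟨x, hx, rfl⟩ | rfl
    · simpa [gWord] using hX x hx
    · simp [mWord]
  · have : List.length ∘ P.gWord = List.length := by ext x; simp [gWord]
    simp [this, mWord, gWord]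
    ring

end GerstenhaberModule

theorem mainTheorem6 {G M : Type*} [AddCommGroup G] [Module ℝ G] [AddCommGroup M] [Module ℝ M]
    (A : GerstenhaberAlgebra G) (P : GerstenhaberModule A M) :
    ∃ m l : SymH P.semidirect.grade →ₗ[ℝ] SymH P.semidirect.grade,
      -- `m` and `l` are the two well-defined operators of `G_∞(G ⋉ M)`
      (P.semidirect.IsProductExtension m ∧
        ∀ m', P.semidirect.IsProductExtension m' → m' = m) ∧
      (P.semidirect.IsBracketExtension l ∧
        ∀ l', P.semidirect.IsBracketExtension l' → l' = l) ∧
      -- `G_∞(G ⋉ M)` with `m + l` is a complex, with components `C_N(G ⋉ M)`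
      (∀ z ∈ P.semidirect.gInf, (m + l) z ∈ P.semidirect.gInf) ∧
      (m + l) ∘ₗ (m + l) = 0 ∧
      (∀ N, ∀ z ∈ P.semidirect.chains (N + 1), (m + l) z ∈ P.semidirect.chains N) ∧
      -- the `C_N(G, M)` form a subcomplex
      (∀ N, P.moduleChains N ≤ P.semidirect.chains (N + 1)) ∧
      (∀ N, ∀ z ∈ P.moduleChains (N + 1), (m + l) z ∈ P.moduleChains N) ∧
      (∀ z ∈ P.moduleChains 0, (m + l) z = 0) ∧
      -- explicit form of the boundary on `X₁ · ⋯ · X_r · Y`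
      (∀ (X : List (List (Letter A.grade))) (y : List (Letter A.grade)) (v : Letter P.grade)
        (y' : List (Letter A.grade)),
        (m + l) (symProd (X.map P.gWord) * symProd [P.mWord y v y']) =
          (l + m) (symProd (X.map P.gWord)) * symProd [P.mWord y v y']
          + ((-1 : ℝ) ^ ((X.map P.gWord).map wordDeg).sum) •
              (symProd (X.map P.gWord) * P.semidirect.mBlock (P.mWord y v y'))
          + ∑ i : Fin X.length,
              ((-1 : ℝ) ^ (((X.eraseIdx i).map P.gWord).map wordDeg).sum *
                (-1 : ℝ) ^ (wordDeg (P.gWord (X.get i)) *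
                  (((X.drop (i + 1)).map P.gWord).map wordDeg).sum)) •
                (symProd ((X.eraseIdx i).map P.gWord) *
                  P.semidirect.lBlock (P.gWord (X.get i)) (P.mWord y v y'))) := by
  have hm := P.semidirect.isProductExtension_mulSym
  have hl := P.semidirect.isBracketExtension_lieSym
  refine ⟨P.semidirect.mulSym, P.semidirect.lieSym, ⟨hm, fun m' h => h.unique _ hm⟩,
    ⟨hl, fun l' h => h.unique _ hl⟩, fun z hz => P.semidirect.boundary_mem_gInf hz,
    P.semidirect.boundary_comp_boundary, fun N z hz => P.semidirect.boundary_mem_chains hz,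
    P.moduleChains_le_chains, fun N z hz => P.boundary_mem_moduleChains hz,
    fun z hz => P.boundary_moduleChains_zero hz, fun X y v y' => ?_⟩
  -- Both operators have been expanded with `Y` as last factor, so only a regrouping of sums
  -- remains.
  rw [symProd_cons, symProd_nil, mul_one, LinearMap.add_apply, LinearMap.add_apply,
    P.semidirect.mulSym_symProd_mul, P.semidirect.lieSym_map_symProd_mul, add_mul]
  abel

end
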